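/- **Conventions.** Let $p$ be a prime. A *discrete $p$-toral group* is a group $S$ with a normal subgroup isomorphic to $(\mathbb Z/p^\infty)^r$ for some $r\ge 0$ whose index is finite and a power of $p$. Let $\mathcal F$ be a saturated fusion system over $S$, and let $\mathcal L$ be a linking system associated to $\mathcal F$: a category whose objects form a set of subgroups of $S$ which is closed under $\mathcal F$-conjugacy and overgroups and contains all $\mathcal F$-centric $\mathcal F$-radical subgroups, together with functors $\mathcal T_{\mathrm{Ob}(\mathcal L)}(S)\xrightarrow{\delta}\mathcal L\xrightarrow{\pi}\mathcal F$ (the identity, respectively the inclusion, on objects), where $\mathcal T_{\mathrm{Ob}(\mathcal L)}(S)$ is the transporter category, such that: every object is isomorphic in $\mathcal L$ to one which is fully centralized in $\mathcal F$; if $P$ is fully centralized then $C_S(P)$ acts freely on $\mathrm{Mor}_{\mathcal L}(P,Q)$ via $\delta$ and right composition, with $\pi$ inducing a bijection $\mathrm{Mor}_{\mathcal L}(P,Q)/C_S(P)\cong\mathrm{Hom}_{\mathcal F}(P,Q)$; $\pi(\delta_{P,Q}(g))=c_g$; and $\psi\circ\delta_P(g)=\delta_Q(\pi(\psi)(g))\circ\psi$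 for $\psi\in\mathrm{Mor}_{\mathcal L}(P,Q)$ and $g\in P$. Such $(S,\mathcal F,\mathcal L)$ is called a *linking triple*. Inclusions in $\mathcal L$ are the morphisms $\delta_{P,Q}(1)$ for $P\le Q$. Put $\Gamma=\mathrm{Aut}_{\mathcal L}(S)$; elements of $\Gamma$ have unique restrictions to the objects of $\mathcal L$. $\mathrm{Aut}_{\mathrm{typ}}^I(\mathcal L)$ is the group of automorphisms $\alpha$ of the category $\mathcal L$ which send inclusions to inclusions and satisfy $\alpha(\delta_P(P))=\delta_{\alpha(P)}(\alpha(P))$ for all $P$. For $\gamma\in\Gamma$, $c_\gamma\in\mathrm{Aut}_{\mathrm{typ}}^I(\mathcal L)$ sends $P$ to $\pi(\gamma)(P)$ and $\varphi$ to $\gamma\varphi\gamma^{-1}$ (composition with restrictions of $\gamma^{\pm1}$). $\mathcal{A}ut_{\mathrm{typ}}(\mathcal L)$ is the groupoid with object set $\mathrm{Aut}_{\mathrm{typ}}^I(\mathcal L)$ whose morphisms are the natural transformations; a natural transformation is identified with its value at $S$, so $\mathrm{Mor}(\alpha,\beta)=\{\chi\in\Gamma\mid\beta=c_\chi\circ\alpha\}$.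 The nerve $\mathcal N\mathcal C$ of a category has as $n$-simplices the sequences $c_0\leftarrow c_1\leftarrow\dots\leftarrow c_n$, and $d_i$ omits $c_i$. $\mathcal N\mathcal{A}ut_{\mathrm{typ}}(\mathcal L)$ is a simplicial group through $(\alpha\xrightarrow{\chi}\beta)\cdot(\alpha'\xrightarrow{\chi'}\beta')=(\alpha\alpha'\xrightarrow{\chi\circ\alpha(\chi')}\beta\beta')$, and it acts on $\mathcal N\mathcal L$ through $(\alpha\xrightarrow{\chi}\beta)(P\xrightarrow{\varphi}Q)=(\alpha(P)\xrightarrow{\chi_Q\circ\alpha(\varphi)}\beta(Q))$. Let $G$ be a finite group and let $\mathcal B(G)$ be the category with one object and automorphism group $G$. An *extension pair* $U=(\widehat\Gamma,\tau)$ for $\mathcal L$ and $G$ consists of an extension $1\to\Gamma\to\widehat\Gamma\xrightarrow{\rho}G\to1$ and a homomorphism $\tau:\widehat\Gamma\to\mathrm{Aut}_{\mathrm{typ}}^I(\mathcal L)$ such that $\tau(\lambda)=c_\lambda$ and $\tau(\gamma)(\lambda)=\gamma\lambda\gamma^{-1}$ for all $\lambda\in\Gamma$, $\gamma\in\widehat\Gamma$.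 A *regular section* is a map of sets $t:G\to\widehat\Gamma$ with $\rho\circ t=\mathrm{id}$ and $t(1)=1$. The category $\mathcal L_U$ has the objects of $\mathcal L$; a morphism $P\to Q$ is a class $[\![\varphi,\gamma]\!]$ of pairs with $\gamma\in\widehat\Gamma$ and $\varphi\in\mathrm{Mor}_{\mathcal L}(\tau(\gamma)(P),Q)$, where $(\varphi,\gamma)\sim(\varphi\lambda,\lambda^{-1}\gamma)$ for $\lambda\in\Gamma$; composition is $[\![\psi,\eta]\!]\circ[\![\varphi,\gamma]\!]=[\![\psi\circ\tau(\eta)(\varphi),\eta\gamma]\!]$. Let $\mathrm{pr}_U:\mathcal L_U\to\mathcal B(G)$ be the functor $[\![\varphi,\gamma]\!]\mapsto\rho(\gamma)$. A *twisting function* $\phi$ from a simplicial set $X$ to a simplicial group $K$ is a family of maps $\phi_n:X_n\to K_{n-1}$ $(n\ge1)$ with $\phi_{n-1}(d_ix)=d_{i-1}\phi_n(x)$ for $2\le i\le n$, $\phi_{n-1}(d_1x)=d_0\phi_n(x)\cdot\phi_{n-1}(d_0x)$, $\phi_{n+1}(s_ix)=s_{i-1}\phi_n(x)$ for $i\ge1$,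 and $\phi_{n+1}(s_0x)=1$. For a twisting function $\phi:\mathcal N\mathcal B(G)\to\mathcal N\mathcal{A}ut_{\mathrm{typ}}(\mathcal L)$, the *twisted cartesian product* $E(\phi)$ is the simplicial set with $E(\phi)_n=\mathcal N_n\mathcal L\times\mathcal N_n\mathcal B(G)$, $d_0(\xi,\mathbf g)=(\phi_n(\mathbf g)^{-1}\cdot d_0\xi,d_0\mathbf g)$, $d_i(\xi,\mathbf g)=(d_i\xi,d_i\mathbf g)$ for $i>0$ and $s_i(\xi,\mathbf g)=(s_i\xi,s_i\mathbf g)$, and $p_\phi:E(\phi)\to\mathcal N\mathcal B(G)$ is the projection. **Proposition 6.5.** Let $(S,\mathcal F,\mathcal L)$ be a linking triple, $G$ a finite group, and $U=(\widehat\Gamma,\tau)$ an extension pair for $\mathcal L$ and $G$ with a regular section $t:G\to\widehat\Gamma$. There is a unique twisting function $\phi=\phi_U:\mathcal N\mathcal B(G)\to\mathcal N\mathcal{A}ut_{\mathrm{typ}}(\mathcal L)$ such that $\phi_1([g])=\tau(t(g))$ and $t(g)\,t(h)=\phi_2([g|h])\,t(gh)$ for all $g,h\in G$ (the edge $\phi_2([g|h])$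 being regarded as an element of $\Gamma$), and there is an isomorphism of simplicial sets $$\mathcal N\mathcal L_U\;\cong\;E(\phi_U)$$ which commutes with the projections $\mathcal N(\mathrm{pr}_U)$ and $p_{\phi_U}$ to $\mathcal N\mathcal B(G)$. Moreover $|\mathrm{pr}_U|:|\mathcal L_U|\to BG=|\mathcal N\mathcal B(G)|$ is a fibre bundle with fibre $|\mathcal L|$ and structure group $|\mathcal{A}ut_{\mathrm{typ}}(\mathcal L)|$: there are an open cover $\{U_i\}$ of $BG$, homeomorphisms $|\mathrm{pr}_U|^{-1}(U_i)\cong U_i\times|\mathcal L|$ over $U_i$, and continuous maps $g_{ij}:U_i\cap U_j\to|\mathcal{A}ut_{\mathrm{typ}}(\mathcal L)|$ satisfying the cocycle condition $g_{ij}g_{jk}=g_{ik}$ on $U_i\cap U_j\cap U_k$, such that the coordinate changes from the $j$-th to the $i$-th trivialization are $(b,y)\mapsto(b,g_{ij}(b)\cdot y)$. Here products of spaces are taken in the category of compactly generated spaces, and the multiplication of $|\mathcal{A}ut_{\mathrm{typ}}(\mathcal L)|$ and its action on $|\mathcal L|$ are the realizations of the simplicial ones. -/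

import Mathlib

open CategoryTheory Opposite Simplicial MonoidalCategory

universe u

noncomputable section

/-! ## Discrete `p`-toral groups -/

/-- The Pruefer group `ℤ/p^∞`: the group of complex roots of unity of `p`-power order. -/
abbrev PrueferGroup (p : ℕ) [Fact p.Prime] : Type := CommGroup.primaryComponent ℂˣ p

/-- `P` is a discrete `p`-toral group of rank `a.1` with `|π₀ P| = a.2`: there is a normal
subgroup `P₀ ≅ (ℤ/p^∞)^(a.1)` whose quotient is a finite `p`-group of order `a.2`. -/
def HasPToralOrder (p : ℕ) [Fact p.Prime] (P : Type u) [Group P] (a : ℕ × ℕ) : Prop :=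
  ∃ P₀ : Subgroup P, P₀.Normal ∧ Nonempty (P₀ ≃* (Fin a.1 → PrueferGroup p)) ∧
    P₀.index = a.2 ∧ ∃ k : ℕ, a.2 = p ^ k

/-- Discrete `p`-toral groups. -/
def IsDiscretePToral (p : ℕ) [Fact p.Prime] (P : Type u) [Group P] : Prop :=
  ∃ a, HasPToralOrder p P a

open Classical in
/-- The order `(rank, |π₀|)` of a discrete `p`-toral group, in `ℕ²` ordered lexicographically
(with the value `(0, 0)` on groups which are not discrete `p`-toral). -/
def pToralOrder (p : ℕ) [Fact p.Prime] (P : Type u) [Group P] : ℕ ×ₗ ℕ :=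
  if h : IsDiscretePToral p P then toLex h.choose else toLex (0, 0)

/-! ## Fusion systems -/

/-- Conjugation by `g`, as a homomorphism `P → Q`, when `g P g⁻¹ ≤ Q`. -/
def conjHom {S : Type u} [Group S] (P Q : Subgroup S) (g : S)
    (h : ∀ x ∈ P, g * x * g⁻¹ ∈ Q) : P →* Q where
  toFun x := ⟨g * x * g⁻¹, h x x.2⟩
  map_one' := by ext; simp
  map_mul' x y := by ext; simp

/-- A fusion system over the group `S`: a category whose objects are the subgroups of `S`, whose
morphisms are injective homomorphisms, including those induced by conjugation in `S` (in
particular identities and inclusions), and in which each morphism is the composite of an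
isomorphism of the category followed by an inclusion. -/
structure FusionSystem (S : Type u) [Group S] where
  /-- the set of morphisms from `P` to `Q` -/
  Hom : ∀ P Q : Subgroup S, Set (P →* Q)
  conj_mem : ∀ (P Q : Subgroup S) (g : S) (h : ∀ x ∈ P, g * x * g⁻¹ ∈ Q), conjHom P Q g h ∈ Hom P Q
  injective : ∀ {P Q : Subgroup S} {f : P →* Q}, f ∈ Hom P Q → Function.Injective f
  comp_mem : ∀ {P Q R : Subgroup S} {f : P →* Q} {g : Q →* R},
    f ∈ Hom P Q → g ∈ Hom Q R → g.comp f ∈ Hom P R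
  factor : ∀ {P Q : Subgroup S} {f : P →* Q}, f ∈ Hom P Q →
    ∃ (R : Subgroup S) (hR : R ≤ Q) (e : P ≃* R), e.toMonoidHom ∈ Hom P R ∧
      e.symm.toMonoidHom ∈ Hom R P ∧ f = (Subgroup.inclusion hR).comp e.toMonoidHom

namespace FusionSystem

variable {S : Type u} [Group S] (F : FusionSystem S)

/-- `P` and `Q` are `F`-conjugate: isomorphic as objects of the category `F`. -/
def IsConj (P Q : Subgroup S) : Prop :=
  ∃ e : P ≃* Q, e.toMonoidHom ∈ F.Hom P Q ∧ e.symm.toMonoidHom ∈ F.Hom Q P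

/-- `P` is fully centralized in `F`. -/
def FullyCentralized (p : ℕ) [Fact p.Prime] (P : Subgroup S) : Prop :=
  ∀ Q : Subgroup S, F.IsConj P Q →
    pToralOrder p (Subgroup.centralizer (Q : Set S)) ≤
      pToralOrder p (Subgroup.centralizer (P : Set S))

/-- `P` is fully normalized in `F`. -/
def FullyNormalized (p : ℕ) [Fact p.Prime] (P : Subgroup S) : Prop :=
  ∀ Q : Subgroup S, F.IsConj P Q →
    pToralOrder p (Subgroup.normalizer (Q : Set S)) ≤
      pToralOrder p (Subgroup.normalizer (P : Set S))

lemma id_mem (P : Subgroup S) : MonoidHom.id P ∈ F.Hom P P := by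
  have h := F.conj_mem P P 1 (by simp)
  convert h using 1
  ext; simp [conjHom]

/-- The group `Aut_F(P)`. -/
def AutF (P : Subgroup S) : Subgroup (MulAut P) where
  carrier := {e | e.toMonoidHom ∈ F.Hom P P ∧ e.symm.toMonoidHom ∈ F.Hom P P}
  one_mem' := ⟨F.id_mem P, F.id_mem P⟩
  mul_mem' ha hb := ⟨F.comp_mem hb.1 ha.1, F.comp_mem ha.2 hb.2⟩
  inv_mem' ha := ⟨ha.2, ha.1⟩

/-- The group `Aut_S(P)` of automorphisms of `P` induced by conjugation by elements of
`N_S(P)`. -/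
def AutS (P : Subgroup S) : Subgroup (MulAut P) := P.normalizerMonoidHom.range

/-- The group `Inn(P)`. -/
def InnP (P : Subgroup S) : Subgroup (MulAut P) := (MulAut.conj : P →* MulAut P).range

instance (P : Subgroup S) : (InnP P).Normal where
  conj_mem := by
    rintro _ ⟨x, rfl⟩ g
    refine ⟨g x, ?_⟩
    ext y
    simp [MulAut.conj_apply, MulAut.mul_apply]

/-- The group `Out_F(P) = Aut_F(P) / Inn(P)`. -/
abbrev OutF (P : Subgroup S) : Type u := F.AutF P ⧸ (InnP P).subgroupOf (F.AutF P)

/-- The subgroup `Out_S(P) = Aut_S(P) / Inn(P)` of `Out_F(P)`. -/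
def OutS (P : Subgroup S) : Subgroup (F.OutF P) :=
  ((AutS P).subgroupOf (F.AutF P)).map (QuotientGroup.mk' ((InnP P).subgroupOf (F.AutF P)))

/-- The subgroup `N_φ` of all `g ∈ N_S(P)` such that `φ c_g φ⁻¹ ∈ Aut_S(φ(P))`. -/
def extensionDomain {P : Subgroup S} (φ : P →* (⊤ : Subgroup S)) : Subgroup S where
  carrier := {g | ∃ hg : g ∈ Subgroup.normalizer (P : Set S),
    ∃ h : S, ∀ x : P, ((φ (P.normalizerMonoidHom ⟨g, hg⟩ x) : (⊤ : Subgroup S)) : S) =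
      h * (φ x : S) * h⁻¹}
  one_mem' := ⟨one_mem _, 1, fun x => by
    have h1 : (⟨1, one_mem _⟩ : Subgroup.normalizer (P : Set S)) = 1 := rfl
    rw [h1, map_one]; simp⟩
  mul_mem' := by
    rintro a b ⟨ha, h, hh⟩ ⟨hb, k, hk⟩
    refine ⟨mul_mem ha hb, h * k, fun x => ?_⟩
    have h1 : (⟨a * b, mul_mem ha hb⟩ : Subgroup.normalizer (P : Set S)) = ⟨a, ha⟩ * ⟨b, hb⟩ := rfl
    rw [h1, map_mul, MulAut.mul_apply, hh, hk]
    group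
  inv_mem' := by
    rintro a ⟨ha, h, hh⟩
    refine ⟨inv_mem ha, h⁻¹, fun x => ?_⟩
    have h1 : (⟨a⁻¹, inv_mem ha⟩ : Subgroup.normalizer (P : Set S)) = ⟨a, ha⟩⁻¹ := rfl
    have h2 := hh ((P.normalizerMonoidHom ⟨a, ha⟩)⁻¹ x)
    rw [MulAut.apply_inv_self] at h2
    rw [h1, map_inv, h2]
    group

/-- The fusion system `F` over `S` is saturated. -/
structure IsSaturated (p : ℕ) [Fact p.Prime] : Prop where
  sylow : ∀ P : Subgroup S, F.FullyNormalized p P →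
    F.FullyCentralized p P ∧ Finite (F.OutF P) ∧ ∃ Q : Sylow p (F.OutF P), Q.toSubgroup = F.OutS P
  extend : ∀ (P : Subgroup S) (φ : P →* (⊤ : Subgroup S)), φ ∈ F.Hom P ⊤ →
    F.FullyCentralized p ((Subgroup.subtype ⊤).comp φ).range →
    ∃ ψ ∈ F.Hom (extensionDomain φ) ⊤,
      ∀ (x : S) (hx : x ∈ P) (hx' : x ∈ extensionDomain φ), ψ ⟨x, hx'⟩ = φ ⟨x, hx⟩
  union : ∀ P : ℕ → Subgroup S, Monotone P →
    ∀ φ : (⨆ n, P n : Subgroup S) →* (⊤ : Subgroup S),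
    (∀ n, φ.comp (Subgroup.inclusion (le_iSup P n)) ∈ F.Hom (P n) ⊤) → φ ∈ F.Hom (⨆ n, P n) ⊤

/-- `P` is `F`-centric: `C_S(Q) = Z(Q)` for all `Q` which are `F`-conjugate to `P`. -/
def IsCentric (P : Subgroup S) : Prop :=
  ∀ Q : Subgroup S, F.IsConj P Q → Subgroup.centralizer (Q : Set S) ≤ Q

/-- `P` is `F`-radical: `Out_F(P)` contains no nontrivial normal `p`-subgroup. -/
def IsRadical (p : ℕ) (P : Subgroup S) : Prop :=
  ∀ N : Subgroup (F.OutF P), N.Normal → IsPGroup p N → N = ⊥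

end FusionSystem
/-! ## Linking systems -/

/-- The objects of a linking system with object set `H`. -/
@[ext]
structure LObj {S : Type u} [Group S] (H : Set (Subgroup S)) : Type u where
  /-- the underlying subgroup of `S` -/
  grp : Subgroup S
  mem : grp ∈ H

/-- `g P g⁻¹ ≤ Q`, i.e. `g` is a morphism `P → Q` of the transporter category of `S`. -/
def Transports {S : Type u} [Group S] (g : S) (P Q : Subgroup S) : Prop :=
  ∀ x ∈ P, g * x * g⁻¹ ∈ Q

namespace Transports

variable {S : Type u} [Group S] {P Q R : Subgroup S} {g h : S}

lemma of_le (hPQ : P ≤ Q) : Transports 1 P Q := fun x hx => by simpa using hPQ hx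

lemma of_mem (hg : g ∈ P) : Transports g P P :=
  fun _ hx => mul_mem (mul_mem hg hx) (inv_mem hg)

lemma of_centralizer (hg : g ∈ Subgroup.centralizer (P : Set S)) : Transports g P P :=
  fun x hx => by
    have := Subgroup.mem_centralizer_iff.1 hg x hx
    rw [← this]; simpa using hx

lemma mul (hh : Transports h Q R) (hg : Transports g P Q) : Transports (h * g) P R :=
  fun x hx => by
    have := hh _ (hg x hx)
    convert this using 1; group

end Transports

/-- A linking system associated to the fusion system `F` over `S`: a category `L` whose objects
form a set `objs` of subgroups of `S`, with functors `δ : T_objs(S) → L` and `π : L → F` which are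
the identity (respectively, the inclusion) on objects.  (The requirement that there is at least
one object is automatic when `S` is discrete `p`-toral and `F` is saturated, since `S` itself is
then `F`-centric and `F`-radical.) -/
structure LinkingSystem (p : ℕ) [Fact p.Prime] {S : Type u} [Group S] (F : FusionSystem S) where
  /-- the set of objects -/
  objs : Set (Subgroup S)
  objs_nonempty : objs.Nonempty
  objs_conj : ∀ {P Q : Subgroup S}, P ∈ objs → F.IsConj P Q → Q ∈ objs
  objs_over : ∀ {P Q : Subgroup S}, P ∈ objs → P ≤ Q → Q ∈ objs
  objs_centric_radical : ∀ P : Subgroup S, F.IsCentric P → F.IsRadical p P → P ∈ objs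
  [cat : Category.{u} (LObj objs)]
  /-- the functor from the transporter category, on morphisms -/
  δ : ∀ (P Q : LObj objs) (g : S), Transports g P.grp Q.grp → (P ⟶ Q)
  δ_one : ∀ P : LObj objs, δ P P 1 (.of_le le_rfl) = 𝟙 P
  δ_mul : ∀ (P Q R : LObj objs) (g h : S) (hg : Transports g P.grp Q.grp)
    (hh : Transports h Q.grp R.grp), δ P R (h * g) (hh.mul hg) = δ P Q g hg ≫ δ Q R h hh
  /-- the functor to the fusion system, on morphisms -/
  π : ∀ {P Q : LObj objs}, (P ⟶ Q) → (P.grp →* Q.grp)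
  π_mem : ∀ {P Q : LObj objs} (ψ : P ⟶ Q), π ψ ∈ F.Hom P.grp Q.grp
  π_id : ∀ P : LObj objs, π (𝟙 P) = MonoidHom.id P.grp
  π_comp : ∀ {P Q R : LObj objs} (ψ : P ⟶ Q) (θ : Q ⟶ R), π (ψ ≫ θ) = (π θ).comp (π ψ)
  exists_fullyCentralized : ∀ P : LObj objs, ∃ Q : LObj objs,
    F.FullyCentralized p Q.grp ∧ Nonempty (P ≅ Q)
  /-- `C_S(P)` acts freely on the morphisms from `P` to `Q` -/
  free : ∀ P Q : LObj objs, F.FullyCentralized p P.grp → ∀ (ψ : P ⟶ Q) (g : S)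
    (hg : g ∈ Subgroup.centralizer (P.grp : Set S)),
    δ P P g (.of_centralizer hg) ≫ ψ = ψ → g = 1
  /-- `π` induces an injection on the set of orbits of `C_S(P)` -/
  π_eq_iff : ∀ P Q : LObj objs, F.FullyCentralized p P.grp → ∀ ψ ψ' : P ⟶ Q,
    π ψ = π ψ' ↔ ∃ (g : S) (hg : g ∈ Subgroup.centralizer (P.grp : Set S)),
      ψ' = δ P P g (.of_centralizer hg) ≫ ψ
  /-- `π` is surjective onto the morphisms of the fusion system -/
  π_surj : ∀ P Q : LObj objs, F.FullyCentralized p P.grp →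
    ∀ f ∈ F.Hom P.grp Q.grp, ∃ ψ : P ⟶ Q, π ψ = f
  π_δ : ∀ (P Q : LObj objs) (g : S) (hg : Transports g P.grp Q.grp),
    π (δ P Q g hg) = conjHom P.grp Q.grp g hg
  δ_comm : ∀ {P Q : LObj objs} (ψ : P ⟶ Q) (g : S) (hg : g ∈ P.grp),
    δ P P g (.of_mem hg) ≫ ψ = ψ ≫ δ Q Q (π ψ ⟨g, hg⟩) (.of_mem (π ψ ⟨g, hg⟩).2)

attribute [instance] LinkingSystem.cat

namespace LinkingSystem

variable {p : ℕ} [Fact p.Prime] {S : Type u} [Group S] {F : FusionSystem S}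
  (L : LinkingSystem p F)

/-- The category underlying the linking system. -/
abbrev Obj : Type u := LObj L.objs

/-- The object `S` of `L`. -/
def top : L.Obj := ⟨⊤, by
  obtain ⟨P, hP⟩ := L.objs_nonempty
  exact L.objs_over hP le_top⟩

/-- The inclusion morphism `ι_{P,Q} = δ_{P,Q}(1)`, for `P ≤ Q`. -/
def incl (P Q : L.Obj) (h : P.grp ≤ Q.grp) : P ⟶ Q := L.δ P Q 1 (.of_le h)

lemma grp_le_top (P : L.Obj) : P.grp ≤ L.top.grp := le_top

/-- The inclusion morphism of `P` in `S`. -/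
def inclTop (P : L.Obj) : P ⟶ L.top := L.incl P L.top (L.grp_le_top P)

/-- The group `Γ = Aut_L(S)`, with multiplication `γ * γ' = γ ∘ γ'`. -/
abbrev Gam : Type u := Aut L.top

variable {L}

@[simp] lemma incl_self (P : L.Obj) (h : P.grp ≤ P.grp) : L.incl P P h = 𝟙 P := L.δ_one P

@[simp] lemma incl_incl (P Q R : L.Obj) (h : P.grp ≤ Q.grp) (h' : Q.grp ≤ R.grp) :
    L.incl P Q h ≫ L.incl Q R h' = L.incl P R (h.trans h') := by
  have := L.δ_mul P Q R 1 1 (.of_le h) (.of_le h')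
  simp only [incl, ← this, mul_one]

@[simp] lemma incl_inclTop (P Q : L.Obj) (h : P.grp ≤ Q.grp) :
    L.incl P Q h ≫ L.inclTop Q = L.inclTop P := incl_incl _ _ _ _ _

lemma eqToHom_eq_incl {P Q : L.Obj} (h : P = Q) :
    eqToHom h = L.incl P Q (by rw [h]) := by
  subst h; simp

@[simp] lemma inclTop_top : L.inclTop L.top = 𝟙 _ := incl_self _ _

lemma π_incl_apply (P Q : L.Obj) (h : P.grp ≤ Q.grp) (x : P.grp) :
    (L.π (L.incl P Q h) x : S) = x := by
  simp [incl, L.π_δ, conjHom]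

lemma π_inclTop_apply (P : L.Obj) (x : P.grp) : (L.π (L.inclTop P) x : S) = x :=
  π_incl_apply _ _ _ _

lemma π_inclTop_eq (P : L.Obj) (x : P.grp) :
    L.π (L.inclTop P) x = ⟨x, L.grp_le_top P x.2⟩ := Subtype.ext (π_inclTop_apply P x)

lemma π_injective {P Q : L.Obj} (ψ : P ⟶ Q) : Function.Injective (L.π ψ) :=
  F.injective (L.π_mem ψ)

/-- All morphisms of a linking system are monomorphisms. -/
instance mono {P Q : L.Obj} (ψ : P ⟶ Q) : Mono ψ where
  right_cancellation := by
    intro Z a b hab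
    obtain ⟨Z', hZ', ⟨ω⟩⟩ := L.exists_fullyCentralized Z
    have h1 : L.π (ω.inv ≫ a) = L.π (ω.inv ≫ b) := by
      have h2 : L.π (a ≫ ψ) = L.π (b ≫ ψ) := by rw [hab]
      rw [L.π_comp, L.π_comp] at h2
      rw [L.π_comp, L.π_comp]
      ext x
      have := DFunLike.congr_fun h2 (L.π ω.inv x)
      exact congrArg Subtype.val (π_injective ψ this)
    obtain ⟨g, hg, hb⟩ := (L.π_eq_iff _ _ hZ' _ _).1 h1
    have h3 : L.δ Z' Z' g (.of_centralizer hg) ≫ (ω.inv ≫ a ≫ ψ) = ω.inv ≫ a ≫ ψ := by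
      rw [← Category.assoc ω.inv a ψ, ← Category.assoc, ← hb, Category.assoc, Category.assoc, hab]
    obtain rfl := L.free _ _ hZ' _ _ hg h3
    rw [L.δ_one, Category.id_comp] at hb
    simpa using hb.symm

/-- A morphism `ψ : P → Q` of a linking system restricts to (unique) morphisms `P₀ → Q₀` whenever
`P₀ ≤ P`, `Q₀ ≤ Q` and `π(ψ)` sends `P₀` into `Q₀`. -/
lemma exists_restriction {P Q : L.Obj} (ψ : P ⟶ Q) (P₀ Q₀ : L.Obj) (hP : P₀.grp ≤ P.grp)
    (hQ : Q₀.grp ≤ Q.grp)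
    (h : ∀ (x : S) (hx : x ∈ P₀.grp), (L.π ψ ⟨x, hP hx⟩ : S) ∈ Q₀.grp) :
    ∃ ψ₀ : P₀ ⟶ Q₀, ψ₀ ≫ L.incl Q₀ Q hQ = L.incl P₀ P hP ≫ ψ := by
  obtain ⟨Z, hZ, ⟨ω⟩⟩ := L.exists_fullyCentralized P₀
  let f := L.π (ω.inv ≫ L.incl P₀ P hP ≫ ψ)
  have hf : f ∈ F.Hom Z.grp Q.grp := L.π_mem _
  have hfQ : ∀ z, (f z : S) ∈ Q₀.grp := by
    intro z
    have h1 := h _ (L.π ω.inv z).2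
    simp only [f, L.π_comp, MonoidHom.comp_apply]
    convert h1 using 3
    ext
    exact π_incl_apply _ _ _ _
  obtain ⟨R, hR, e, he, -, hfe⟩ := F.factor hf
  have hRQ : ∀ x ∈ R, (1 : S) * x * 1⁻¹ ∈ Q₀.grp := by
    intro x hx
    have h2 := hfQ (e.symm ⟨x, hx⟩)
    rw [hfe] at h2
    simpa using h2
  have hf' : (conjHom R Q₀.grp 1 hRQ).comp e.toMonoidHom ∈ F.Hom Z.grp Q₀.grp :=
    F.comp_mem he (F.conj_mem _ _ _ _)
  obtain ⟨χ, hχ⟩ := L.π_surj Z Q₀ hZ _ hf'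
  have h3 : L.π (χ ≫ L.incl Q₀ Q hQ) = L.π (ω.inv ≫ L.incl P₀ P hP ≫ ψ) := by
    change _ = f
    rw [hfe, L.π_comp, hχ]
    ext z
    simp only [MonoidHom.comp_apply]
    rw [π_incl_apply]
    simp [conjHom]
  obtain ⟨g, hg, hb⟩ := (L.π_eq_iff _ _ hZ _ _).1 h3
  refine ⟨ω.hom ≫ L.δ Z Z g (.of_centralizer hg) ≫ χ, ?_⟩
  rw [Category.assoc, Category.assoc, ← hb]
  simp

/-! ### Restrictions of elements of `Aut_L(S)` -/

/-- The automorphism `π(γ)` of `S`, for `γ ∈ Aut_L(S)`. -/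
def piS (γ : L.Gam) : S →* S :=
  (Subgroup.subtype ⊤).comp ((L.π γ.hom).comp (Subgroup.topEquiv (G := S)).symm.toMonoidHom)

lemma piS_mul (γ γ' : L.Gam) (x : S) : piS (γ * γ') x = piS γ (piS γ' x) := by
  have h : (γ * γ').hom = γ'.hom ≫ γ.hom := rfl
  simp only [piS, h, L.π_comp]
  rfl

lemma piS_one (x : S) : piS (1 : L.Gam) x = x := by
  have : (1 : L.Gam).hom = 𝟙 _ := rfl
  simp only [piS, this, L.π_id]
  rfl

lemma piS_inv_self (γ : L.Gam) (x : S) : piS γ⁻¹ (piS γ x) = x := by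
  rw [← piS_mul, inv_mul_cancel, piS_one]

lemma piS_self_inv (γ : L.Gam) (x : S) : piS γ (piS γ⁻¹ x) = x := by
  rw [← piS_mul, mul_inv_cancel, piS_one]

/-- `μ : P → Q` is the restriction `γ|_{P,Q}` of `γ ∈ Aut_L(S)`. -/
def IsRestr (γ : L.Gam) {P Q : L.Obj} (μ : P ⟶ Q) : Prop :=
  μ ≫ L.inclTop Q = L.inclTop P ≫ γ.hom

lemma IsRestr.unique {γ : L.Gam} {P Q : L.Obj} {μ μ' : P ⟶ Q} (h : IsRestr γ μ)
    (h' : IsRestr γ μ') : μ = μ' := by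
  rw [← cancel_mono (L.inclTop Q)]
  exact h.trans h'.symm

lemma IsRestr.comp {γ γ' : L.Gam} {P Q R : L.Obj} {μ : P ⟶ Q} {ν : Q ⟶ R} (h : IsRestr γ μ)
    (h' : IsRestr γ' ν) : IsRestr (γ' * γ) (μ ≫ ν) := by
  unfold IsRestr at *
  rw [Category.assoc, h', ← Category.assoc, h, Category.assoc]
  rfl

lemma isRestr_incl (P Q : L.Obj) (h : P.grp ≤ Q.grp) : IsRestr 1 (L.incl P Q h) := by
  have : (1 : L.Gam).hom = 𝟙 _ := rfl
  simp [IsRestr, this]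

lemma isRestr_id (P : L.Obj) : IsRestr 1 (𝟙 P) := by
  rw [← incl_self P le_rfl]; exact isRestr_incl _ _ _

lemma isRestr_eqToHom {P Q : L.Obj} (h : P = Q) : IsRestr 1 (eqToHom h) := by
  rw [eqToHom_eq_incl]; exact isRestr_incl _ _ _

lemma isRestr_self (γ : L.Gam) : IsRestr γ γ.hom := by
  simp [IsRestr]

/-- An endomorphism which restricts `γ` on the whole of `S` is `γ`. -/
lemma IsRestr.eq_hom {γ : L.Gam} {μ : L.top ⟶ L.top} (h : IsRestr γ μ) : μ = γ.hom :=
  h.unique (isRestr_self γ)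

lemma IsRestr.piS_apply {γ : L.Gam} {P Q : L.Obj} {μ : P ⟶ Q} (h : IsRestr γ μ) (x : P.grp) :
    (L.π μ x : S) = piS γ x := by
  have h1 := DFunLike.congr_fun (congrArg L.π h) x
  rw [L.π_comp, L.π_comp] at h1
  have h2 := congrArg Subtype.val h1
  simp only [MonoidHom.comp_apply] at h2
  rw [π_inclTop_apply, π_inclTop_eq] at h2
  rw [h2]
  rfl

lemma exists_restr (γ : L.Gam) (P Q : L.Obj) (h : P.grp.map (piS γ) ≤ Q.grp) :
    ∃ μ : P ⟶ Q, IsRestr γ μ := by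
  refine exists_restriction γ.hom P Q (L.grp_le_top P) (L.grp_le_top Q) (fun x hx => h ⟨x, hx, rfl⟩)

/-- The restriction `γ|_{P,Q} : P → Q` of `γ ∈ Aut_L(S)`, when `π(γ)(P) ≤ Q`. -/
def restr (γ : L.Gam) (P Q : L.Obj) (h : P.grp.map (piS γ) ≤ Q.grp) : P ⟶ Q :=
  (exists_restr γ P Q h).choose

lemma restr_spec (γ : L.Gam) (P Q : L.Obj) (h : P.grp.map (piS γ) ≤ Q.grp) :
    IsRestr γ (restr γ P Q h) := (exists_restr γ P Q h).choose_spec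

/-- The object `π(γ)(P)`. -/
def act (γ : L.Gam) (P : L.Obj) : L.Obj where
  grp := P.grp.map (piS γ)
  mem := by
    obtain ⟨R, hR, e, he, he', hfe⟩ := F.factor (L.π_mem (L.inclTop P ≫ γ.hom))
    have hRP : R = P.grp.map (piS γ) := by
      have key : ∀ x : P.grp, (e x : S) = piS γ x := by
        intro x
        have h1 := congrArg Subtype.val (DFunLike.congr_fun hfe x)
        have h2 : ((e x : R) : S) =
          (((Subgroup.inclusion hR).comp e.toMonoidHom) x : L.top.grp) := rfl
        rw [h2, ← h1, L.π_comp, MonoidHom.comp_apply, π_inclTop_eq]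
        rfl
      ext y
      constructor
      · intro hy
        refine ⟨e.symm ⟨y, hy⟩, (e.symm ⟨y, hy⟩).2, ?_⟩
        rw [← key]; simp
      · rintro ⟨x, hx, rfl⟩
        rw [← key ⟨x, hx⟩]
        exact (e _).2
    rw [← hRP]
    exact L.objs_conj P.mem ⟨e, he, he'⟩

lemma act_mul (γ γ' : L.Gam) (P : L.Obj) : act (γ * γ') P = act γ (act γ' P) := by
  apply LObj.ext; ext x
  simp only [act, Subgroup.mem_map]
  constructor
  · rintro ⟨y, hy, rfl⟩
    exact ⟨_, ⟨y, hy, rfl⟩, (piS_mul _ _ _).symm⟩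
  · rintro ⟨_, ⟨y, hy, rfl⟩, rfl⟩
    exact ⟨y, hy, piS_mul _ _ _⟩

lemma act_one (P : L.Obj) : act (1 : L.Gam) P = P := by
  apply LObj.ext; ext x
  simp only [act, Subgroup.mem_map]
  constructor
  · rintro ⟨y, hy, rfl⟩
    rwa [piS_one]
  · exact fun h => ⟨x, h, piS_one x⟩

/-- An isomorphism which is a restriction of `γ` has target `π(γ)(P)`. -/
lemma IsRestr.eq_act {γ : L.Gam} {P Q : L.Obj} {μ : P ⟶ Q} (h : IsRestr γ μ) [IsIso μ] :
    Q = act γ P := by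
  apply LObj.ext; ext y
  simp only [act, Subgroup.mem_map]
  constructor
  · intro hy
    refine ⟨L.π (inv μ) ⟨y, hy⟩, (L.π (inv μ) ⟨y, hy⟩).2, ?_⟩
    rw [← h.piS_apply]
    have h1 := DFunLike.congr_fun (L.π_comp (inv μ) μ) ⟨y, hy⟩
    rw [IsIso.inv_hom_id, L.π_id] at h1
    exact (congrArg Subtype.val h1).symm
  · rintro ⟨x, hx, rfl⟩
    rw [← h.piS_apply ⟨x, hx⟩]
    exact (L.π μ _).2

/-- The restriction `γ|_{P, π(γ)(P)}`. -/
def restrTo (γ : L.Gam) (P : L.Obj) : P ⟶ act γ P := restr γ P (act γ P) le_rfl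

lemma restrTo_spec (γ : L.Gam) (P : L.Obj) : IsRestr γ (restrTo γ P) := restr_spec _ _ _ _

/-- The inverse of `γ|_{P, π(γ)(P)}`, a restriction of `γ⁻¹`. -/
def restrFrom (γ : L.Gam) (P : L.Obj) : act γ P ⟶ P :=
  restr γ⁻¹ (act γ P) P (by
    rintro _ ⟨_, ⟨x, hx, rfl⟩, rfl⟩
    rw [piS_inv_self]; exact hx)

lemma restrFrom_spec (γ : L.Gam) (P : L.Obj) : IsRestr γ⁻¹ (restrFrom γ P) := restr_spec _ _ _ _

@[simp] lemma restrTo_restrFrom (γ : L.Gam) (P : L.Obj) :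
    restrTo γ P ≫ restrFrom γ P = 𝟙 P := by
  have h := (restrTo_spec γ P).comp (restrFrom_spec γ P)
  rw [inv_mul_cancel] at h
  exact h.unique (isRestr_id P)

@[simp] lemma restrFrom_restrTo (γ : L.Gam) (P : L.Obj) :
    restrFrom γ P ≫ restrTo γ P = 𝟙 _ := by
  have h := (restrFrom_spec γ P).comp (restrTo_spec γ P)
  rw [mul_inv_cancel] at h
  exact h.unique (isRestr_id _)

@[simp] lemma restrTo_restrFrom_assoc (γ : L.Gam) (P Q : L.Obj) (f : P ⟶ Q) :
    restrTo γ P ≫ restrFrom γ P ≫ f = f := by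
  rw [← Category.assoc, restrTo_restrFrom, Category.id_comp]

@[simp] lemma restrFrom_restrTo_assoc (γ : L.Gam) (P Q : L.Obj) (f : act γ P ⟶ Q) :
    restrFrom γ P ≫ restrTo γ P ≫ f = f := by
  rw [← Category.assoc, restrFrom_restrTo, Category.id_comp]

instance (γ : L.Gam) (P : L.Obj) : IsIso (restrTo γ P) :=
  ⟨restrFrom γ P, restrTo_restrFrom γ P, restrFrom_restrTo γ P⟩

end LinkingSystem

/-! ## The group of isotypical automorphisms -/

namespace LinkingSystem

variable {p : ℕ} [Fact p.Prime] {S : Type u} [Group S] {F : FusionSystem S}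
  (L : LinkingSystem p F)

/-- The subgroup `δ_P(P)` of `Aut_L(P)`, as a set of endomorphisms. -/
def dist (P : L.Obj) : Set (P ⟶ P) :=
  Set.range fun g : P.grp => L.δ P P g (.of_mem g.2)

variable {L}

lemma mem_dist_conj {P Q : L.Obj} (h : P = Q) (f : P ⟶ P) :
    eqToHom h.symm ≫ f ≫ eqToHom h ∈ L.dist Q ↔ f ∈ L.dist P := by
  subst h; simp

end LinkingSystem

open LinkingSystem

/-- An element of `Aut_typ^I(L)`: an automorphism of the category `L` which is isotypical and sends
inclusions to inclusions. -/
structure TypAut {p : ℕ} [Fact p.Prime] {S : Type u} [Group S] {F : FusionSystem S}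
    (L : LinkingSystem p F) where
  /-- the underlying functor -/
  F : L.Obj ⥤ L.Obj
  /-- the inverse functor -/
  inv : L.Obj ⥤ L.Obj
  hom_inv : F ⋙ inv = 𝟭 _
  inv_hom : inv ⋙ F = 𝟭 _
  isotypical : ∀ P : L.Obj, F.map '' L.dist P = L.dist (F.obj P)
  map_incl : ∀ (P Q : L.Obj) (h : P.grp ≤ Q.grp),
    ∃ h' : (F.obj P).grp ≤ (F.obj Q).grp, F.map (L.incl P Q h) = L.incl (F.obj P) (F.obj Q) h'

namespace TypAut

variable {p : ℕ} [Fact p.Prime] {S : Type u} [Group S] {F : FusionSystem S}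
  {L : LinkingSystem p F}

@[ext]
lemma ext {α β : TypAut L} (h : α.F = β.F) : α = β := by
  have h2 : α.inv = β.inv := by
    calc α.inv = α.inv ⋙ (β.F ⋙ β.inv) := by rw [β.hom_inv]; rfl
      _ = (α.inv ⋙ α.F) ⋙ β.inv := by rw [h]; rfl
      _ = β.inv := by rw [α.inv_hom]; rfl
  cases α; cases β; cases h; cases h2; rfl

lemma inv_obj (α : TypAut L) (P : L.Obj) : α.inv.obj (α.F.obj P) = P :=
  Functor.congr_obj α.hom_inv P

lemma obj_inv (α : TypAut L) (P : L.Obj) : α.F.obj (α.inv.obj P) = P :=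
  Functor.congr_obj α.inv_hom P

lemma obj_mono (α : TypAut L) {P Q : L.Obj} (h : P.grp ≤ Q.grp) :
    (α.F.obj P).grp ≤ (α.F.obj Q).grp := (α.map_incl P Q h).1

lemma map_incl' (α : TypAut L) (P Q : L.Obj) (h : P.grp ≤ Q.grp) :
    α.F.map (L.incl P Q h) = L.incl _ _ (α.obj_mono h) := (α.map_incl P Q h).2

lemma obj_top (α : TypAut L) : α.F.obj L.top = L.top := by
  apply LObj.ext
  apply le_antisymm le_top
  have := α.obj_mono (L.grp_le_top (α.inv.obj L.top))
  rwa [α.obj_inv] at this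

lemma map_inclTop (α : TypAut L) (P : L.Obj) :
    α.F.map (L.inclTop P) ≫ eqToHom α.obj_top = L.inclTop (α.F.obj P) := by
  rw [inclTop, map_incl', eqToHom_eq_incl, incl_incl]
  rfl

lemma map_injective (α : TypAut L) {P Q : L.Obj} :
    Function.Injective (fun f : P ⟶ Q => α.F.map f) := by
  intro f g h
  have h1 := Functor.congr_hom α.hom_inv f
  have h2 := Functor.congr_hom α.hom_inv g
  simp only [Functor.comp_map] at h1 h2
  simp only at h
  rw [h, h2] at h1
  exact ((cancel_mono _).1 ((cancel_epi _).1 h1)).symm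

lemma inv_isotypical (α : TypAut L) (P : L.Obj) :
    α.inv.map '' L.dist P = L.dist (α.inv.obj P) := by
  have key : ∀ f : α.inv.obj P ⟶ α.inv.obj P,
      ∃ g : P ⟶ P, α.inv.map g = f ∧ (f ∈ L.dist (α.inv.obj P) → g ∈ L.dist P) := by
    intro f
    refine ⟨eqToHom (α.obj_inv P).symm ≫ α.F.map f ≫ eqToHom (α.obj_inv P), ?_, ?_⟩
    · have h1 := Functor.congr_hom α.hom_inv f
      simp only [Functor.comp_map] at h1
      simp only [Functor.map_comp, h1, eqToHom_map]
      simp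
    · intro hf
      rw [mem_dist_conj, ← α.isotypical]
      exact ⟨f, hf, rfl⟩
  ext f
  constructor
  · rintro ⟨g, hg, rfl⟩
    have h2 : eqToHom (α.obj_inv P) ≫ g ≫ eqToHom (α.obj_inv P).symm
        ∈ L.dist (α.F.obj (α.inv.obj P)) := (mem_dist_conj (α.obj_inv P).symm g).2 hg
    rw [← α.isotypical] at h2
    obtain ⟨k, hk, hk2⟩ := h2
    have h1 := Functor.congr_hom α.inv_hom g
    simp only [Functor.comp_map, Functor.id_map] at h1
    have : k = α.inv.map g := α.map_injective (hk2.trans h1.symm)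
    rwa [← this]
  · intro hf
    obtain ⟨g, hg, hg2⟩ := key f
    exact ⟨g, hg2 hf, hg⟩

lemma inv_map_incl (α : TypAut L) (P Q : L.Obj) (h : P.grp ≤ Q.grp) :
    ∃ h' : (α.inv.obj P).grp ≤ (α.inv.obj Q).grp,
      α.inv.map (L.incl P Q h) = L.incl (α.inv.obj P) (α.inv.obj Q) h' := by
  have h0 : IsRestr 1 (α.inv.map (L.incl P Q h)) := by
    have e1 : (1 : L.Gam).hom = 𝟙 _ := rfl
    rw [IsRestr, e1, Category.comp_id]
    apply α.map_injective
    have h1 : α.F.map (α.inv.map (L.incl P Q h)) =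
        eqToHom (α.obj_inv P) ≫ L.incl P Q h ≫ eqToHom (α.obj_inv Q).symm :=
      Functor.congr_hom α.inv_hom (L.incl P Q h)
    simp only [Functor.map_comp, h1]
    rw [← cancel_mono (eqToHom α.obj_top)]
    simp only [Category.assoc, map_inclTop]
    rw [eqToHom_eq_incl, eqToHom_eq_incl, incl_inclTop, incl_inclTop, incl_inclTop]
  have h' : (α.inv.obj P).grp ≤ (α.inv.obj Q).grp := by
    intro x hx
    have := h0.piS_apply ⟨x, hx⟩
    rw [piS_one] at this
    rw [← show (_ : S) = x from this]
    exact (L.π _ _).2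
  exact ⟨h', h0.unique (isRestr_incl _ _ _)⟩

instance : Group (TypAut L) where
  mul α β :=
    { F := β.F ⋙ α.F
      inv := α.inv ⋙ β.inv
      hom_inv := by
        rw [Functor.assoc, ← Functor.assoc α.F, α.hom_inv, Functor.id_comp, β.hom_inv]
      inv_hom := by
        rw [Functor.assoc, ← Functor.assoc β.inv, β.inv_hom, Functor.id_comp, α.inv_hom]
      isotypical := fun P => by
        have := α.isotypical (β.F.obj P)
        rw [← β.isotypical, Set.image_image] at this
        exact this
      map_incl := fun P Q h => ⟨α.obj_mono (β.obj_mono h), by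
        simp only [Functor.comp_map, map_incl']; rfl⟩ }
  one :=
    { F := 𝟭 _
      inv := 𝟭 _
      hom_inv := rfl
      inv_hom := rfl
      isotypical := fun P => by simp
      map_incl := fun P Q h => ⟨h, rfl⟩ }
  inv α :=
    { F := α.inv
      inv := α.F
      hom_inv := α.inv_hom
      inv_hom := α.hom_inv
      isotypical := α.inv_isotypical
      map_incl := α.inv_map_incl }
  mul_assoc _ _ _ := rfl
  one_mul _ := ext rfl
  mul_one _ := ext rfl
  inv_mul_cancel α := ext α.hom_inv

@[simp] lemma mul_obj (α β : TypAut L) (P : L.Obj) :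
    (α * β).F.obj P = α.F.obj (β.F.obj P) := rfl

@[simp] lemma mul_map (α β : TypAut L) {P Q : L.Obj} (f : P ⟶ Q) :
    (α * β).F.map f = α.F.map (β.F.map f) := rfl

@[simp] lemma one_obj (P : L.Obj) : (1 : TypAut L).F.obj P = P := rfl

@[simp] lemma one_map {P Q : L.Obj} (f : P ⟶ Q) : (1 : TypAut L).F.map f = f := rfl

lemma congr_obj {α β : TypAut L} (h : α = β) (P : L.Obj) : α.F.obj P = β.F.obj P := by rw [h]

/-! ### Evaluation at `S` -/

/-- The automorphism `α_S` of `Aut_L(S)`, evaluated at `γ`. -/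
def ev (α : TypAut L) (γ : L.Gam) : L.Gam :=
  (eqToIso α.obj_top).symm ≪≫ α.F.mapIso γ ≪≫ eqToIso α.obj_top

lemma ev_hom (α : TypAut L) (γ : L.Gam) :
    (α.ev γ).hom = eqToHom α.obj_top.symm ≫ α.F.map γ.hom ≫ eqToHom α.obj_top := rfl

/-- An automorphism `α` sends restrictions of `γ` to restrictions of `α_S(γ)`. -/
lemma isRestr_map (α : TypAut L) {γ : L.Gam} {P Q : L.Obj} {μ : P ⟶ Q} (h : IsRestr γ μ) :
    IsRestr (α.ev γ) (α.F.map μ) := by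
  have h1 := congrArg (fun f => α.F.map f ≫ eqToHom α.obj_top) h
  simp only [Functor.map_comp, Category.assoc, map_inclTop] at h1
  rw [IsRestr, h1, ev_hom, ← map_inclTop]
  simp

lemma ev_mul' (α : TypAut L) (γ γ' : L.Gam) : α.ev (γ * γ') = α.ev γ * α.ev γ' := by
  apply Iso.ext
  have h : ∀ a b : L.Gam, (a * b).hom = b.hom ≫ a.hom := fun _ _ => rfl
  simp [h, ev_hom]

lemma ev_comp (α β : TypAut L) (γ : L.Gam) : (α * β).ev γ = α.ev (β.ev γ) := by
  apply Iso.ext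
  simp [ev_hom, eqToHom_map]

lemma ev_one' (γ : L.Gam) : (1 : TypAut L).ev γ = γ := by
  apply Iso.ext
  simp [ev_hom]

variable (L) in
/-- The homomorphism `Aut_typ^I(L) → Aut(Aut_L(S))`, `α ↦ α_S`. -/
def evS : TypAut L →* MulAut L.Gam where
  toFun α :=
    { toFun := α.ev
      invFun := α⁻¹.ev
      left_inv := fun γ => by rw [← ev_comp, inv_mul_cancel, ev_one']
      right_inv := fun γ => by rw [← ev_comp, mul_inv_cancel, ev_one']
      map_mul' := α.ev_mul' }
  map_one' := by ext1 γ; exact ev_one' γ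
  map_mul' α β := by ext1 γ; exact ev_comp α β γ

lemma evS_apply (α : TypAut L) (γ : L.Gam) : evS L α γ = α.ev γ := rfl

/-! ### Inner automorphisms -/

/-- The functor `c_γ`: `P ↦ π(γ)(P)` on objects, `φ ↦ γ φ γ⁻¹` on morphisms. -/
def conjFunctor (γ : L.Gam) : L.Obj ⥤ L.Obj where
  obj P := act γ P
  map {P Q} φ := restrFrom γ P ≫ φ ≫ restrTo γ Q

lemma restrTo_mul (γ γ' : L.Gam) (P : L.Obj) :
    restrTo (γ * γ') P = restrTo γ' P ≫ restrTo γ (act γ' P) ≫ eqToHom (act_mul γ γ' P).symm := by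
  apply (restrTo_spec _ _).unique
  have := (restrTo_spec γ' P).comp ((restrTo_spec γ (act γ' P)).comp
    (isRestr_eqToHom (act_mul γ γ' P).symm))
  rwa [one_mul] at this

lemma restrFrom_mul (γ γ' : L.Gam) (P : L.Obj) :
    restrFrom (γ * γ') P =
      eqToHom (act_mul γ γ' P) ≫ restrFrom γ (act γ' P) ≫ restrFrom γ' P := by
  apply (restrFrom_spec _ _).unique
  have := ((isRestr_eqToHom (act_mul γ γ' P)).comp (restrFrom_spec γ (act γ' P))).comp
    (restrFrom_spec γ' P)
  rwa [mul_one, ← mul_inv_rev, Category.assoc] at this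

lemma restrTo_one (P : L.Obj) : restrTo (1 : L.Gam) P = eqToHom (act_one P).symm :=
  (restrTo_spec _ _).unique (isRestr_eqToHom _)

lemma restrFrom_one (P : L.Obj) : restrFrom (1 : L.Gam) P = eqToHom (act_one P) :=
  (restrFrom_spec _ _).unique (by rw [inv_one]; exact isRestr_eqToHom _)

lemma conjFunctor_mul (γ γ' : L.Gam) :
    conjFunctor (γ * γ') = conjFunctor γ' ⋙ conjFunctor γ := by
  refine CategoryTheory.Functor.ext (fun P => act_mul γ γ' P) fun P Q f => ?_
  simp only [conjFunctor, Functor.comp_map, restrTo_mul, restrFrom_mul, Category.assoc]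

lemma conjFunctor_one : conjFunctor (1 : L.Gam) = 𝟭 _ := by
  refine CategoryTheory.Functor.ext (fun P => act_one P) fun P Q f => ?_
  simp [conjFunctor, restrTo_one, restrFrom_one]

variable (L) in
/-- The homomorphism `Aut_L(S) → Aut_typ^I(L)`, `γ ↦ c_γ`. -/
def c : L.Gam →* TypAut L where
  toFun γ :=
    { F := conjFunctor γ
      inv := conjFunctor γ⁻¹
      hom_inv := by rw [← conjFunctor_mul, inv_mul_cancel, conjFunctor_one]
      inv_hom := by rw [← conjFunctor_mul, mul_inv_cancel, conjFunctor_one]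
      isotypical := fun P => by
        have key : ∀ (g : S) (hg : g ∈ P.grp), (conjFunctor γ).map (L.δ P P g (.of_mem hg)) =
            L.δ _ _ (L.π (restrTo γ P) ⟨g, hg⟩) (.of_mem (L.π (restrTo γ P) ⟨g, hg⟩).2) := by
          intro g hg
          simp only [conjFunctor]
          rw [L.δ_comm _ g hg]
          simp
        ext f
        constructor
        · rintro ⟨_, ⟨g, rfl⟩, rfl⟩
          exact ⟨L.π (restrTo γ P) g, (key g g.2).symm⟩
        · rintro ⟨⟨_, ⟨x, hx, rfl⟩⟩, rfl⟩
          refine ⟨_, ⟨⟨x, hx⟩, rfl⟩, (key x hx).trans ?_⟩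
          have := (restrTo_spec γ P).piS_apply ⟨x, hx⟩
          congr 1
      map_incl := fun P Q h => by
        have h' : (act γ P).grp ≤ (act γ Q).grp := Subgroup.map_mono h
        refine ⟨h', ?_⟩
        have h1 := ((restrFrom_spec γ P).comp (isRestr_incl P Q h)).comp (restrTo_spec γ Q)
        rw [one_mul, mul_inv_cancel] at h1
        have h2 := h1.unique (isRestr_incl _ _ h')
        rw [Category.assoc] at h2
        exact h2 }
  map_one' := ext conjFunctor_one
  map_mul' γ γ' := ext (conjFunctor_mul γ γ')

lemma c_F (γ : L.Gam) : (c L γ).F = conjFunctor γ := rfl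

/-- `χ ∈ Aut_L(S)` is (the value at `S` of) a natural transformation from `α` to `β`. -/
lemma eq_c_mul {α β : TypAut L} {χ : L.Gam} (μ : ∀ P : L.Obj, α.F.obj P ⟶ β.F.obj P)
    (hμ : ∀ P, IsRestr χ (μ P)) (hiso : ∀ P, IsIso (μ P))
    (hn : ∀ (P Q : L.Obj) (φ : P ⟶ Q), α.F.map φ ≫ μ Q = μ P ≫ β.F.map φ) :
    β = c L χ * α := by
  have hμ' : ∀ P, restrTo χ (α.F.obj P) = μ P ≫ eqToHom (hμ P).eq_act := by
    intro P
    have := (hμ P).comp (isRestr_eqToHom (hμ P).eq_act)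
    rw [one_mul] at this
    exact (restrTo_spec _ _).unique this
  apply ext
  refine CategoryTheory.Functor.ext (fun P => (hμ P).eq_act) fun P Q f => ?_
  change _ = eqToHom (hμ P).eq_act ≫ (restrFrom χ _ ≫ α.F.map f ≫ restrTo χ _) ≫
    eqToHom (hμ Q).eq_act.symm
  rw [hμ' Q, ← Category.assoc (α.F.map f), hn]
  have h2 : restrFrom χ (α.F.obj P) ≫ μ P = eqToHom (hμ P).eq_act.symm := by
    rw [← cancel_mono (eqToHom (hμ P).eq_act), Category.assoc, ← hμ']
    simp
  rw [Category.assoc (μ P), ← Category.assoc (restrFrom _ _), h2]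
  simp

lemma ev_c (γ γ' : L.Gam) : (c L γ).ev γ' = γ * γ' * γ⁻¹ := by
  have h1 := (c L γ).isRestr_map (isRestr_self γ')
  have h2 := ((restrFrom_spec γ L.top).comp (isRestr_self γ')).comp (restrTo_spec γ L.top)
  rw [Category.assoc] at h2
  have h3 : (c L γ).F.map γ'.hom = restrFrom γ L.top ≫ γ'.hom ≫ restrTo γ L.top := rfl
  rw [← h3] at h2
  have h4 : L.inclTop ((c L γ).F.obj L.top) ≫ ((c L γ).ev γ').hom =
    L.inclTop ((c L γ).F.obj L.top) ≫ Iso.hom (γ * (γ' * γ⁻¹)) := Eq.trans (Eq.symm h1) h2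
  rw [mul_assoc]
  apply Iso.ext
  have h5 : ∀ P : L.Obj, P = L.top → IsIso (L.inclTop P) := by
    rintro P rfl
    rw [inclTop_top]; infer_instance
  have := h5 _ (c L γ).obj_top
  exact (cancel_epi _).1 h4

lemma c_ev (α : TypAut L) (χ : L.Gam) : α * c L χ = c L (α.ev χ) * α := by
  have key : ∀ {P P' Q Q' : L.Obj} (a : P ⟶ P') (b : P' ⟶ P) (φ : P ⟶ Q) (d : Q ⟶ Q'),
      a ≫ b = 𝟙 P → α.F.map φ ≫ α.F.map d = α.F.map a ≫ α.F.map (b ≫ φ ≫ d) := by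
    intro P P' Q Q' a b φ d h
    rw [← Functor.map_comp, ← Functor.map_comp, ← Category.assoc a b, h, Category.id_comp]
  have hi : ∀ {P Q : L.Obj} (a : P ⟶ Q), IsIso a → IsIso (α.F.map a) :=
    fun a h => inferInstance
  exact eq_c_mul (fun P => α.F.map (restrTo χ P))
    (fun P => α.isRestr_map (restrTo_spec χ P)) (fun P => hi (restrTo χ P) inferInstance)
    (fun P Q φ => key _ _ _ _ (restrTo_restrFrom χ P))

lemma act_eq_of_c {α β : TypAut L} {χ : L.Gam} (h : β = c L χ * α) (P : L.Obj) :
    act χ (α.F.obj P) = β.F.obj P := by subst h; rfl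

/-- The component `χ_P : α(P) → β(P)` at `P` of the natural transformation `χ`. -/
def comp {α β : TypAut L} {χ : L.Gam} (h : β = c L χ * α) (P : L.Obj) :
    α.F.obj P ⟶ β.F.obj P := restrTo χ (α.F.obj P) ≫ eqToHom (act_eq_of_c h P)

lemma comp_spec {α β : TypAut L} {χ : L.Gam} (h : β = c L χ * α) (P : L.Obj) :
    IsRestr χ (comp h P) := by
  have := (restrTo_spec χ (α.F.obj P)).comp (isRestr_eqToHom (act_eq_of_c h P))
  rwa [one_mul] at this

lemma comp_naturality {α β : TypAut L} {χ : L.Gam} (h : β = c L χ * α) {P Q : L.Obj}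
    (φ : P ⟶ Q) : α.F.map φ ≫ comp h Q = comp h P ≫ β.F.map φ := by
  subst h
  have h1 : ∀ Q, comp (β := c L χ * α) rfl Q = restrTo χ (α.F.obj Q) :=
    fun Q => Category.comp_id _
  rw [h1, h1]
  change _ = restrTo χ (α.F.obj P) ≫
    (restrFrom χ (α.F.obj P) ≫ α.F.map φ ≫ restrTo χ (α.F.obj Q))
  rw [restrTo_restrFrom_assoc]
  rfl

instance {α β : TypAut L} {χ : L.Gam} (h : β = c L χ * α) (P : L.Obj) : IsIso (comp h P) := by
  unfold comp; infer_instance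

end TypAut

/-! ## The category of isotypical automorphisms -/

/-- The objects of the category `𝒜ut_typ(L)`. -/
@[ext]
structure AutTyp {p : ℕ} [Fact p.Prime] {S : Type u} [Group S] {F : FusionSystem S}
    (L : LinkingSystem p F) : Type u where
  /-- the underlying element of `Aut_typ^I(L)` -/
  aut : TypAut L

namespace AutTyp

variable {p : ℕ} [Fact p.Prime] {S : Type u} [Group S] {F : FusionSystem S}
  {L : LinkingSystem p F}

/-- The groupoid `𝒜ut_typ(L)`: a natural transformation `α → β` is identified with its value
`χ ∈ Aut_L(S)` at `S`, and `χ` occurs if and only if `β = c_χ ∘ α`. -/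
instance : Category.{u} (AutTyp L) where
  Hom α β := {χ : L.Gam // β.aut = TypAut.c L χ * α.aut}
  id α := ⟨1, by rw [map_one, one_mul]⟩
  comp {α β γ} χ ω := ⟨ω.1 * χ.1, by
    obtain ⟨ω, hω⟩ := ω
    obtain ⟨χ, hχ⟩ := χ
    simp only [hω, hχ, map_mul, mul_assoc]⟩
  id_comp _ := Subtype.ext (mul_one _)
  comp_id _ := Subtype.ext (one_mul _)
  assoc _ _ _ := Subtype.ext (mul_assoc _ _ _).symm

lemma eqToHom_val {α β : AutTyp L} (h : α = β) :
    (eqToHom h : α ⟶ β).1 = 1 := by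
  subst h; rfl

lemma comp_val {α β γ : AutTyp L} (χ : α ⟶ β) (ω : β ⟶ γ) : (χ ≫ ω).1 = ω.1 * χ.1 := rfl

section Diagrams

variable {J : Type} [Category.{0} J]

/-- The object at `j` of a diagram in `𝒜ut_typ(L)ᵒᵖ`. -/
def ob (A : J ⥤ (AutTyp L)ᵒᵖ) (j : J) : TypAut L := (A.obj j).unop.aut

/-- The element of `Aut_L(S)` which represents a morphism in a diagram in `𝒜ut_typ(L)ᵒᵖ`. -/
def chi (A : J ⥤ (AutTyp L)ᵒᵖ) {i j : J} (f : i ⟶ j) : L.Gam := (A.map f).unop.1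

lemma ob_eq (A : J ⥤ (AutTyp L)ᵒᵖ) {i j : J} (f : i ⟶ j) :
    ob A i = TypAut.c L (chi A f) * ob A j := (A.map f).unop.2

lemma chi_id (A : J ⥤ (AutTyp L)ᵒᵖ) (j : J) : chi A (𝟙 j) = 1 := by
  unfold chi; rw [A.map_id]; rfl

lemma chi_comp (A : J ⥤ (AutTyp L)ᵒᵖ) {i j k : J} (f : i ⟶ j) (g : j ⟶ k) :
    chi A (f ≫ g) = chi A f * chi A g := by
  unfold chi; rw [A.map_comp]; rfl

/-- A diagram in `𝒜ut_typ(L)ᵒᵖ` from its objects and morphisms. -/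
def mkDiagram (o : J → TypAut L) (x : ∀ {i j : J}, (i ⟶ j) → L.Gam)
    (h : ∀ {i j : J} (f : i ⟶ j), o i = TypAut.c L (x f) * o j)
    (hid : ∀ j, x (𝟙 j) = 1)
    (hcomp : ∀ {i j k : J} (f : i ⟶ j) (g : j ⟶ k), x (f ≫ g) = x f * x g) :
    J ⥤ (AutTyp L)ᵒᵖ where
  obj j := op ⟨o j⟩
  map {i j} f := Quiver.Hom.op (X := (⟨o j⟩ : AutTyp L)) (Y := ⟨o i⟩) ⟨x f, h f⟩
  map_id j := Quiver.Hom.unop_inj (Subtype.ext (hid j))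
  map_comp f g := Quiver.Hom.unop_inj (Subtype.ext (hcomp f g))

lemma diagram_ext {A B : J ⥤ (AutTyp L)ᵒᵖ} (h : ∀ j, ob A j = ob B j)
    (h' : ∀ {i j : J} (f : i ⟶ j), chi A f = chi B f) : A = B := by
  refine CategoryTheory.Functor.ext
    (fun j => congrArg op (AutTyp.ext (h j))) fun i j f => ?_
  apply Quiver.Hom.unop_inj
  apply Subtype.ext
  change chi A f = _
  rw [h' f, unop_comp, unop_comp, comp_val, comp_val, eqToHom_unop, eqToHom_unop, eqToHom_val,
    eqToHom_val]
  simp [chi]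

lemma ev_ob (A : J ⥤ (AutTyp L)ᵒᵖ) {i j : J} (f : i ⟶ j) (γ : L.Gam) :
    (ob A i).ev γ = chi A f * (ob A j).ev γ * (chi A f)⁻¹ := by
  rw [ob_eq A f, TypAut.ev_comp, TypAut.ev_c]

/-- The product of two diagrams, given on objects by composition of automorphisms and on morphisms
by `(χ : α → β) · (χ' : α' → β') = χ ∘ α(χ')`. -/
def diagramMul (A B : J ⥤ (AutTyp L)ᵒᵖ) : J ⥤ (AutTyp L)ᵒᵖ :=
  mkDiagram (fun j => ob A j * ob B j) (fun {_ j} f => chi A f * (ob A j).ev (chi B f))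
    (fun {i j} f => by
      have h := TypAut.c_ev (ob A j) (chi B f)
      calc ob A i * ob B i
          = TypAut.c L (chi A f) * (ob A j * TypAut.c L (chi B f)) * ob B j := by
            rw [ob_eq A f, ob_eq B f]; simp only [mul_assoc]
        _ = _ := by rw [h, map_mul]; simp only [mul_assoc])
    (fun j => by
      have : (ob A j).ev 1 = 1 := map_one (TypAut.evS L (ob A j))
      rw [chi_id, chi_id, this, mul_one])
    (fun {i j k} f g => by
      rw [chi_comp, chi_comp, TypAut.ev_mul', ev_ob A g]
      group)

/-- The inverse of a diagram. -/
def diagramInv (A : J ⥤ (AutTyp L)ᵒᵖ) : J ⥤ (AutTyp L)ᵒᵖ :=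
  mkDiagram (fun j => (ob A j)⁻¹) (fun {_ j} f => ((ob A j)⁻¹).ev (chi A f)⁻¹)
    (fun {i j} f => by
      have h := TypAut.c_ev (ob A j)⁻¹ (chi A f)⁻¹
      rw [← h, ob_eq A f, mul_inv_rev, map_inv])
    (fun j => by
      rw [chi_id, inv_one]
      exact map_one (TypAut.evS L (ob A j)⁻¹))
    (fun {i j k} f g => by
      have h1 : (ob A j)⁻¹ = (ob A k)⁻¹ * TypAut.c L (chi A g)⁻¹ := by
        rw [ob_eq A g, mul_inv_rev, map_inv]
      rw [h1, TypAut.ev_comp, TypAut.ev_c, ← TypAut.ev_mul', chi_comp]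
      congr 1
      group)

/-- Diagrams in `𝒜ut_typ(L)ᵒᵖ` of a given shape form a group. -/
instance : Group (J ⥤ (AutTyp L)ᵒᵖ) where
  mul := diagramMul
  one := mkDiagram (fun _ => 1) (fun _ => 1) (fun _ => by rw [map_one, one_mul]) (fun _ => rfl)
    (fun _ _ => (mul_one _).symm)
  inv := diagramInv
  mul_assoc A B C := diagram_ext (fun _ => mul_assoc _ _ _) (fun {i j} f => by
    change (chi A f * (ob A j).ev (chi B f)) * (ob A j * ob B j).ev (chi C f) =
      chi A f * (ob A j).ev (chi B f * (ob B j).ev (chi C f))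
    rw [TypAut.ev_comp, TypAut.ev_mul', mul_assoc])
  one_mul A := diagram_ext (fun _ => one_mul _) (fun {i j} f => by
    change 1 * (1 : TypAut L).ev (chi A f) = chi A f
    rw [TypAut.ev_one', one_mul])
  mul_one A := diagram_ext (fun _ => mul_one _) (fun {i j} f => by
    change chi A f * (ob A j).ev 1 = chi A f
    have : (ob A j).ev 1 = 1 := map_one (TypAut.evS L (ob A j))
    rw [this, mul_one])
  inv_mul_cancel A := diagram_ext (fun _ => inv_mul_cancel _) (fun {i j} f => by
    change (ob A j)⁻¹.ev (chi A f)⁻¹ * (ob A j)⁻¹.ev (chi A f) = 1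
    rw [← TypAut.ev_mul', inv_mul_cancel]
    exact map_one (TypAut.evS L (ob A j)⁻¹))

lemma ob_mul (A B : J ⥤ (AutTyp L)ᵒᵖ) (j : J) : ob (A * B) j = ob A j * ob B j := rfl

lemma chi_mul (A B : J ⥤ (AutTyp L)ᵒᵖ) {i j : J} (f : i ⟶ j) :
    chi (A * B) f = chi A f * (ob A j).ev (chi B f) := rfl

lemma ob_one (j : J) : ob (1 : J ⥤ (AutTyp L)ᵒᵖ) j = 1 := rfl

lemma chi_one {i j : J} (f : i ⟶ j) : chi (1 : J ⥤ (AutTyp L)ᵒᵖ) f = 1 := rfl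

/-- The action of a diagram in `𝒜ut_typ(L)ᵒᵖ` on a diagram in `Lᵒᵖ`, given on objects by evaluation
and on morphisms by `(χ : α → β) (φ : P → Q) = χ_Q ∘ α(φ) : α(P) → β(Q)`. -/
def diagramSMul (A : J ⥤ (AutTyp L)ᵒᵖ) (X : J ⥤ L.Objᵒᵖ) : J ⥤ L.Objᵒᵖ where
  obj j := op ((ob A j).F.obj (X.obj j).unop)
  map {i j} f := Quiver.Hom.op
    ((ob A j).F.map (X.map f).unop ≫ TypAut.comp (ob_eq A f) (X.obj i).unop)
  map_id j := by
    apply Quiver.Hom.unop_inj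
    have h := TypAut.comp_spec (ob_eq A (𝟙 j)) (X.obj j).unop
    have h2 : TypAut.comp (ob_eq A (𝟙 j)) (X.obj j).unop = 𝟙 _ :=
      h.unique (by rw [chi_id]; exact LinkingSystem.isRestr_id _)
    rw [Quiver.Hom.unop_op, h2, X.map_id, unop_id, CategoryTheory.Functor.map_id]
    exact Category.comp_id _
  map_comp {i j k} f g := by
    apply Quiver.Hom.unop_inj
    have h : TypAut.comp (ob_eq A (f ≫ g)) (X.obj i).unop =
        TypAut.comp (ob_eq A g) (X.obj i).unop ≫ TypAut.comp (ob_eq A f) (X.obj i).unop := by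
      apply (TypAut.comp_spec _ _).unique
      rw [chi_comp]
      exact (TypAut.comp_spec _ _).comp (TypAut.comp_spec _ _)
    have h2 := TypAut.comp_naturality (ob_eq A g) (X.map f).unop
    rw [unop_comp, Quiver.Hom.unop_op, Quiver.Hom.unop_op, Quiver.Hom.unop_op, h, X.map_comp,
      unop_comp, Functor.map_comp]
    simp only [Category.assoc]
    rw [← Category.assoc (TypAut.comp (ob_eq A g) (X.obj j).unop), ← h2]
    simp only [Category.assoc]

instance : MulAction (J ⥤ (AutTyp L)ᵒᵖ) (J ⥤ L.Objᵒᵖ) where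
  smul := diagramSMul
  one_smul X := by
    refine CategoryTheory.Functor.hext (fun j => rfl) fun i j f => heq_of_eq ?_
    apply Quiver.Hom.unop_inj
    change (X.map f).unop ≫ TypAut.comp (ob_eq 1 f) (X.obj i).unop = (X.map f).unop
    have h := TypAut.comp_spec (ob_eq (1 : J ⥤ (AutTyp L)ᵒᵖ) f) (X.obj i).unop
    have h2 : TypAut.comp (ob_eq (1 : J ⥤ (AutTyp L)ᵒᵖ) f) (X.obj i).unop = 𝟙 (X.obj i).unop :=
      h.unique (LinkingSystem.isRestr_id _)
    exact (congrArg (fun t => (X.map f).unop ≫ t) h2).trans (Category.comp_id _)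
  mul_smul A B X := by
    refine CategoryTheory.Functor.hext (fun j => rfl) fun i j f => heq_of_eq ?_
    apply Quiver.Hom.unop_inj
    change (ob A j).F.map ((ob B j).F.map (X.map f).unop) ≫
        TypAut.comp (ob_eq (A * B) f) (X.obj i).unop =
      (ob A j).F.map ((ob B j).F.map (X.map f).unop ≫ TypAut.comp (ob_eq B f) (X.obj i).unop) ≫
        TypAut.comp (ob_eq A f) ((ob B i).F.obj (X.obj i).unop)
    rw [Functor.map_comp, Category.assoc]
    congr 1
    apply (TypAut.comp_spec (ob_eq (A * B) f) _).unique
    exact ((ob A j).isRestr_map (TypAut.comp_spec (ob_eq B f) (X.obj i).unop)).comp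
      (TypAut.comp_spec (ob_eq A f) ((ob B i).F.obj (X.obj i).unop))

end Diagrams

end AutTyp

/-! ## Simplicial groups, actions, and twisted cartesian products -/

/-- A simplicial group structure on a simplicial set. -/
class SimplicialGroup (K : SSet.{u}) where
  [grp : ∀ n : SimplexCategoryᵒᵖ, Group (K.obj n)]
  map_mul : ∀ {m n : SimplexCategoryᵒᵖ} (θ : m ⟶ n) (a b : K.obj m),
    K.map θ (a * b) = K.map θ a * K.map θ b

attribute [reducible] SimplicialGroup.grp
attribute [instance] SimplicialGroup.grp

/-- An action of a simplicial group on a simplicial set. -/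
class SimplicialAction (K : SSet.{u}) [SimplicialGroup K] (Y : SSet.{u}) where
  [act : ∀ n : SimplexCategoryᵒᵖ, MulAction (K.obj n) (Y.obj n)]
  map_smul : ∀ {m n : SimplexCategoryᵒᵖ} (θ : m ⟶ n) (a : K.obj m) (y : Y.obj m),
    Y.map θ (a • y) = K.map θ a • Y.map θ y

attribute [reducible] SimplicialAction.act
attribute [instance] SimplicialAction.act

/-- The nerve of a small category, with the convention that an `n`-simplex is a sequence
`c₀ ← c₁ ← ⋯ ← cₙ`, of which the `i`-th face omits `cᵢ`: the nerve of the opposite category. -/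
abbrev opNerve (C : Type u) [Category.{u} C] : SSet.{u} := nerve Cᵒᵖ

/-- The map of nerves induced by a functor. -/
def opNerveMap {C D : Type u} [Category.{u} C] [Category.{u} D] (Φ : C ⥤ D) :
    opNerve C ⟶ opNerve D := nerveMap Φ.op

section

variable {p : ℕ} [Fact p.Prime] {S : Type u} [Group S] {F : FusionSystem S}
  (L : LinkingSystem p F)

/-- The nerve of `𝒜ut_typ(L)` is a simplicial group. -/
instance : SimplicialGroup (opNerve (AutTyp L)) where
  grp n := inferInstanceAs (Group (Fin (n.unop.len + 1) ⥤ (AutTyp L)ᵒᵖ))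
  map_mul _ _ _ := rfl

/-- The nerve of `𝒜ut_typ(L)` acts on the nerve of `L`. -/
instance : SimplicialAction (opNerve (AutTyp L)) (opNerve L.Obj) where
  act n := inferInstanceAs
    (MulAction (Fin (n.unop.len + 1) ⥤ (AutTyp L)ᵒᵖ) (Fin (n.unop.len + 1) ⥤ L.Objᵒᵖ))
  map_smul _ _ _ := rfl

end

/-- A twisting function from a simplicial set `X` to a simplicial group `K`. -/
@[ext]
structure TwistingFunction (X K : SSet.{u}) [SimplicialGroup K] where
  /-- the maps `φ_{n+1} : X_{n+1} → K_n` -/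
  φ : ∀ n : ℕ, X _⦋n + 1⦌ → K _⦋n⦌
  φ_δ : ∀ (n : ℕ) (i : Fin (n + 2)) (x : X _⦋n + 2⦌),
    i ≠ 0 → φ n (X.δ i.succ x) = K.δ i (φ (n + 1) x)
  φ_δ_one : ∀ (n : ℕ) (x : X _⦋n + 2⦌),
    φ n (X.δ 1 x) = K.δ 0 (φ (n + 1) x) * φ n (X.δ 0 x)
  φ_σ : ∀ (n : ℕ) (i : Fin (n + 1)) (x : X _⦋n + 1⦌), φ (n + 1) (X.σ i.succ x) = K.σ i (φ n x)
  φ_σ_zero : ∀ (n : ℕ) (x : X _⦋n⦌), φ n (X.σ 0 x) = 1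

namespace SimplexShift

/-- The map `[m + 1] → [n + 1]` with `0 ↦ 0` and `i + 1 ↦ θ(i) + 1`. -/
def shift {m n : SimplexCategory} (θ : m ⟶ n) : ⦋m.len + 1⦌ ⟶ ⦋n.len + 1⦌ :=
  SimplexCategory.Hom.mk
    { toFun := Fin.cases 0 (fun i => (θ.toOrderHom i).succ)
      monotone' := by
        intro i j h
        induction i using Fin.cases with
        | zero => exact Fin.zero_le _
        | succ i =>
          induction j using Fin.cases with
          | zero => simp at h
          | succ j => exact Fin.succ_le_succ_iff.2 (θ.toOrderHom.monotone (Fin.succ_le_succ_iff.1 h)) }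

@[simp] lemma shift_zero {m n : SimplexCategory} (θ : m ⟶ n) :
    (shift θ).toOrderHom 0 = 0 := rfl

@[simp] lemma shift_succ {m n : SimplexCategory} (θ : m ⟶ n) (i : Fin (m.len + 1)) :
    (shift θ).toOrderHom i.succ = (θ.toOrderHom i).succ := rfl

lemma hom_ext' {m : ℕ} {n : SimplexCategory} {f g : ⦋m + 1⦌ ⟶ n}
    (h0 : f.toOrderHom 0 = g.toOrderHom 0)
    (h : ∀ i : Fin (m + 1), f.toOrderHom i.succ = g.toOrderHom i.succ) : f = g := by
  apply SimplexCategory.Hom.ext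
  apply OrderHom.ext
  funext i
  induction i using Fin.cases with
  | zero => exact h0
  | succ i => exact h i

lemma shift_id (m : SimplexCategory) : shift (𝟙 m) = 𝟙 _ := by
  refine hom_ext' ?_ fun i => ?_
  · rfl
  · rfl

lemma shift_comp {l m n : SimplexCategory} (κ : l ⟶ m) (θ : m ⟶ n) :
    shift (κ ≫ θ) = shift κ ≫ shift θ := by
  refine hom_ext' ?_ fun i => ?_
  · rfl
  · rfl

lemma shift_δ {n : ℕ} (i : Fin (n + 2)) :
    shift (SimplexCategory.δ i) = SimplexCategory.δ i.succ := by
  apply hom_ext'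
  · simp [SimplexCategory.δ]
  · intro j
    simp [SimplexCategory.δ]

lemma shift_σ {n : ℕ} (i : Fin (n + 1)) :
    shift (SimplexCategory.σ i) = SimplexCategory.σ i.succ := by
  apply hom_ext'
  · simp [SimplexCategory.σ]
  · intro j
    simp [SimplexCategory.σ]

lemma δ_zero_shift {m n : ℕ} (θ : (⦋m⦌ : SimplexCategory) ⟶ ⦋n⦌) :
    SimplexCategory.δ 0 ≫ shift θ = θ ≫ SimplexCategory.δ 0 := by
  apply SimplexCategory.Hom.ext
  apply OrderHom.ext
  funext i
  simp [SimplexCategory.δ]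

lemma δ_one_shift_shift {m n : ℕ} (θ : (⦋m⦌ : SimplexCategory) ⟶ ⦋n⦌) :
    SimplexCategory.δ 1 ≫ shift (shift θ) = shift θ ≫ SimplexCategory.δ 1 := by
  have h : (1 : Fin (m + 1 + 2)) = Fin.succ 0 := rfl
  have h' : (1 : Fin (n + 1 + 2)) = Fin.succ 0 := rfl
  rw [h, h', ← shift_δ, ← shift_δ, ← shift_comp, δ_zero_shift, shift_comp]

lemma map_map (X : SSet.{u}) {l m n : SimplexCategory} (f : l ⟶ m) (g : m ⟶ n)
    (x : X.obj (op n)) : X.map f.op (X.map g.op x) = X.map (f ≫ g).op x := by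
  rw [op_comp, X.map_comp]; rfl

lemma δ_zero_map_shift (X : SSet.{u}) {m n : SimplexCategory} (θ : m ⟶ n) (x : X _⦋n.len + 1⦌) :
    X.δ 0 (X.map (shift θ).op x) = X.map θ.op (X.δ 0 x) := by
  have h := δ_zero_shift (m := m.len) (n := n.len) θ
  have h1 := map_map X (SimplexCategory.δ (0 : Fin (m.len + 2))) (shift θ) x
  have h2 := map_map X θ (SimplexCategory.δ (0 : Fin (n.len + 2))) x
  rw [h] at h1
  exact h1.trans h2.symm

lemma δ_one_map_shift (X : SSet.{u}) {m n : SimplexCategory} (θ : m ⟶ n) (x : X _⦋n.len + 2⦌) :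
    X.δ 1 (X.map (shift (shift θ)).op x) = X.map (shift θ).op (X.δ 1 x) := by
  have h := δ_one_shift_shift (m := m.len) (n := n.len) θ
  have h1 := map_map X (SimplexCategory.δ (1 : Fin (m.len + 3))) (shift (shift θ)) x
  have h2 := map_map X (shift θ) (SimplexCategory.δ (1 : Fin (n.len + 3))) x
  rw [h] at h1
  exact h1.trans h2.symm

end SimplexShift

namespace TwistingFunction

open SimplexShift

variable {X K : SSet.{u}} [SimplicialGroup K] (φ : TwistingFunction X K)

lemma φ_shift {m n : SimplexCategory} (θ : m ⟶ n) (y : X _⦋n.len + 2⦌) :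
    φ.φ (m.len + 1) (X.map (shift (shift θ)).op y) =
      K.map (shift θ).op (φ.φ (n.len + 1) y) := by
  let W : MorphismProperty SimplexCategory := fun m n θ => ∀ y : X _⦋n.len + 2⦌,
    φ.φ (m.len + 1) (X.map (shift (shift θ)).op y) = K.map (shift θ).op (φ.φ (n.len + 1) y)
  have : W.IsMultiplicative :=
    { id_mem := fun n y => by
        simp only [shift_id, op_id, CategoryTheory.Functor.map_id]
        rfl
      comp_mem := fun f g hf hg y => by
        simp only [shift_comp, op_comp, CategoryTheory.Functor.map_comp, types_comp_apply]
        have h1 := hf (X.map (shift (shift g)).op y)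
        rw [hg y] at h1
        exact h1 }
  have hW : W = ⊤ := by
    apply SimplexCategory.morphismProperty_eq_top
    · intro n i y
      rw [shift_δ, shift_δ]
      exact φ.φ_δ _ i.succ y (Fin.succ_ne_zero i)
    · intro n i y
      rw [shift_σ, shift_σ]
      exact φ.φ_σ _ i.succ y
  have h : W θ := by rw [hW]; trivial
  exact h y

/-- For `θ : [m] → [n]` and `g ∈ X_n`, the value of `φ` at `(θ⁺)^* g ∈ X_{m+1}`, where
`θ⁺ : [m + 1] → [n]` is given by `0 ↦ 0` and `i + 1 ↦ θ(i)`. -/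
def twist {m n : SimplexCategory} (θ : m ⟶ n) (g : X _⦋n.len⦌) : K _⦋m.len⦌ :=
  φ.φ m.len (X.map (shift θ).op (X.σ 0 g))

lemma twist_id (n : SimplexCategory) (g : X _⦋n.len⦌) : φ.twist (𝟙 n) g = 1 := by
  unfold twist
  rw [shift_id, op_id, CategoryTheory.Functor.map_id]
  exact φ.φ_σ_zero _ _

lemma twist_comp {l m n : SimplexCategory} (κ : l ⟶ m) (θ : m ⟶ n) (g : X _⦋n.len⦌) :
    φ.twist (κ ≫ θ) g = K.map κ.op (φ.twist θ g) * φ.twist κ (X.map θ.op g) := by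
  let y : X _⦋m.len + 1⦌ := X.map (shift θ).op (X.σ 0 g)
  let x : X _⦋l.len + 2⦌ := X.map (shift (shift κ)).op (X.σ 1 y)
  have hφ := φ.φ_δ_one _ x
  have h1 : X.δ 1 x = X.map (shift (κ ≫ θ)).op (X.σ 0 g) := by
    have e : X.δ 1 (X.σ 1 y) = y := SSet.δ_comp_σ_self'_apply (S := X) (i := 1) (j := 1) rfl y
    rw [δ_one_map_shift, e, map_map, shift_comp]
  have h2 : φ.φ (l.len + 1) x = K.map (shift κ).op (K.σ 0 (φ.φ m.len y)) := by
    rw [← φ.φ_σ]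
    exact φ.φ_shift κ _
  have h3 : K.δ 0 (φ.φ (l.len + 1) x) = K.map κ.op (φ.φ m.len y) := by
    have e : K.δ 0 (K.σ 0 (φ.φ m.len y)) = φ.φ m.len y :=
      SSet.δ_comp_σ_self'_apply (S := K) (i := 0) (j := 0) rfl _
    rw [h2, δ_zero_map_shift, e]
  have h4 : X.δ 0 x = X.map (shift κ).op (X.σ 0 (X.map θ.op g)) := by
    have e : X.δ 0 (X.σ 0 g) = g :=
      SSet.δ_comp_σ_self'_apply (S := X) (i := 0) (j := 0) rfl _
    have e1 : X.δ 0 y = X.map θ.op g := by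
      rw [δ_zero_map_shift, e]
    have e2 : X.δ 0 (X.σ 1 y) = X.σ 0 (X.δ 0 y) :=
      SSet.δ_comp_σ_of_le_apply (S := X) (i := 0) (j := 0) le_rfl y
    have e3 := δ_zero_map_shift X (shift κ) (X.σ 1 y)
    rw [e2, e1] at e3
    exact e3
  rw [h1, h3, h4] at hφ
  exact hφ

lemma twist_δ_zero {n : ℕ} (g : X _⦋n + 1⦌) :
    φ.twist (SimplexCategory.δ (0 : Fin (n + 2))) g = φ.φ n g := by
  unfold twist
  rw [shift_δ]
  have e : X.δ (Fin.succ 0) (X.σ 0 g) = g := SSet.δ_comp_σ_succ_apply (S := X) 0 g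
  exact congrArg _ e

lemma twist_δ_succ {n : ℕ} (i : Fin (n + 1)) (g : X _⦋n + 1⦌) :
    φ.twist (SimplexCategory.δ i.succ) g = 1 := by
  unfold twist
  rw [shift_δ]
  have e : X.δ i.succ.succ (X.σ 0 g) = X.σ 0 (X.δ i.succ g) :=
    SSet.δ_comp_σ_of_gt_apply (S := X) (i := i.succ) (j := 0) (Fin.succ_pos i) g
  exact (congrArg _ e).trans (φ.φ_σ_zero _ _)

lemma twist_σ {n : ℕ} (i : Fin (n + 1)) (g : X _⦋n⦌) :
    φ.twist (SimplexCategory.σ i) g = 1 := by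
  unfold twist
  rw [shift_σ]
  have e : X.σ i.succ (X.σ 0 g) = X.σ 0 (X.σ i g) :=
    (SSet.σ_comp_σ_apply (S := X) (i := 0) (j := i) (Fin.zero_le i) g).symm
  exact (congrArg _ e).trans (φ.φ_σ_zero _ _)

end TwistingFunction

/-- The twisted cartesian product `E(φ)`: its `n`-simplices are the pairs `(ξ, g) ∈ Y_n × X_n`, with
`d₀(ξ, g) = (φ(g)⁻¹ · d₀ ξ, d₀ g)`, `d_i(ξ, g) = (d_i ξ, d_i g)` for `i > 0`, and
`s_i(ξ, g) = (s_i ξ, s_i g)` for all `i`. -/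
def twistedProduct {X K : SSet.{u}} [SimplicialGroup K] (φ : TwistingFunction X K)
    (Y : SSet.{u}) [SimplicialAction K Y] : SSet.{u} where
  obj n := Y.obj n × X.obj n
  map {n m} θ := ↾fun z => ((φ.twist θ.unop z.2)⁻¹ • Y.map θ z.1, X.map θ z.2)
  map_id n := by
    apply ConcreteCategory.hom_ext
    intro z
    refine Prod.ext ?_ ?_
    · change (φ.twist (𝟙 n.unop) z.2)⁻¹ • Y.map (𝟙 n) z.1 = z.1
      have h : φ.twist (𝟙 n.unop) z.2 = 1 := φ.twist_id n.unop z.2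
      rw [h, Y.map_id, inv_one]
      exact one_smul (K.obj n) z.1
    · change X.map (𝟙 n) z.2 = z.2
      rw [X.map_id]; rfl
  map_comp {l m n} f g := by
    apply ConcreteCategory.hom_ext
    intro z
    refine Prod.ext ?_ ?_
    · change (φ.twist (g.unop ≫ f.unop) z.2)⁻¹ • Y.map (f ≫ g) z.1 =
        (φ.twist g.unop (X.map f z.2))⁻¹ • Y.map g ((φ.twist f.unop z.2)⁻¹ • Y.map f z.1)
      have h1 := φ.twist_comp g.unop f.unop z.2
      have h2 := SimplicialAction.map_smul g (φ.twist f.unop z.2)⁻¹ (Y.map f z.1)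
      have h3 : K.map g (φ.twist f.unop z.2)⁻¹ = (K.map g (φ.twist f.unop z.2))⁻¹ :=
        eq_inv_of_mul_eq_one_left (by
          rw [← SimplicialGroup.map_mul, inv_mul_cancel]
          have h4 : K.map g 1 * K.map g 1 = K.map g 1 := by
            rw [← SimplicialGroup.map_mul, one_mul]
          exact mul_eq_left.1 h4)
      rw [h2, h3, smul_smul, ← mul_inv_rev, Y.map_comp]
      exact congrArg (fun k => k⁻¹ • Y.map g (Y.map f z.1)) h1
    · change X.map (f ≫ g) z.2 = X.map g (X.map f z.2)
      rw [X.map_comp]; rfl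

namespace twistedProduct

variable {X K : SSet.{u}} [SimplicialGroup K] (φ : TwistingFunction X K)
    (Y : SSet.{u}) [SimplicialAction K Y]

lemma δ_zero {n : ℕ} (ξ : Y _⦋n + 1⦌) (g : X _⦋n + 1⦌) :
    (twistedProduct φ Y).δ 0 (ξ, g) = ((φ.φ n g)⁻¹ • Y.δ 0 ξ, X.δ 0 g) := by
  refine Prod.ext ?_ rfl
  exact congrArg (fun k => k⁻¹ • Y.δ 0 ξ) (φ.twist_δ_zero g)

lemma δ_succ {n : ℕ} (i : Fin (n + 1)) (ξ : Y _⦋n + 1⦌) (g : X _⦋n + 1⦌) :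
    (twistedProduct φ Y).δ i.succ (ξ, g) = (Y.δ i.succ ξ, X.δ i.succ g) := by
  refine Prod.ext ?_ rfl
  refine (congrArg (fun k => k⁻¹ • Y.δ i.succ ξ) (φ.twist_δ_succ i g)).trans ?_
  simp

lemma σ_apply {n : ℕ} (i : Fin (n + 1)) (ξ : Y _⦋n⦌) (g : X _⦋n⦌) :
    (twistedProduct φ Y).σ i (ξ, g) = (Y.σ i ξ, X.σ i g) := by
  refine Prod.ext ?_ rfl
  refine (congrArg (fun k => k⁻¹ • Y.σ i ξ) (φ.twist_σ i g)).trans ?_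
  simp

/-- The projection `p_φ : E(φ) → X`. -/
def proj : twistedProduct φ Y ⟶ X where
  app _ := ↾fun z => z.2
  naturality _ _ _ := rfl

end twistedProduct

/-! ## Extension pairs and the extended category -/

/-- The category `B(G)` with a single object and with `G` as its group of automorphisms, where
`g ∘ h = g * h`. -/
structure OneObj (G : Type u) : Type u where

instance (G : Type u) [Group G] : Category.{u} (OneObj G) where
  Hom _ _ := G
  id _ := (1 : G)
  comp g h := (h * g : G)
  id_comp _ := mul_one _
  comp_id _ := one_mul _
  assoc _ _ _ := (mul_assoc _ _ _).symm

/-- An extension pair for `L` and `G`: an extension `1 → Γ → Γ̂ → G → 1` of `Γ = Aut_L(S)` by `G`,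
together with a homomorphism `τ : Γ̂ → Aut_typ^I(L)` which agrees with `λ ↦ c_λ` on `Γ`, and such
that `τ(g)_S ∈ Aut(Γ)` is conjugation by `g` for each `g ∈ Γ̂`. -/
structure ExtensionPair {p : ℕ} [Fact p.Prime] {S : Type u} [Group S] {F : FusionSystem S}
    (L : LinkingSystem p F) (G : Type u) [Group G] where
  /-- the extension group -/
  Γhat : Type u
  [group : Group Γhat]
  /-- the inclusion of `Γ` -/
  incl : L.Gam →* Γhat
  /-- the projection to `G` -/
  ρ : Γhat →* G
  incl_injective : Function.Injective incl
  ρ_surjective : Function.Surjective ρ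
  exact : ρ.ker = incl.range
  /-- the action on `L` -/
  τ : Γhat →* TypAut L
  τ_incl : ∀ l : L.Gam, τ (incl l) = TypAut.c L l
  τ_conj : ∀ (g : Γhat) (l : L.Gam), incl (TypAut.evS L (τ g) l) = g * incl l * g⁻¹

attribute [instance] ExtensionPair.group

/-- The objects of the category `L_U`: the objects of `L`. -/
@[ext]
structure ExtCat {p : ℕ} [Fact p.Prime] {S : Type u} [Group S] {F : FusionSystem S}
    {L : LinkingSystem p F} {G : Type u} [Group G] (U : ExtensionPair L G) : Type u where
  /-- the underlying object of `L` -/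
  obj : L.Obj

namespace ExtCat

variable {p : ℕ} [Fact p.Prime] {S : Type u} [Group S] {F : FusionSystem S}
  {L : LinkingSystem p F} {G : Type u} [Group G] {U : ExtensionPair L G}

/-- The pairs `(φ, γ)` with `γ ∈ Γ̂` and `φ : τ(γ)(P) → Q` a morphism of `L`. -/
structure Pre (P Q : ExtCat U) : Type u where
  /-- the element of the extension group -/
  γ : U.Γhat
  /-- the morphism of `L` -/
  φ : (U.τ γ).F.obj P.obj ⟶ Q.obj

/-- `(φ, γ) ∼ (φ', γ')` if and only if `φ' = φ λ` and `γ' = λ⁻¹ γ` for some `λ ∈ Γ`, where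
`φ λ` is the composite of `φ` with the restriction of `λ`. -/
def Rel {P Q : ExtCat U} (a b : Pre P Q) : Prop :=
  ∃ (l : L.Gam) (μ : (U.τ b.γ).F.obj P.obj ⟶ (U.τ a.γ).F.obj P.obj),
    IsRestr l μ ∧ b.γ = (U.incl l)⁻¹ * a.γ ∧ b.φ = μ ≫ a.φ

lemma τ_eq {l : L.Gam} {γ γ' : U.Γhat} (h : γ' = (U.incl l)⁻¹ * γ) :
    U.τ γ = TypAut.c L l * U.τ γ' := by
  rw [h, map_mul, map_inv, U.τ_incl, mul_inv_cancel_left]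

lemma Rel.refl {P Q : ExtCat U} (a : Pre P Q) : Rel a a :=
  ⟨1, 𝟙 _, isRestr_id _, by simp, by simp⟩

lemma Rel.symm {P Q : ExtCat U} {a b : Pre P Q} (h : Rel a b) : Rel b a := by
  obtain ⟨l, μ, h1, h2, h3⟩ := h
  have h4 : b.γ = (U.incl l)⁻¹ * a.γ := h2
  have h5 : a.γ = (U.incl l⁻¹)⁻¹ * b.γ := by rw [h2, map_inv, inv_inv, mul_inv_cancel_left]
  refine ⟨l⁻¹, TypAut.comp (τ_eq h5) P.obj, TypAut.comp_spec _ _, h5, ?_⟩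
  have h6 : TypAut.comp (τ_eq h5) P.obj ≫ μ = 𝟙 _ := by
    have := (TypAut.comp_spec (τ_eq h5) P.obj).comp h1
    rw [mul_inv_cancel] at this
    exact this.unique (isRestr_id _)
  rw [h3, ← Category.assoc, h6, Category.id_comp]

lemma Rel.trans {P Q : ExtCat U} {a b c : Pre P Q} (h : Rel a b) (h' : Rel b c) : Rel a c := by
  obtain ⟨l, μ, h1, h2, h3⟩ := h
  obtain ⟨l', μ', h1', h2', h3'⟩ := h'
  refine ⟨l * l', μ' ≫ μ, h1'.comp h1, ?_, ?_⟩
  · rw [h2', h2, map_mul, mul_inv_rev, mul_assoc]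
  · rw [h3', h3, Category.assoc]

/-- The relation `∼`. -/
instance setoid (P Q : ExtCat U) : Setoid (Pre P Q) where
  r := Rel
  iseqv := ⟨Rel.refl, Rel.symm, Rel.trans⟩

lemma τ_mul_obj (η γ : U.Γhat) (P : L.Obj) :
    (U.τ (η * γ)).F.obj P = (U.τ η).F.obj ((U.τ γ).F.obj P) :=
  TypAut.congr_obj (map_mul U.τ η γ) P

lemma τ_one_obj (P : L.Obj) : (U.τ 1).F.obj P = P := TypAut.congr_obj (map_one U.τ) P

lemma τ_map_congr {α β : TypAut L} (h : α = β) {P Q : L.Obj} (f : P ⟶ Q) :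
    α.F.map f ≫ eqToHom (TypAut.congr_obj h Q) = eqToHom (TypAut.congr_obj h P) ≫ β.F.map f := by
  subst h; simp

/-- The pair `(id, 1)`. -/
def Pre.id (P : ExtCat U) : Pre P P := ⟨1, eqToHom (τ_one_obj P.obj)⟩

/-- The composite `(ψ, η) ∘ (φ, γ) = (ψ ∘ τ(η)(φ), η γ)`. -/
def Pre.comp {P Q R : ExtCat U} (a : Pre P Q) (b : Pre Q R) : Pre P R :=
  ⟨b.γ * a.γ, eqToHom (τ_mul_obj b.γ a.γ P.obj) ≫ (U.τ b.γ).F.map a.φ ≫ b.φ⟩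

lemma eqToHom_aux₁ {C : Type u} [Category.{u} C] {A X Y Z W V R : C} (e₁ : A = X) (m : X ⟶ Y)
    (c : Y ⟶ Z) (e₂ : Z = W) (e₃ : W = Z) (f : Z ⟶ V) (g : V ⟶ R) :
    (((eqToHom e₁ ≫ m) ≫ c) ≫ eqToHom e₂) ≫ (eqToHom e₃ ≫ f ≫ g) =
      eqToHom e₁ ≫ m ≫ (c ≫ f) ≫ g := by
  subst e₂; simp

lemma eqToHom_aux₂ {C : Type u} [Category.{u} C] {A X Y Z : C} (e₁ : A = X) (e₂ : X = Y)
    (e₃ : A = Y) (f : Y ⟶ Z) : eqToHom e₁ ≫ eqToHom e₂ ≫ f = eqToHom e₃ ≫ f := by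
  subst e₁; subst e₂; simp

lemma eqToHom_aux₃ {C : Type u} [Category.{u} C] (Φ : C ⥤ C) {A A' X Y Z W T Y' Z' : C}
    (e₁ : A = Φ.obj X) (e₂ : X = Y) (m : Y ⟶ Z) (ψ : Z ⟶ W) (ω : Φ.obj W ⟶ T)
    (e : A = A') (e₃ : A' = Y') (n : Y' ⟶ Z') (e₄ : Z' = Φ.obj Z) (e₅ : Y' = Φ.obj Y)
    (h : n ≫ eqToHom e₄ = eqToHom e₅ ≫ Φ.map m) :
    eqToHom e₁ ≫ Φ.map (eqToHom e₂ ≫ m ≫ ψ) ≫ ω =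
      eqToHom e ≫ eqToHom e₃ ≫ n ≫ eqToHom e₄ ≫ Φ.map ψ ≫ ω := by
  subst e₂; subst e₃; subst e
  rw [← Category.assoc n, h]
  simp

lemma Pre.comp_rel {P Q R : ExtCat U} {a a' : Pre P Q} {b b' : Pre Q R}
    (h : Rel a a') (h' : Rel b b') : Rel (a.comp b) (a'.comp b') := by
  obtain ⟨l, μ, h1, h2, h3⟩ := h
  obtain ⟨k, ν, h1', h2', h3'⟩ := h'
  have hν : ν = TypAut.comp (τ_eq h2') Q.obj := h1'.unique (TypAut.comp_spec _ _)
  have hr := (((isRestr_eqToHom (τ_mul_obj b'.γ a'.γ P.obj)).comp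
    ((U.τ b'.γ).isRestr_map h1)).comp (TypAut.comp_spec (τ_eq h2') _)).comp
    (isRestr_eqToHom (τ_mul_obj b.γ a.γ P.obj).symm)
  rw [one_mul, mul_one] at hr
  refine ⟨_, _, hr, ?_, ?_⟩
  · have h4 := U.τ_conj b'.γ l
    rw [TypAut.evS_apply] at h4
    change b'.γ * a'.γ = _ * (b.γ * a.γ)
    rw [map_mul, h4, h2', h2]
    group
  · refine Eq.trans ?_ (eqToHom_aux₁ _ _ _ _ _ _ _).symm
    change eqToHom _ ≫ (U.τ b'.γ).F.map a'.φ ≫ b'.φ =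
      eqToHom _ ≫ (U.τ b'.γ).F.map μ ≫
        (TypAut.comp (τ_eq h2') ((U.τ a.γ).F.obj P.obj) ≫ (U.τ b.γ).F.map a.φ) ≫ b.φ
    have h5 := TypAut.comp_naturality (τ_eq h2') a.φ
    rw [← h5, h3, h3', hν, Functor.map_comp]
    simp only [Category.assoc]

lemma rel_of_eqToHom {P Q : ExtCat U} {a b : Pre P Q} (h : b.γ = a.γ)
    (h' : b.φ = eqToHom (by rw [h]) ≫ a.φ) : Rel a b :=
  ⟨1, _, isRestr_eqToHom _, by rw [h]; simp, h'⟩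

/-- The category `L_U`. -/
instance : Category.{u} (ExtCat U) where
  Hom P Q := Quotient (setoid P Q)
  id P := Quotient.mk _ (Pre.id P)
  comp := Quotient.map₂ Pre.comp (fun _ _ h _ _ h' => Pre.comp_rel h h')
  id_comp {P Q} f := by
    induction f using Quotient.ind with | _ a
    refine Quotient.sound (Rel.symm (rel_of_eqToHom (mul_one a.γ) ?_))
    change eqToHom _ ≫ (U.τ a.γ).F.map (eqToHom (τ_one_obj P.obj)) ≫ a.φ = _
    rw [eqToHom_map]
    exact eqToHom_aux₂ _ _ _ _
  comp_id {P Q} f := by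
    induction f using Quotient.ind with | _ a
    refine Quotient.sound (Rel.symm (rel_of_eqToHom (one_mul a.γ) ?_))
    change eqToHom _ ≫ (U.τ 1).F.map a.φ ≫ eqToHom (τ_one_obj Q.obj) = _
    have h := τ_map_congr (map_one U.τ) a.φ
    exact (congrArg (fun t => eqToHom _ ≫ t) h).trans (eqToHom_aux₂ _ _ _ _)
  assoc {P Q R T} f g h := by
    induction f using Quotient.ind with | _ a
    induction g using Quotient.ind with | _ b
    induction h using Quotient.ind with | _ c
    refine Quotient.sound (Rel.symm (rel_of_eqToHom (mul_assoc c.γ b.γ a.γ).symm ?_))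
    have h := τ_map_congr (map_mul U.τ c.γ b.γ) a.φ
    exact eqToHom_aux₃ (U.τ c.γ).F _ _ _ _ _ _ _ _ _ _ h

/-- The morphism `⟦φ, γ⟧ : P → Q` of `L_U`. -/
def homMk {P Q : ExtCat U} (γ : U.Γhat) (φ : (U.τ γ).F.obj P.obj ⟶ Q.obj) : P ⟶ Q :=
  Quotient.mk (setoid P Q) ⟨γ, φ⟩

variable (U) in
/-- The functor `pr : L_U → B(G)`, `⟦φ, γ⟧ ↦ ρ(γ)`. -/
def pr : ExtCat U ⥤ OneObj G where
  obj _ := ⟨⟩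
  map {P Q} f := Quotient.lift (s := setoid P Q) (fun a => U.ρ a.γ) (by
    rintro a b ⟨l, μ, -, h2, -⟩
    have : U.ρ (U.incl l) = 1 := by
      rw [← MonoidHom.mem_ker, U.exact]; exact ⟨l, rfl⟩
    change U.ρ a.γ = U.ρ b.γ
    rw [h2, map_mul, map_inv, this, inv_one, one_mul]) f
  map_id P := map_one U.ρ
  map_comp {P Q R} f g := by
    induction f using Quotient.ind with | _ a
    induction g using Quotient.ind with | _ b
    exact map_mul U.ρ b.γ a.γ

end ExtCat

/-! ## The twisting function of an extension pair with regular section -/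

/-- The 1-simplex `[g] = (• ← •)` of the nerve of `B(G)`. -/
def bar₁ {G : Type u} [Group G] (g : G) : opNerve (OneObj G) _⦋1⦌ :=
  ComposableArrows.mk₁ (Quiver.Hom.op (X := OneObj.mk) (Y := OneObj.mk) g)

/-- The 2-simplex `[g|h] = (• ← • ← •)` of the nerve of `B(G)`. -/
def bar₂ {G : Type u} [Group G] (g h : G) : opNerve (OneObj G) _⦋2⦌ :=
  ComposableArrows.mk₂ (Quiver.Hom.op (X := OneObj.mk) (Y := OneObj.mk) g)
    (Quiver.Hom.op (X := OneObj.mk) (Y := OneObj.mk) h)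

section

variable {p : ℕ} [Fact p.Prime] {S : Type u} [Group S] {F : FusionSystem S}
  {L : LinkingSystem p F}

/-- The element of `Aut_typ^I(L)` which is a given vertex of the nerve of `𝒜ut_typ(L)`. -/
def vertexAut (a : opNerve (AutTyp L) _⦋0⦌) : TypAut L := AutTyp.ob (J := Fin 1) a 0

/-- The element `χ ∈ Aut_L(S)` which underlies a given edge `α₀ ← α₁` of the nerve of
`𝒜ut_typ(L)`. -/
def edgeGam (a : opNerve (AutTyp L) _⦋1⦌) : L.Gam :=
  AutTyp.chi (J := Fin 2) a (i := 0) (j := 1) (homOfLE (Fin.zero_le 1))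

/-- The twisting function `φ` is associated with the extension pair `U` and its section `t`:
`φ₁([g]) = τ(t(g))`, and `t(g) t(h) = φ₂([g|h]) t(gh)`. -/
structure IsAssociated {G : Type u} [Group G] (U : ExtensionPair L G) (t : G → U.Γhat)
    (φ : TwistingFunction (opNerve (OneObj G)) (opNerve (AutTyp L))) : Prop where
  vertex : ∀ g : G, U.τ (t g) = vertexAut (φ.φ 0 (bar₁ g))
  edge : ∀ g h : G, t g * t h = U.incl (edgeGam (φ.φ 1 (bar₂ g h))) * t (g * h)

end

/-! ## Fibre bundles whose structure group is the realization of a simplicial group -/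

/-- The product `A × B` with its compactly generated topology: the product in the category of
compactly generated spaces. -/
def KProd (A B : Type u) : Type u := A × B

instance (A B : Type u) [TopologicalSpace A] [TopologicalSpace B] :
    TopologicalSpace (KProd A B) :=
  TopologicalSpace.compactlyGenerated.{u} (A × B)

/-- The multiplication of a simplicial group. -/
def mulMap (K : SSet.{u}) [SimplicialGroup K] : K ⊗ K ⟶ K where
  app n := ↾fun z : K.obj n × K.obj n => z.1 * z.2
  naturality _ _ θ := by
    apply ConcreteCategory.hom_ext
    intro z
    exact (SimplicialGroup.map_mul θ z.1 z.2).symm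

/-- The action of a simplicial group on a simplicial set. -/
def smulMap (K Y : SSet.{u}) [SimplicialGroup K] [SimplicialAction K Y] : K ⊗ Y ⟶ Y where
  app n := ↾fun z : K.obj n × Y.obj n => z.1 • z.2
  naturality _ _ θ := by
    apply ConcreteCategory.hom_ext
    intro z
    exact (SimplicialAction.map_smul θ z.1 z.2).symm

/-- For a simplicial map `f : X × Y → Z`, the graph `{(x, y, z)}` of the function
`|X| × |Y| ≅ |X × Y| → |Z|`, where the bijection on the left is induced by the projections.  For the
multiplication of a simplicial group `K` and for its action on `Y` this describes the multiplication
of the topological group `|K|` and its action on `|Y|`. -/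
def RealRel {X Y Z : SSet.{u}} (f : X ⊗ Y ⟶ Z) (x : SSet.toTop.obj X) (y : SSet.toTop.obj Y)
    (z : SSet.toTop.obj Z) : Prop :=
  ∃ w : SSet.toTop.obj (X ⊗ Y),
    SSet.toTop.map (CartesianMonoidalCategory.fst X Y) w = x ∧
    SSet.toTop.map (CartesianMonoidalCategory.snd X Y) w = y ∧
    SSet.toTop.map f w = z

/-- Local trivializations of `q : E → B` as a fibre bundle with fibre `|Y|` and structure group `|K|`
(acting on `|Y|` through the action of `K` on `Y`): homeomorphisms `q⁻¹(U_i) ≅ U_i × |Y|` over the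
sets `U_i` of an open cover of `B`, with `chart_i ∘ chart_j⁻¹ (b, y) = (b, g_ij(b) y)` for continuous
transition functions `g_ij : U_i ∩ U_j → |K|` which satisfy the cocycle condition. -/
structure BundleAtlas {E B : Type u} [TopologicalSpace E] [TopologicalSpace B] (q : E → B)
    (K Y : SSet.{u}) [SimplicialGroup K] [SimplicialAction K Y] where
  /-- the index set of the open cover -/
  ι : Type u
  /-- the open cover -/
  U : ι → Set B
  isOpen : ∀ i, IsOpen (U i)
  covers : ∀ b, ∃ i, b ∈ U i
  /-- the local trivializations -/
  chart : ∀ i, (q ⁻¹' U i : Set E) ≃ₜ KProd (U i) (SSet.toTop.obj Y)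
  chart_fst : ∀ i e, ((chart i e).1 : B) = q e
  /-- the transition functions -/
  g : ∀ i j, C((U i ∩ U j : Set B), SSet.toTop.obj K)
  transition : ∀ i j (e : E) (hi : q e ∈ U i) (hj : q e ∈ U j),
    RealRel (smulMap K Y) (g i j ⟨q e, hi, hj⟩) (chart j ⟨e, hj⟩).2 (chart i ⟨e, hi⟩).2
  cocycle : ∀ i j k (b : B) (hi : b ∈ U i) (hj : b ∈ U j) (hk : b ∈ U k),
    RealRel (mulMap K) (g i j ⟨b, hi, hj⟩) (g j k ⟨b, hj, hk⟩) (g i k ⟨b, hi, hk⟩)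

/-- `q : E → B` is a fibre bundle with fibre `|Y|` and structure group `|K|`. -/
def IsFibreBundle {E B : Type u} [TopologicalSpace E] [TopologicalSpace B] (q : E → B)
    (K Y : SSet.{u}) [SimplicialGroup K] [SimplicialAction K Y] : Prop :=
  Nonempty (BundleAtlas q K Y)

end

-- Everything comes from choosing frames. The canonical isomorphism ⟦id, γ⟧ : P → τ(γ)(P) of L_U
-- (`ExtCat.frame`) lies over ρ(γ). If A is a simplex of the nerve of L_U over x in the nerve of
-- B(G), and the elements u j of Γ̂ satisfy ρ(u i) · x_ij = ρ(u j), then the frames of the u j carry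
-- A to a diagram ξ in L, and for given u the diagrams A and ξ determine each other (`Framed`).
-- Replacing u j by v j · u j, where all v j have the same image in G, replaces ξ by the product of
-- ξ with the simplex `diag v` of the nerve of 𝒜ut_typ(L), whose vertices are τ(v j) and whose edges
-- are v i (v j)⁻¹ ∈ Γ (`Framed.smul`).
--
-- Twisted product: a section t frames the j-th vertex by t(x_0j). The face d₀ moves the base vertex
-- from 0 to 1, so its own frames are t(x_1j); the ratios t(x_0j) t(x_1j)⁻¹ form the twisting
-- function, and its identities are telescoping products. Reading A as the pair (ξ, x) is then the
-- isomorphism with E(φ). For uniqueness, a diagram in 𝒜ut_typ(L) is determined by its vertices and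
-- edges, and the restriction of φ(x) to an m-dimensional face is a ratio of two values of φ in K_m
-- (`TwistingFunction.map_φ`); so the prescribed vertices and edges fix φ.
--
-- Bundle: framing by t(a_j), for any lift a of x to the universal cover EG, exhibits the nerve of
-- L_U as the quotient of NL × EG by the free action g(ξ, a) = (κ_g(a) · ξ, ga), where κ_g(a) has
-- the frame changes t(g a_j) t(a_j)⁻¹ and is a cocycle by telescoping (`ExtCat.twistedQuotient`).
-- Local sections of |EG| → BG trivialize this quotient; the transition functions are the |κ_g|
-- evaluated on a section, with g locally constant (`TwistedQuotient.atlas`).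
--
-- Realization: a point of |X| is a simplex together with a partition of [0, 1) into consecutive
-- intervals. Any two partitions have a common refinement with positive lengths
-- (`exists_common_refinement`), and sampling at left endpoints recovers the simplex
-- (`charMap_injective_of_pos`). Hence statements about two points reduce to two simplices of the
-- same dimension: this gives the bijection |X × Y| → |X| × |Y| and the passage from quotients by G
-- of simplicial sets to quotients of spaces. The same picture provides the sheets of |EG|: the
-- points whose G-valued step function equals g on more than half of [0, s].

universe v w

noncomputable section

/-! ## Points of the geometric realization -/

namespace Realization

variable {X Y : SSet.{u}}

/-- The topological simplex with the vertices of `n`. -/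
abbrev TopSimplex (n : SimplexCategory) : Type := stdSimplex ℝ (Fin (n.len + 1))

/-- The continuous map between topological simplices induced by a monotone map. -/
def topSimplexMap {m n : SimplexCategory} (θ : m ⟶ n) : C(TopSimplex m, TopSimplex n) :=
  ⟨stdSimplex.map θ, stdSimplex.continuous_map _⟩

/-- The characteristic map of a simplex. -/
def charMap {n : SimplexCategory} (x : X.obj (op n)) : C(TopSimplex n, SSet.toTop.obj X) :=
  TopCat.toSSetObjEquiv _ (op n) ((sSetTopAdj.unit.app X).app (op n) x)

lemma charMap_map {m n : SimplexCategory} (θ : m ⟶ n) (x : X.obj (op n)) (t : TopSimplex m) :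
    charMap (X.map θ.op x) t = charMap x (topSimplexMap θ t) := by
  have h := ConcreteCategory.congr_hom ((sSetTopAdj.unit.app X).naturality θ.op) x
  exact congrArg (fun k => TopCat.toSSetObjEquiv _ (op m) k t) h

lemma toTop_map_charMap (f : X ⟶ Y) {n : SimplexCategory} (x : X.obj (op n)) (t : TopSimplex n) :
    SSet.toTop.map f (charMap x t) = charMap (f.app _ x) t := by
  have h := congrArg (fun k => TopCat.toSSetObjEquiv _ (op n) (k.app (op n) x) t)
    (sSetTopAdj.unit.naturality f)
  exact h.symm

/-- A compatible family of continuous maps on the simplices of `X`. -/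
structure SimplexFamily (X : SSet.{u}) (T : Type*) [TopologicalSpace T] where
  /-- the map on a simplex -/
  map : ∀ {n : SimplexCategory}, X.obj (op n) → C(TopSimplex n, T)
  compat : ∀ {m n : SimplexCategory} (θ : m ⟶ n) (x : X.obj (op n)) (t : TopSimplex m),
    map (X.map θ.op x) t = map x (topSimplexMap θ t)

/-- The simplicial map to the singular simplicial set given by a compatible family. -/
def SimplexFamily.toSing {T : Type u} [TopologicalSpace T] (f : SimplexFamily X T) :
    X ⟶ TopCat.toSSet.obj (TopCat.of T) where
  app n := ↾fun x => (TopCat.toSSetObjEquiv (TopCat.of T) n).symm (f.map (n := n.unop) x)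
  naturality m n θ := by
    apply ConcreteCategory.hom_ext
    intro x
    change (TopCat.toSSetObjEquiv (TopCat.of T) n).symm (f.map (X.map θ x)) = _
    have h : f.map (X.map θ x) = (f.map (n := m.unop) x).comp (topSimplexMap θ.unop) := by
      ext t
      exact f.compat θ.unop x t
    rw [h]
    rfl

/-- The map on the realization given by a compatible family. -/
def SimplexFamily.desc {T : Type u} [TopologicalSpace T] (f : SimplexFamily X T) :
    C(SSet.toTop.obj X, T) :=
  ((sSetTopAdj.homEquiv X (TopCat.of T)).symm f.toSing).hom

lemma SimplexFamily.desc_charMap {T : Type u} [TopologicalSpace T] (f : SimplexFamily X T)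
    {n : SimplexCategory} (x : X.obj (op n)) (t : TopSimplex n) :
    f.desc (charMap x t) = f.map x t := by
  have h := congrArg (fun k => TopCat.toSSetObjEquiv (TopCat.of T) (op n) (k.app (op n) x) t)
    ((sSetTopAdj.homEquiv X (TopCat.of T)).apply_symm_apply f.toSing)
  exact h

lemma hom_ext_charMap {T : Type u} [TopologicalSpace T] {f g : C(SSet.toTop.obj X, T)}
    (h : ∀ {n : SimplexCategory} (x : X.obj (op n)) (t : TopSimplex n),
      f (charMap x t) = g (charMap x t)) : f = g := by
  have : TopCat.ofHom f = TopCat.ofHom (X := SSet.toTop.obj X) g := by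
    apply (sSetTopAdj.homEquiv X (TopCat.of T)).injective
    ext n x
    apply (TopCat.toSSetObjEquiv (TopCat.of T) n).injective
    ext t
    exact h (n := n.unop) x t
  exact congrArg TopCat.Hom.hom this

/-- With the indiscrete topology on the target every function is continuous, so the uniqueness half
of the adjunction applies to the indicator of the union of all simplices: it agrees with the
constant function true on each simplex. -/
lemma exists_charMap (z : SSet.toTop.obj X) :
    ∃ (n : SimplexCategory) (x : X.obj (op n)) (t : TopSimplex n), charMap x t = z := by
  let _ : TopologicalSpace (ULift.{u} Prop) := ⊤
  let f : C(SSet.toTop.obj X, ULift.{u} Prop) :=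
    ⟨fun z => ⟨∃ (n : SimplexCategory) (x : X.obj (op n)) (t : TopSimplex n), charMap x t = z⟩,
      continuous_top⟩
  let g : C(SSet.toTop.obj X, ULift.{u} Prop) := ⟨fun _ => ⟨True⟩, continuous_top⟩
  have h : f = g := hom_ext_charMap fun x t => ULift.ext _ _ (eq_true ⟨_, x, t, rfl⟩)
  have h1 : (f z).down = (g z).down := by rw [h]
  exact of_eq_true h1

lemma continuous_iff_charMap_aux {T : Type u} [TopologicalSpace T] {f : SSet.toTop.obj X → T}
    (h : ∀ {n : SimplexCategory} (x : X.obj (op n)), Continuous fun t => f (charMap x t)) :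
    Continuous f := by
  let φ : SimplexFamily X T :=
    { map := fun x => ⟨_, h x⟩
      compat := fun θ x t => congrArg f (charMap_map θ x t) }
  have hf : ∀ z, φ.desc z = f z := by
    intro z
    obtain ⟨n, x, t, rfl⟩ := exists_charMap z
    exact φ.desc_charMap x t
  exact φ.desc.continuous.congr hf

/-- Openness is continuity of a `Prop`-valued map for the Sierpiński topology, so the universal
property applies. The lift puts the target in the universe of the adjunction; afterwards continuity
can be tested for targets in any universe. -/
lemma isOpen_iff_charMap {O : Set (SSet.toTop.obj X)} :
    IsOpen O ↔ ∀ {n : SimplexCategory} (x : X.obj (op n)), IsOpen (charMap x ⁻¹' O) := by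
  refine ⟨fun h n x => h.preimage (charMap x).continuous, fun h => ?_⟩
  have h1 : Continuous fun z => ULift.up.{u} (z ∈ O) :=
    continuous_iff_charMap_aux fun x =>
      continuous_uliftUp.comp (continuous_Prop.2 (h x))
  exact continuous_Prop.1 (continuous_uliftDown.comp h1)

lemma continuous_iff_charMap {T : Type*} [TopologicalSpace T] {f : SSet.toTop.obj X → T} :
    Continuous f ↔
      ∀ {n : SimplexCategory} (x : X.obj (op n)), Continuous fun t => f (charMap x t) := by
  refine ⟨fun h n x => h.comp (charMap x).continuous, fun h => ?_⟩
  rw [continuous_def]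
  intro O hO
  exact isOpen_iff_charMap.2 fun x => hO.preimage (h x)

/-- A map on the realization whose composites with the characteristic maps are given. -/
lemma exists_map_of_compat {T : Type u}
    (f : ∀ {n : SimplexCategory}, X.obj (op n) → TopSimplex n → T)
    (hf : ∀ {m n : SimplexCategory} (θ : m ⟶ n) (x : X.obj (op n)) (t : TopSimplex m),
      f (X.map θ.op x) t = f x (topSimplexMap θ t)) :
    ∃ F : SSet.toTop.obj X → T, ∀ {n : SimplexCategory} (x : X.obj (op n)) (t : TopSimplex n),
      F (charMap x t) = f x t := by
  -- The indiscrete topology turns the universal property for continuous maps into one for arbitrary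
  -- functions.
  let _ : TopologicalSpace T := ⊤
  let φ : SimplexFamily X T :=
    { map := fun x => ⟨f x, continuous_top⟩
      compat := hf }
  exact ⟨φ.desc, φ.desc_charMap⟩

/-- The realization of a surjective map is a quotient map. -/
lemma isQuotientMap_toTop_map {f : X ⟶ Y} (hf : ∀ n, Function.Surjective (f.app n)) :
    Topology.IsQuotientMap (SSet.toTop.map f) := by
  refine (Topology.isQuotientMap_iff _).2 ⟨.of_isOpen_preimage_iff_isOpen fun O =>
    ⟨fun h => ?_, fun h => h.preimage (SSet.toTop.map f).hom.continuous⟩, fun z => ?_⟩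
  · rw [isOpen_iff_charMap]
    intro n y
    obtain ⟨x, rfl⟩ := hf _ y
    have h1 := isOpen_iff_charMap.1 h x
    convert h1 using 1
    ext t
    simp only [Set.mem_preimage]
    rw [toTop_map_charMap]
  · obtain ⟨n, y, t, rfl⟩ := exists_charMap z
    obtain ⟨x, rfl⟩ := hf _ y
    exact ⟨charMap x t, toTop_map_charMap f x t⟩

/-! ## Compactly generated topologies -/

/-- Openness is tested on characteristic maps, whose domains are compact Hausdorff. -/
instance : UCompactlyGeneratedSpace.{u} (SSet.toTop.obj X) := by
  refine uCompactlyGeneratedSpace_of_isOpen fun O h => isOpen_iff_charMap.2 fun {n} x => ?_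
  have h1 := h (CompHaus.of (ULift.{u} (TopSimplex n)))
    ⟨fun t => charMap x t.down, (charMap x).continuous.comp continuous_uliftDown⟩
  exact h1.preimage continuous_uliftUp

end Realization

lemma exists_compact_nhds_subset {S : Type*} [TopologicalSpace S] [CompactSpace S] [T2Space S]
    {s : S} {W : Set S} (hW : W ∈ nhds s) : ∃ C ∈ nhds s, C ⊆ W ∧ IsCompact C :=
  local_compact_nhds hW

/-- For a test map f : S → E, every point of the open set f⁻¹(V) has a compact neighbourhood C
inside it, and the restriction of f to C is a test map into V. So a subset of V which is open for
all test maps into V is open for all test maps into E. -/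
lemma IsOpen.uCompactlyGeneratedSpace {E : Type u} [TopologicalSpace E]
    [UCompactlyGeneratedSpace.{u} E] {V : Set E} (hV : IsOpen V) :
    UCompactlyGeneratedSpace.{u} V := by
  refine uCompactlyGeneratedSpace_of_isOpen fun O h => ?_
  rw [hV.isOpenEmbedding_subtypeVal.isOpen_iff_image_isOpen]
  refine UCompactlyGeneratedSpace.isOpen.{u} fun S f => ?_
  rw [isOpen_iff_mem_nhds]
  rintro s ⟨v, hv, hvs⟩
  have hW : f ⁻¹' V ∈ nhds s :=
    (hV.preimage f.continuous).mem_nhds (by rw [Set.mem_preimage, ← hvs]; exact v.2)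
  obtain ⟨C, hC, hCV, hCc⟩ := exists_compact_nhds_subset hW
  have : CompactSpace C := isCompact_iff_compactSpace.1 hCc
  have h1 := h (CompHaus.of C) ⟨fun c => ⟨f c, hCV c.2⟩, by fun_prop⟩
  obtain ⟨O', hO', hO'C⟩ := isOpen_induced_iff.1 h1
  have hsO' : s ∈ O' := by
    have h2 : (⟨s, mem_of_mem_nhds hC⟩ : C) ∈ Subtype.val ⁻¹' O' := by
      rw [hO'C]
      change (⟨f s, _⟩ : V) ∈ O
      convert hv
      exact hvs.symm
    exact h2
  filter_upwards [hC, hO'.mem_nhds hsO'] with x hx hx'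
  have h2 : (⟨x, hx⟩ : C) ∈ Subtype.val ⁻¹' O' := hx'
  rw [hO'C] at h2
  exact ⟨_, h2, rfl⟩

/-- Compact Hausdorff spaces have the same continuous maps to B and to its compactly generated
refinement, and they detect continuity on A. -/
lemma continuous_to_compactlyGenerated {A : Type v} {B : Type w} [tA : TopologicalSpace A]
    [UCompactlyGeneratedSpace.{u} A] [tB : TopologicalSpace B] {f : A → B} (hf : Continuous f) :
    @Continuous A B tA (TopologicalSpace.compactlyGenerated.{u} B) f := by
  refine @continuous_from_uCompactlyGeneratedSpace A B _
    (TopologicalSpace.compactlyGenerated.{u} B) _ f fun S g => ?_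
  refine @continuous_def _ _ _ (TopologicalSpace.compactlyGenerated.{u} B) _ |>.2 fun O hO => ?_
  rw [TopologicalSpace.compactlyGenerated, isOpen_coinduced, isOpen_sigma_iff] at hO
  exact hO ⟨S, ⟨f ∘ g, hf.comp g.continuous⟩⟩

namespace Realization

/-! ## Cumulative sums of barycentric coordinates -/

/-- The sum of the first `k` barycentric coordinates. -/
def cumSum {n : SimplexCategory} (t : TopSimplex n) (k : ℕ) : ℝ :=
  ∑ j : Fin (n.len + 1), if j.val < k then t j else 0

variable {m n : SimplexCategory}

lemma cumSum_zero (t : TopSimplex n) : cumSum t 0 = 0 := by simp [cumSum]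

lemma cumSum_of_le (t : TopSimplex n) {k : ℕ} (hk : n.len + 1 ≤ k) : cumSum t k = 1 := by
  rw [← stdSimplex.sum_eq_one t, cumSum]
  exact Finset.sum_congr rfl fun j _ => if_pos (j.2.trans_le hk)

lemma cumSum_succ (t : TopSimplex n) (j : Fin (n.len + 1)) :
    cumSum t (j.val + 1) = cumSum t j + t j := by
  have h : t j = ∑ i : Fin (n.len + 1), if i = j then t i else 0 := by simp
  rw [h, cumSum, cumSum, ← Finset.sum_add_distrib]
  refine Finset.sum_congr rfl fun i _ => ?_
  by_cases h1 : i = j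
  · subst h1; simp
  · have h2 : i.val ≠ j.val := fun h => h1 (Fin.ext h)
    have h3 : i.val < j.val + 1 ↔ i.val < j.val := by lia
    simp [h1, h3]

lemma cumSum_mono (t : TopSimplex n) : Monotone (cumSum t) := by
  intro k l hkl
  refine Finset.sum_le_sum fun j _ => ?_
  have h : 0 ≤ t j := stdSimplex.zero_le t j
  split_ifs with h1 h2
  · exact le_rfl
  · exact absurd (h1.trans_le hkl) h2
  · exact h
  · exact le_rfl

lemma continuous_cumSum (k : ℕ) : Continuous fun t : TopSimplex n => cumSum t k := by
  unfold cumSum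
  refine continuous_finsetSum _ fun j _ => ?_
  split_ifs
  · exact (continuous_apply j).comp continuous_subtype_val
  · exact continuous_const

lemma cumSum_nonneg (t : TopSimplex n) (k : ℕ) : 0 ≤ cumSum t k := by
  rw [← cumSum_zero t]; exact cumSum_mono t (Nat.zero_le k)

lemma cumSum_le_one (t : TopSimplex n) (k : ℕ) : cumSum t k ≤ 1 := by
  rw [← cumSum_of_le t (le_max_left (n.len + 1) k)]; exact cumSum_mono t (le_max_right _ _)

lemma topSimplex_ext {s t : TopSimplex n} (h : ∀ k, cumSum s k = cumSum t k) : s = t := by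
  apply stdSimplex.ext
  funext j
  have h1 := cumSum_succ s j
  rw [h, h, cumSum_succ] at h1
  linarith

lemma topSimplexMap_apply (θ : m ⟶ n) (t : TopSimplex m) (i : Fin (n.len + 1)) :
    topSimplexMap θ t i = ∑ j : Fin (m.len + 1), if θ.toOrderHom j = i then t j else 0 := by
  change FunOnFinite.linearMap ℝ ℝ _ _ _ = _
  rw [FunOnFinite.linearMap_apply_apply, Finset.sum_filter]
  rfl

lemma cumSum_topSimplexMap (θ : m ⟶ n) (t : TopSimplex m) (k : ℕ) :
    cumSum (topSimplexMap θ t) k =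
      ∑ j : Fin (m.len + 1), if (θ.toOrderHom j).val < k then t j else 0 := by
  unfold cumSum
  simp only [topSimplexMap_apply]
  have h : ∀ i : Fin (n.len + 1),
      (if i.val < k then ∑ j : Fin (m.len + 1), (if θ.toOrderHom j = i then t j else 0) else 0) =
      ∑ j : Fin (m.len + 1),
        if θ.toOrderHom j = i then (if i.val < k then t j else 0) else 0 := by
    intro i
    split_ifs <;> simp
  simp only [h]
  rw [Finset.sum_comm]
  refine Finset.sum_congr rfl fun j _ => ?_
  simp

/-- The point `u` lies in the `i`-th of the consecutive intervals of `[0, 1)` whose lengths are the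
barycentric coordinates of `t`. -/
def InInterval (t : TopSimplex n) (u : ℝ) (i : Fin (n.len + 1)) : Prop :=
  cumSum t i ≤ u ∧ u < cumSum t (i.val + 1)

/-- Turns comparisons of interval indices into comparisons of u with the break points. -/
lemma InInterval.lt_iff {t : TopSimplex n} {u : ℝ} {i : Fin (n.len + 1)} (h : InInterval t u i)
    (k : ℕ) : i.val < k ↔ u < cumSum t k := by
  refine ⟨fun hk => h.2.trans_le (cumSum_mono t hk), fun hu => ?_⟩
  by_contra hk
  exact absurd ((cumSum_mono t (not_lt.1 hk)).trans h.1) (not_le.2 hu)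

lemma InInterval.mono {t : TopSimplex n} {u u' : ℝ} {i j : Fin (n.len + 1)}
    (h : InInterval t u i) (h' : InInterval t u' j) (huu' : u ≤ u') : i ≤ j := by
  by_contra hij
  have h1 := (h'.lt_iff i).1 (not_le.1 hij)
  exact absurd (h.1.trans huu') (not_le.2 h1)

lemma InInterval.unique {t : TopSimplex n} {u : ℝ} {i j : Fin (n.len + 1)}
    (h : InInterval t u i) (h' : InInterval t u j) : i = j :=
  le_antisymm (h.mono h' le_rfl) (h'.mono h le_rfl)

lemma exists_inInterval (t : TopSimplex n) {u : ℝ} (h0 : 0 ≤ u) (h1 : u < 1) :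
    ∃ i, InInterval t u i := by
  classical
  have h : ∃ k, u < cumSum t (k + 1) := ⟨n.len, by rwa [cumSum_of_le t le_rfl]⟩
  have hlt : Nat.find h < n.len + 1 :=
    Nat.lt_succ_of_le (Nat.find_min' h (by rwa [cumSum_of_le t le_rfl]))
  refine ⟨⟨Nat.find h, hlt⟩, ?_, Nat.find_spec h⟩
  rcases Nat.eq_zero_or_pos (Nat.find h) with h2 | h2
  · simp only [h2, cumSum_zero]; exact h0
  · have h3 := Nat.find_min h (Nat.sub_lt h2 one_pos)
    rw [Nat.sub_add_cancel (show 1 ≤ Nat.find h from h2)] at h3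
    exact not_lt.1 h3

/-- The index of the interval of `t` in which `u` lies. -/
def intervalIndex (t : TopSimplex n) (u : Set.Ico (0 : ℝ) 1) : Fin (n.len + 1) :=
  (exists_inInterval t u.2.1 u.2.2).choose

lemma inInterval_intervalIndex (t : TopSimplex n) (u : Set.Ico (0 : ℝ) 1) :
    InInterval t u (intervalIndex t u) :=
  (exists_inInterval t u.2.1 u.2.2).choose_spec

/-- Pushing coordinates forward along a monotone map merges consecutive intervals and inserts empty
ones, so the i-th interval is contained in the one with index θ(i). -/
lemma InInterval.map (θ : m ⟶ n) {t : TopSimplex m} {u : ℝ} {i : Fin (m.len + 1)}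
    (h : InInterval t u i) : InInterval (topSimplexMap θ t) u (θ.toOrderHom i) := by
  have hpos : ∀ j, 0 ≤ t j := stdSimplex.zero_le t
  constructor
  · refine le_trans ?_ h.1
    rw [cumSum_topSimplexMap]
    refine Finset.sum_le_sum fun j _ => ?_
    by_cases h1 : (θ.toOrderHom j).val < (θ.toOrderHom i).val
    · have h2 : j < i := by
        by_contra h2
        exact absurd (θ.toOrderHom.monotone (not_lt.1 h2)) (not_le.2 h1)
      have h3 : j.val < i.val := h2
      simp [h1, h3]
    · rw [if_neg h1]
      split_ifs
      exacts [hpos j, le_rfl]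
  · refine h.2.trans_le ?_
    rw [cumSum_topSimplexMap]
    refine Finset.sum_le_sum fun j _ => ?_
    by_cases h1 : j.val < i.val + 1
    · have h2 : j ≤ i := Fin.le_def.2 (Nat.lt_succ_iff.1 h1)
      have h3 : (θ.toOrderHom j).val < (θ.toOrderHom i).val + 1 :=
        Nat.lt_succ_iff.2 (Fin.le_def.1 (θ.toOrderHom.monotone h2))
      simp [h1, h3]
    · rw [if_neg h1]
      split_ifs
      exacts [hpos j, le_rfl]

lemma intervalIndex_map (θ : m ⟶ n) (t : TopSimplex m) (u : Set.Ico (0 : ℝ) 1) :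
    intervalIndex (topSimplexMap θ t) u = θ.toOrderHom (intervalIndex t u) :=
  (inInterval_intervalIndex _ u).unique ((inInterval_intervalIndex t u).map θ)

/-- The monotone map given by the interval indices of an increasing sequence of points. -/
def sampleHom (t : TopSimplex n) (u : Fin (m.len + 1) → Set.Ico (0 : ℝ) 1) (hu : Monotone u) :
    m ⟶ n :=
  SimplexCategory.Hom.mk
    { toFun := fun i => intervalIndex t (u i)
      monotone' := fun _ _ hij =>
        (inInterval_intervalIndex t _).mono (inInterval_intervalIndex t _) (hu hij) }

/-- This naturality makes y ↦ (sampleHom s u)^* y well defined on the realization for fixed sample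
points u. -/
lemma sampleHom_map {l : SimplexCategory} (θ : m ⟶ n) (t : TopSimplex m)
    (u : Fin (l.len + 1) → Set.Ico (0 : ℝ) 1) (hu : Monotone u) :
    sampleHom (topSimplexMap θ t) u hu = sampleHom t u hu ≫ θ := by
  apply SimplexCategory.Hom.ext
  apply OrderHom.ext
  funext i
  exact intervalIndex_map θ t (u i)

variable {X Y : SSet.{u}}

/-- Distinct simplices have no interior point in common with the same coordinates. -/
lemma charMap_injective_of_pos {x x' : X.obj (op n)} {t : TopSimplex n} (ht : ∀ i, 0 < t i)
    (h : charMap x t = charMap x' t) : x = x' := by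
  -- The sample points are the left endpoints of the intervals of t; they are below 1 because every
  -- interval has positive length.
  let u : Fin (n.len + 1) → Set.Ico (0 : ℝ) 1 := fun i =>
    ⟨cumSum t i, cumSum_nonneg t i, by
      have h1 := cumSum_succ t i
      have h2 := cumSum_le_one t (i.val + 1)
      have h3 := ht i
      linarith⟩
  have hu : Monotone u := fun i j hij => Subtype.mk_le_mk.2 (cumSum_mono t hij)
  -- Sampling at u is a function from the whole realization to the n-simplices of X. At coordinates
  -- t the sampling operator is the identity, so f returns the simplex itself, degenerate or not.
  obtain ⟨f, hf⟩ := exists_map_of_compat (X := X) (T := X.obj (op n))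
    (fun {k} y s => X.map (sampleHom s u hu).op y) (by
      intro k l θ y s
      simp only [sampleHom_map, op_comp, Functor.map_comp]
      rfl)
  have hid : sampleHom t u hu = 𝟙 n := by
    apply SimplexCategory.Hom.ext
    apply OrderHom.ext
    funext i
    refine (inInterval_intervalIndex t (u i)).unique (?_ : InInterval t (u i) i)
    refine ⟨le_rfl, ?_⟩
    rw [cumSum_succ]
    exact lt_add_of_pos_right _ (ht i)
  have h1 := congrArg f h
  rw [hf, hf] at h1
  simp only [hid, op_id, CategoryTheory.Functor.map_id] at h1
  exact h1

/-! ## Common refinements -/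

lemma sum_ite_sub_eq {k : ℕ} (v : Fin (k + 2) → ℝ) (p : Fin (k + 2)) :
    (∑ i : Fin (k + 1), if i.castSucc < p then v i.succ - v i.castSucc else 0) = v p - v 0 := by
  induction p using Fin.induction with
  | zero => simp
  | succ q ih =>
    have h : ∀ i : Fin (k + 1), (if i.castSucc < q.succ then v i.succ - v i.castSucc else 0) =
        (if i.castSucc < q.castSucc then v i.succ - v i.castSucc else 0) +
          if i = q then v i.succ - v i.castSucc else 0 := by
      intro i
      rcases lt_trichotomy i q with h1 | h1 | h1
      · have h2 : i.castSucc < q.succ := (Fin.castSucc_lt_castSucc_iff.2 h1).trans q.castSucc_lt_succ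
        simp [h2, h1, h1.ne]
      · subst h1; simp
      · have h2 : ¬ i.castSucc < q.succ := by
          simp only [Fin.lt_def, Fin.val_castSucc, Fin.val_succ] at *
          lia
        simp [h2, h1.not_gt, h1.ne']
    simp only [h, Finset.sum_add_distrib, ih]
    simp

/-- Two points of topological simplices are images of a common interior point. -/
lemma exists_common_refinement (t : TopSimplex m) (t' : TopSimplex n) :
    ∃ (k : ℕ) (_ : k ≤ m.len + n.len + 2) (s : TopSimplex ⦋k⦌) (θ : ⦋k⦌ ⟶ m) (θ' : ⦋k⦌ ⟶ n),
      (∀ i, 0 < s i) ∧ topSimplexMap θ s = t ∧ topSimplexMap θ' s = t' := by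
  classical
  -- D consists of the break points of both partitions, including 0 and 1. Listed increasingly as v
  -- 0 < ⋯ < v (k + 1), they bound the k + 1 intervals of the refinement, so the bound on the
  -- cardinality of D gives the bound on k.
  let D : Finset ℝ := (Finset.range (m.len + 2)).image (cumSum t) ∪
    (Finset.range (n.len + 2)).image (cumSum t')
  have h0 : (0 : ℝ) ∈ D := Finset.mem_union_left _
    (Finset.mem_image.2 ⟨0, by simp, cumSum_zero t⟩)
  have h1 : (1 : ℝ) ∈ D := Finset.mem_union_left _
    (Finset.mem_image.2 ⟨m.len + 1, by simp, cumSum_of_le t le_rfl⟩)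
  have hD0 : ∀ x ∈ D, 0 ≤ x := by
    intro x hx
    rcases Finset.mem_union.1 hx with hx | hx <;> obtain ⟨k, -, rfl⟩ := Finset.mem_image.1 hx
    exacts [cumSum_nonneg t k, cumSum_nonneg t' k]
  have hD1 : ∀ x ∈ D, x ≤ 1 := by
    intro x hx
    rcases Finset.mem_union.1 hx with hx | hx <;> obtain ⟨k, -, rfl⟩ := Finset.mem_image.1 hx
    exacts [cumSum_le_one t k, cumSum_le_one t' k]
  have hcard : 2 ≤ D.card := by
    have : ({0, 1} : Finset ℝ) ⊆ D := by
      intro x hx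
      rcases Finset.mem_insert.1 hx with rfl | hx
      · exact h0
      · rw [Finset.mem_singleton.1 hx]; exact h1
    have h2 := Finset.card_le_card this
    rwa [Finset.card_pair (by norm_num)] at h2
  have hcard' : D.card ≤ m.len + n.len + 4 := by
    refine (Finset.card_union_le _ _).trans ?_
    have e1 := Finset.card_image_le (s := Finset.range (m.len + 2)) (f := cumSum t)
    have e2 := Finset.card_image_le (s := Finset.range (n.len + 2)) (f := cumSum t')
    simp only [Finset.card_range] at e1 e2
    lia
  obtain ⟨k, hk⟩ := Nat.exists_eq_add_of_le' hcard
  let v : Fin (k + 2) ↪o ℝ := D.orderEmbOfFin hk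
  have hvD : ∀ p, v p ∈ D := fun p => D.orderEmbOfFin_mem hk p
  have hvs : ∀ x ∈ D, ∃ p, v p = x := by
    intro x hx
    have : x ∈ Set.range v := by rw [Finset.range_orderEmbOfFin]; exact hx
    exact this
  have hv0 : v 0 = 0 := by
    obtain ⟨p, hp⟩ := hvs 0 h0
    refine le_antisymm ?_ (hD0 _ (hvD 0))
    rw [← hp]; exact v.monotone (Fin.zero_le p)
  have hv1 : v (Fin.last _) = 1 := by
    obtain ⟨p, hp⟩ := hvs 1 h1
    refine le_antisymm (hD1 _ (hvD _)) ?_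
    rw [← hp]; exact v.monotone (Fin.le_last p)
  have hpos : ∀ i : Fin (k + 1), 0 < v i.succ - v i.castSucc := fun i =>
    sub_pos.2 (v.strictMono i.castSucc_lt_succ)
  let s : TopSimplex ⦋k⦌ := ⟨fun i => v i.succ - v i.castSucc, fun i => (hpos i).le, by
    have := sum_ite_sub_eq v (Fin.last _)
    rw [hv0, hv1, sub_zero] at this
    rw [← this]
    exact Finset.sum_congr rfl fun i _ => (if_pos i.castSucc_lt_last).symm⟩
  let u : Fin (k + 1) → Set.Ico (0 : ℝ) 1 := fun i => ⟨v i.castSucc, hD0 _ (hvD _), by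
    rw [← hv1]; exact v.strictMono i.castSucc_lt_last⟩
  have hu : Monotone u := fun i j hij =>
    Subtype.mk_le_mk.2 (v.monotone (Fin.castSucc_le_castSucc_iff.2 hij))
  -- If all break points of r lie in D, each interval of the refinement lies in a single interval of
  -- r, found by sampling at its left endpoint. Summing the lengths up to a break point v p of r
  -- telescopes to v p.
  have key : ∀ {l : SimplexCategory} (r : TopSimplex l),
      (∀ j ∈ Finset.range (l.len + 2), cumSum r j ∈ D) →
      topSimplexMap (sampleHom (m := ⦋k⦌) r u hu) s = r := by
    intro l r hr
    have hr' : ∀ j, cumSum r j ∈ D := by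
      intro j
      by_cases hj : j ∈ Finset.range (l.len + 2)
      · exact hr j hj
      · rw [cumSum_of_le r (by simp at hj; lia)]; exact h1
    apply topSimplex_ext
    intro j
    rw [cumSum_topSimplexMap]
    obtain ⟨p, hp⟩ := hvs _ (hr' j)
    have h2 := sum_ite_sub_eq v p
    rw [hv0, sub_zero, hp] at h2
    rw [← h2]
    refine Finset.sum_congr rfl fun i _ => ?_
    have h3 : ((sampleHom (m := ⦋k⦌) r u hu).toOrderHom i).val < j ↔ i.castSucc < p := by
      rw [← v.lt_iff_lt, hp]
      exact (inInterval_intervalIndex r (u i)).lt_iff j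
    exact if_congr h3 rfl rfl
  exact ⟨k, by lia, s, sampleHom t u hu, sampleHom t' u hu, hpos,
    key t fun j hj => Finset.mem_union_left _ (Finset.mem_image_of_mem _ hj),
    key t' fun j hj => Finset.mem_union_right _ (Finset.mem_image_of_mem _ hj)⟩

/-- Two points of realizations have the same barycentric coordinates with respect to suitable
simplices. -/
lemma exists_charMap_pair (x : SSet.toTop.obj X) (y : SSet.toTop.obj Y) :
    ∃ (k : SimplexCategory) (a : X.obj (op k)) (b : Y.obj (op k)) (s : TopSimplex k),
      (∀ i, 0 < s i) ∧ charMap a s = x ∧ charMap b s = y := by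
  obtain ⟨m, a, t, rfl⟩ := exists_charMap x
  obtain ⟨n, b, t', rfl⟩ := exists_charMap y
  obtain ⟨k, -, s, θ, θ', hs, rfl, rfl⟩ := exists_common_refinement t t'
  exact ⟨_, _, _, s, hs, charMap_map θ a s, charMap_map θ' b s⟩

end Realization

namespace Realization

/-! ## Realization of products -/

variable {X Y : SSet.{u}}

lemma toTop_fst_charMap {n : SimplexCategory} (a : X.obj (op n)) (b : Y.obj (op n))
    (t : TopSimplex n) :
    SSet.toTop.map (CartesianMonoidalCategory.fst X Y) (charMap (X := X ⊗ Y) (a, b) t) =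
      charMap a t :=
  toTop_map_charMap _ _ _

lemma toTop_snd_charMap {n : SimplexCategory} (a : X.obj (op n)) (b : Y.obj (op n))
    (t : TopSimplex n) :
    SSet.toTop.map (CartesianMonoidalCategory.snd X Y) (charMap (X := X ⊗ Y) (a, b) t) =
      charMap b t :=
  toTop_map_charMap _ _ _

lemma exists_pair (x : SSet.toTop.obj X) (y : SSet.toTop.obj Y) :
    ∃ w : SSet.toTop.obj (X ⊗ Y),
      SSet.toTop.map (CartesianMonoidalCategory.fst X Y) w = x ∧
      SSet.toTop.map (CartesianMonoidalCategory.snd X Y) w = y := by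
  obtain ⟨k, a, b, s, -, rfl, rfl⟩ := exists_charMap_pair x y
  exact ⟨charMap (X := X ⊗ Y) (a, b) s, toTop_fst_charMap a b s, toTop_snd_charMap a b s⟩

/-- Write both points with the same interior coordinates; then each equality of projections is an
equality of simplices. -/
lemma prod_ext {w w' : SSet.toTop.obj (X ⊗ Y)}
    (h₁ : SSet.toTop.map (CartesianMonoidalCategory.fst X Y) w =
      SSet.toTop.map (CartesianMonoidalCategory.fst X Y) w')
    (h₂ : SSet.toTop.map (CartesianMonoidalCategory.snd X Y) w =
      SSet.toTop.map (CartesianMonoidalCategory.snd X Y) w') : w = w' := by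
  obtain ⟨k, ⟨a, b⟩, ⟨a', b'⟩, s, hs, rfl, rfl⟩ := exists_charMap_pair w w'
  rw [toTop_fst_charMap, toTop_fst_charMap] at h₁
  rw [toTop_snd_charMap, toTop_snd_charMap] at h₂
  rw [charMap_injective_of_pos hs h₁, charMap_injective_of_pos hs h₂]

/-- The point of `|X × Y|` with given projections. -/
def pairPt (x : SSet.toTop.obj X) (y : SSet.toTop.obj Y) : SSet.toTop.obj (X ⊗ Y) :=
  (exists_pair x y).choose

@[simp] lemma fst_pairPt (x : SSet.toTop.obj X) (y : SSet.toTop.obj Y) :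
    SSet.toTop.map (CartesianMonoidalCategory.fst X Y) (pairPt x y) = x :=
  (exists_pair x y).choose_spec.1

@[simp] lemma snd_pairPt (x : SSet.toTop.obj X) (y : SSet.toTop.obj Y) :
    SSet.toTop.map (CartesianMonoidalCategory.snd X Y) (pairPt x y) = y :=
  (exists_pair x y).choose_spec.2

lemma pairPt_fst_snd (w : SSet.toTop.obj (X ⊗ Y)) :
    pairPt (SSet.toTop.map (CartesianMonoidalCategory.fst X Y) w)
      (SSet.toTop.map (CartesianMonoidalCategory.snd X Y) w) = w :=
  prod_ext (fst_pairPt _ _) (snd_pairPt _ _)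

lemma pairPt_charMap {n : SimplexCategory} (a : X.obj (op n)) (b : Y.obj (op n))
    (t : TopSimplex n) : pairPt (charMap a t) (charMap b t) = charMap (X := X ⊗ Y) (a, b) t :=
  prod_ext ((fst_pairPt _ _).trans (toTop_fst_charMap a b t).symm)
    ((snd_pairPt _ _).trans (toTop_snd_charMap a b t).symm)

instance (m n : SimplexCategory) : Finite (m ⟶ n) :=
  Finite.of_injective (fun θ => (θ.toOrderHom : Fin (m.len + 1) → Fin (n.len + 1)))
    fun _ _ h => SimplexCategory.Hom.ext _ _ (OrderHom.ext _ _ h)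

/-- Common refinements have bounded dimension, so finitely many simplices, one for each pair of
operators, map onto the product of the two simplices. A continuous surjection from a compact space
to a Hausdorff space is a quotient map, and on each of these simplices the pairing is a
characteristic map of X × Y. -/
lemma continuous_pairPt_charMap {m n : SimplexCategory} (a : X.obj (op m)) (b : Y.obj (op n)) :
    Continuous fun p : TopSimplex m × TopSimplex n =>
      pairPt (charMap a p.1) (charMap b p.2) := by
  let I := Σ k : Fin (m.len + n.len + 3), ((⦋k.val⦌ : SimplexCategory) ⟶ m) × (⦋k.val⦌ ⟶ n)
  let Q := Σ i : I, TopSimplex ⦋i.1.val⦌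
  let f : Q → TopSimplex m × TopSimplex n := fun z =>
    (topSimplexMap z.1.2.1 z.2, topSimplexMap z.1.2.2 z.2)
  have hf : Continuous f := by
    refine continuous_sigma fun i => ?_
    exact (topSimplexMap i.2.1).continuous.prodMk (topSimplexMap i.2.2).continuous
  have hs : Function.Surjective f := by
    rintro ⟨t, t'⟩
    obtain ⟨k, hk, s, θ, θ', -, rfl, rfl⟩ := exists_common_refinement t t'
    exact ⟨⟨⟨⟨k, by lia⟩, θ, θ'⟩, s⟩, rfl⟩
  have hq : Topology.IsQuotientMap f := hf.isClosedMap.isQuotientMap hf hs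
  refine hq.continuous_iff.2 (continuous_sigma fun i => ?_)
  refine (charMap (X := X ⊗ Y) (X.map i.2.1.op a, Y.map i.2.2.op b)).continuous.congr fun s => ?_
  rw [← pairPt_charMap, charMap_map, charMap_map]
  rfl

/-- A product with |Y| need not carry the quotient topology from the simplices of Y, so the map is
curried: continuity of |Y| → C(Δᵐ, |X × Y|) can be tested on simplices, and uncurrying is allowed
because Δᵐ is locally compact. -/
lemma continuous_pairPt_left {m : SimplexCategory} (a : X.obj (op m)) :
    Continuous fun p : SSet.toTop.obj Y × TopSimplex m => pairPt (charMap a p.2) p.1 := by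
  have h1 : ∀ y : SSet.toTop.obj Y, Continuous fun s => pairPt (charMap a s) y := by
    intro y
    obtain ⟨n, b, t, rfl⟩ := exists_charMap y
    exact (continuous_pairPt_charMap a b).comp (continuous_id.prodMk continuous_const)
  let f : SSet.toTop.obj Y → C(TopSimplex m, SSet.toTop.obj (X ⊗ Y)) := fun y => ⟨_, h1 y⟩
  have hf : Continuous f := continuous_iff_charMap.2 fun b =>
    ContinuousMap.continuous_of_continuous_uncurry _
      ((continuous_pairPt_charMap a b).comp continuous_swap)
  exact ContinuousMap.continuous_uncurry_of_continuous ⟨f, hf⟩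

/-- The bijection `|X| × |Y| → |X × Y|` is continuous on compact Hausdorff spaces. -/
lemma continuous_pairPt_of_compact {C : Type*} [TopologicalSpace C] [CompactSpace C] [T2Space C]
    {f : C → SSet.toTop.obj X} {g : C → SSet.toTop.obj Y} (hf : Continuous f)
    (hg : Continuous g) : Continuous fun c => pairPt (f c) (g c) := by
  have h1 : ∀ {m : SimplexCategory} (a : X.obj (op m)),
      Continuous fun p : TopSimplex m × C => pairPt (charMap a p.1) (g p.2) := fun a =>
    (continuous_pairPt_left a).comp ((hg.comp continuous_snd).prodMk continuous_fst)
  have h2 : ∀ x : SSet.toTop.obj X, Continuous fun c => pairPt x (g c) := by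
    intro x
    obtain ⟨n, a, t, rfl⟩ := exists_charMap x
    exact (h1 a).comp (continuous_const.prodMk continuous_id)
  -- The same currying argument, now with the compact space C in the role of the simplex and with
  -- |X| in the role of |Y|.
  let F : SSet.toTop.obj X → C(C, SSet.toTop.obj (X ⊗ Y)) := fun x => ⟨_, h2 x⟩
  have hF : Continuous F := continuous_iff_charMap.2 fun a =>
    ContinuousMap.continuous_of_continuous_uncurry _ (h1 a)
  exact (ContinuousMap.continuous_uncurry_of_continuous ⟨F, hF⟩).comp (hf.prodMk continuous_id)

/-- Continuity out of a compactly generated product is tested on compact Hausdorff spaces; this is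
where the k-topology on the product is needed. -/
lemma continuous_pairPt_kprod {B : Type u} [TopologicalSpace B] {f : B → SSet.toTop.obj Y}
    (hf : Continuous f) :
    Continuous fun z : KProd B (SSet.toTop.obj X) => pairPt z.2 (f z.1) :=
  continuous_from_compactlyGenerated (X := B × SSet.toTop.obj X) _ fun _ g =>
    continuous_pairPt_of_compact (continuous_snd.comp g.continuous)
      (hf.comp (continuous_fst.comp g.continuous))

end Realization

/-! ### Bundles obtained as quotients of trivial bundles over a covering -/

open Realization

/-- A section of a quotient map over an open set is continuous if its pullback is locally given by
continuous maps. -/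
lemma Topology.IsQuotientMap.continuous_of_local {A B C I : Type*} [TopologicalSpace A]
    [TopologicalSpace B] [TopologicalSpace C] {π : A → B} (hπ : Topology.IsQuotientMap π)
    {U : Set B} (hU : IsOpen U) (s : U → C) (O : I → Set A) (hO : ∀ i, IsOpen (O i))
    (h : I → A → C) (hh : ∀ i, Continuous (h i))
    (hcov : ∀ z, π z ∈ U → ∃ i, z ∈ O i)
    (hs : ∀ i z (hz : π z ∈ U), z ∈ O i → s ⟨π z, hz⟩ = h i z) : Continuous s := by
  refine (hπ.restrictPreimage_isOpen hU).continuous_iff.2 ?_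
  rw [continuous_iff_continuousAt]
  rintro ⟨z, hz⟩
  obtain ⟨i, hi⟩ := hcov z hz
  have h1 : ContinuousAt (fun z : π ⁻¹' U => h i z) ⟨z, hz⟩ :=
    ((hh i).comp continuous_subtype_val).continuousAt
  refine h1.congr ?_
  filter_upwards [((hO i).preimage continuous_subtype_val).mem_nhds hi] with y hy
  exact (hs i y y.2 hy).symm

/-- Data exhibiting `q : E → X` as the quotient of the trivial bundle `Y × Z → Z` by a free action
of the group `G`, where `G` acts on `Y × Z` through a cocycle with values in the simplicial group
`K` which acts on `Y`, and where `|Z| → |X|` is a covering map. -/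
structure TwistedQuotient (K Y E X Z : SSet.{u}) [SimplicialGroup K] [SimplicialAction K Y]
    (G : Type u) [Group G] where
  /-- the projection of the bundle -/
  q : E ⟶ X
  /-- the projection of the covering -/
  p : Z ⟶ X
  /-- the quotient map -/
  Ψ : Y ⊗ Z ⟶ E
  /-- the action of `G` on the covering -/
  ρ : G → (Z ⟶ Z)
  /-- the cocycle -/
  κ : G → (Z ⟶ K)
  Ψ_q : Ψ ≫ q = CartesianMonoidalCategory.snd Y Z ≫ p
  p_surjective : ∀ n, Function.Surjective (p.app n)
  Ψ_surjective : ∀ n, Function.Surjective (Ψ.app n)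
  ρ_one : ρ 1 = 𝟙 Z
  ρ_mul : ∀ g h, ρ (g * h) = ρ h ≫ ρ g
  κ_mul : ∀ g h n (z : Z.obj n),
    (κ (g * h)).app n z = (κ g).app n ((ρ h).app n z) * (κ h).app n z
  p_eq_iff : ∀ n (z z' : Z.obj n), p.app n z = p.app n z' ↔ ∃ g, (ρ g).app n z = z'
  Ψ_eq_iff : ∀ n (ξ ξ' : Y.obj n) (z z' : Z.obj n),
    Ψ.app n (ξ, z) = Ψ.app n (ξ', z') ↔ ∃ g, (κ g).app n z • ξ = ξ' ∧ (ρ g).app n z = z'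
  /-- the index set of the cover -/
  ι : Type u
  /-- the sheets of the covering -/
  V : ι → G → Set (SSet.toTop.obj Z)
  isOpen_V : ∀ i g, IsOpen (V i g)
  V_disjoint : ∀ i g g' z, z ∈ V i g → z ∈ V i g' → g = g'
  ρ_mem_V : ∀ i g h z, z ∈ V i h → SSet.toTop.map (ρ g) z ∈ V i (g * h)
  V_cover : ∀ z, ∃ i g, z ∈ V i g

namespace TwistedQuotient

variable {K Y E X Z : SSet.{u}} [SimplicialGroup K] [SimplicialAction K Y]
  {G : Type u} [Group G] (D : TwistedQuotient K Y E X Z G)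

/-- The action of `G` on `Y × Z`. -/
def tw (g : G) : Y ⊗ Z ⟶ Y ⊗ Z where
  app n := ↾fun w : Y.obj n × Z.obj n => ((D.κ g).app n w.2 • w.1, (D.ρ g).app n w.2)
  naturality m n θ := by
    apply ConcreteCategory.hom_ext
    rintro ⟨ξ, z⟩
    have h := ConcreteCategory.congr_hom ((D.κ g).naturality θ) z
    have h' := ConcreteCategory.congr_hom ((D.ρ g).naturality θ) z
    refine Prod.ext ?_ h'
    refine Eq.trans ?_ (SimplicialAction.map_smul θ ((D.κ g).app m z) ξ).symm
    exact congrArg (fun k => k • Y.map θ ξ) h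

lemma tw_snd (g : G) : D.tw g ≫ CartesianMonoidalCategory.snd Y Z =
    CartesianMonoidalCategory.snd Y Z ≫ D.ρ g := rfl

lemma toTop_tw_snd (g : G) (w : SSet.toTop.obj (Y ⊗ Z)) :
    SSet.toTop.map (CartesianMonoidalCategory.snd Y Z) (SSet.toTop.map (D.tw g) w) =
      SSet.toTop.map (D.ρ g) (SSet.toTop.map (CartesianMonoidalCategory.snd Y Z) w) := by
  rw [← ConcreteCategory.comp_apply, ← ConcreteCategory.comp_apply, ← Functor.map_comp,
    ← Functor.map_comp, tw_snd]

lemma toTop_Ψ_q (w : SSet.toTop.obj (Y ⊗ Z)) :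
    SSet.toTop.map D.q (SSet.toTop.map D.Ψ w) =
      SSet.toTop.map D.p (SSet.toTop.map (CartesianMonoidalCategory.snd Y Z) w) := by
  rw [← ConcreteCategory.comp_apply, ← ConcreteCategory.comp_apply, ← Functor.map_comp,
    ← Functor.map_comp, Ψ_q]

lemma toTop_ρ_mul (g h : G) (z : SSet.toTop.obj Z) :
    SSet.toTop.map (D.ρ (g * h)) z = SSet.toTop.map (D.ρ g) (SSet.toTop.map (D.ρ h) z) := by
  rw [ρ_mul, Functor.map_comp]; rfl

lemma toTop_ρ_one (z : SSet.toTop.obj Z) : SSet.toTop.map (D.ρ 1) z = z := by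
  rw [ρ_one, CategoryTheory.Functor.map_id]; rfl

/-- Two points with common interior coordinates have the same image exactly when their simplices do,
so the description of the fibres passes from simplices to points. The same argument applies to `Ψ`.
-/
lemma toTop_p_eq_iff (z z' : SSet.toTop.obj Z) :
    SSet.toTop.map D.p z = SSet.toTop.map D.p z' ↔ ∃ g, SSet.toTop.map (D.ρ g) z = z' := by
  constructor
  · intro h
    obtain ⟨k, a, b, s, hs, rfl, rfl⟩ := exists_charMap_pair z z'
    rw [toTop_map_charMap, toTop_map_charMap] at h
    obtain ⟨g, rfl⟩ := (D.p_eq_iff _ _ _).1 (charMap_injective_of_pos hs h)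
    exact ⟨g, toTop_map_charMap _ _ _⟩
  · rintro ⟨g, rfl⟩
    obtain ⟨k, a, s, rfl⟩ := exists_charMap z
    rw [toTop_map_charMap, toTop_map_charMap, toTop_map_charMap]
    exact congrArg (fun x => charMap x s) ((D.p_eq_iff _ _ _).2 ⟨g, rfl⟩)

lemma toTop_Ψ_eq_iff (w w' : SSet.toTop.obj (Y ⊗ Z)) :
    SSet.toTop.map D.Ψ w = SSet.toTop.map D.Ψ w' ↔ ∃ g, SSet.toTop.map (D.tw g) w = w' := by
  constructor
  · intro h
    obtain ⟨k, a, a', s, hs, rfl, rfl⟩ := exists_charMap_pair w w'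
    rw [toTop_map_charMap, toTop_map_charMap] at h
    obtain ⟨g, h₁, h₂⟩ :=
      (D.Ψ_eq_iff _ a.1 a'.1 a.2 a'.2).1 (charMap_injective_of_pos hs h)
    exact ⟨g, (toTop_map_charMap _ _ _).trans
      (congrArg (fun x => charMap x s) (Prod.ext h₁ h₂))⟩
  · rintro ⟨g, rfl⟩
    obtain ⟨k, a, s, rfl⟩ := exists_charMap w
    rw [toTop_map_charMap, toTop_map_charMap, toTop_map_charMap]
    exact congrArg (fun x => charMap x s)
      ((D.Ψ_eq_iff _ a.1 _ a.2 _).2 ⟨g, rfl, rfl⟩)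

/-- The open sets over which the bundle is trivialized. -/
def base (i : D.ι) : Set (SSet.toTop.obj X) := {b | ∃ z ∈ D.V i 1, SSet.toTop.map D.p z = b}

/-- The preimage of a trivializing set is the disjoint union of the sheets `V i g`, which G permutes
as it permutes itself by left translation. -/
lemma mem_base_iff (i : D.ι) (z : SSet.toTop.obj Z) :
    SSet.toTop.map D.p z ∈ D.base i ↔ ∃ g, z ∈ D.V i g := by
  constructor
  · rintro ⟨z', hz', h⟩
    obtain ⟨g, rfl⟩ := (D.toTop_p_eq_iff _ _).1 h
    exact ⟨_, D.ρ_mem_V i g 1 z' hz'⟩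
  · rintro ⟨g, hg⟩
    refine ⟨SSet.toTop.map (D.ρ g⁻¹) z, ?_, ((D.toTop_p_eq_iff _ _).2 ⟨_, rfl⟩).symm⟩
    have := D.ρ_mem_V i g⁻¹ g z hg
    rwa [inv_mul_cancel] at this

lemma isQuotientMap_p : Topology.IsQuotientMap (SSet.toTop.map D.p) :=
  isQuotientMap_toTop_map D.p_surjective

lemma isQuotientMap_Ψ : Topology.IsQuotientMap (SSet.toTop.map D.Ψ) :=
  isQuotientMap_toTop_map D.Ψ_surjective

lemma isOpen_base (i : D.ι) : IsOpen (D.base i) := by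
  rw [← D.isQuotientMap_p.isOpen_preimage]
  have : SSet.toTop.map D.p ⁻¹' D.base i = ⋃ g, D.V i g := by
    ext z
    rw [Set.mem_preimage, mem_base_iff, Set.mem_iUnion]
  rw [this]
  exact isOpen_iUnion (D.isOpen_V i)

/-- The section of `|Z| → |X|` over a trivializing open set. -/
def sec (i : D.ι) (b : D.base i) : SSet.toTop.obj Z := b.2.choose

lemma sec_mem (i : D.ι) (b : D.base i) : D.sec i b ∈ D.V i 1 := b.2.choose_spec.1

lemma p_sec (i : D.ι) (b : D.base i) : SSet.toTop.map D.p (D.sec i b) = b :=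
  b.2.choose_spec.2

lemma eq_one_of_mem {i : D.ι} {g : G} {z : SSet.toTop.obj Z} (hz : z ∈ D.V i 1)
    (hg : SSet.toTop.map (D.ρ g) z ∈ D.V i 1) : g = 1 := by
  have := D.ρ_mem_V i g 1 z hz
  rw [mul_one] at this
  exact D.V_disjoint i _ _ _ this hg

lemma eq_sec {i : D.ι} {b : D.base i} {z : SSet.toTop.obj Z} (hz : z ∈ D.V i 1)
    (h : SSet.toTop.map D.p z = b) : D.sec i b = z := by
  obtain ⟨g, rfl⟩ := (D.toTop_p_eq_iff _ _).1 ((D.p_sec i b).trans h.symm)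
  obtain rfl := D.eq_one_of_mem (D.sec_mem i b) hz
  exact (D.toTop_ρ_one _).symm

lemma ρ_inv_mem {i : D.ι} {g : G} {z : SSet.toTop.obj Z} (hz : z ∈ D.V i g) :
    SSet.toTop.map (D.ρ g⁻¹) z ∈ D.V i 1 := by
  have := D.ρ_mem_V i g⁻¹ g z hz
  rwa [inv_mul_cancel] at this

/-- Pulled back to the sheet `V i g`, the section is translation by g⁻¹. -/
lemma continuous_sec (i : D.ι) : Continuous (D.sec i) := by
  refine D.isQuotientMap_p.continuous_of_local (D.isOpen_base i) _ (D.V i) (D.isOpen_V i)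
    (fun g => SSet.toTop.map (D.ρ g⁻¹)) (fun g => (SSet.toTop.map (D.ρ g⁻¹)).hom.continuous)
    (fun z hz => (D.mem_base_iff i z).1 hz) fun g z hz hg => ?_
  exact D.eq_sec (D.ρ_inv_mem hg) ((D.toTop_p_eq_iff _ _).2 ⟨_, rfl⟩).symm

/-- Any preimage under `Ψ` can be moved by an element of G until its Z-coordinate lies on the chosen
section. -/
lemma exists_lift (i : D.ι) (e : SSet.toTop.map D.q ⁻¹' D.base i) :
    ∃ w, SSet.toTop.map D.Ψ w = e.1 ∧
      SSet.toTop.map (CartesianMonoidalCategory.snd Y Z) w = D.sec i ⟨_, e.2⟩ := by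
  obtain ⟨w, hw⟩ := D.isQuotientMap_Ψ.surjective e.1
  have h1 : SSet.toTop.map D.p (SSet.toTop.map (CartesianMonoidalCategory.snd Y Z) w) =
      SSet.toTop.map D.p (D.sec i ⟨_, e.2⟩) := by
    rw [← toTop_Ψ_q, hw, p_sec]
  obtain ⟨g, hg⟩ := (D.toTop_p_eq_iff _ _).1 h1
  refine ⟨SSet.toTop.map (D.tw g) w, ?_, ?_⟩
  · rw [← hw]; exact ((D.toTop_Ψ_eq_iff _ _).2 ⟨g, rfl⟩).symm
  · rw [toTop_tw_snd, hg]

/-- The lift to `|Y × Z|` of a point over a trivializing open set. -/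
def lift (i : D.ι) (e : SSet.toTop.map D.q ⁻¹' D.base i) : SSet.toTop.obj (Y ⊗ Z) :=
  (D.exists_lift i e).choose

lemma Ψ_lift (i : D.ι) (e : SSet.toTop.map D.q ⁻¹' D.base i) :
    SSet.toTop.map D.Ψ (D.lift i e) = e.1 := (D.exists_lift i e).choose_spec.1

lemma snd_lift (i : D.ι) (e : SSet.toTop.map D.q ⁻¹' D.base i) :
    SSet.toTop.map (CartesianMonoidalCategory.snd Y Z) (D.lift i e) = D.sec i ⟨_, e.2⟩ :=
  (D.exists_lift i e).choose_spec.2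

lemma eq_lift {i : D.ι} {e : SSet.toTop.map D.q ⁻¹' D.base i} {w : SSet.toTop.obj (Y ⊗ Z)}
    (h : SSet.toTop.map D.Ψ w = e.1)
    (hw : SSet.toTop.map (CartesianMonoidalCategory.snd Y Z) w ∈ D.V i 1) : D.lift i e = w := by
  obtain ⟨g, rfl⟩ := (D.toTop_Ψ_eq_iff _ _).1 ((D.Ψ_lift i e).trans h.symm)
  rw [toTop_tw_snd, snd_lift] at hw
  obtain rfl := D.eq_one_of_mem (D.sec_mem i _) hw
  refine prod_ext ?_ ?_
  · have h1 : D.tw 1 ≫ CartesianMonoidalCategory.fst Y Z = CartesianMonoidalCategory.fst Y Z := by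
      ext n ⟨ξ, z⟩
      change (D.κ 1).app n z • ξ = ξ
      -- The cocycle identity makes κ(1) idempotent in a group, hence trivial, so 1 acts as the
      -- identity on the Y-coordinate.
      have h2 := D.κ_mul 1 1 n z
      have h3 : (D.ρ 1).app n z = z := by rw [D.ρ_one]; rfl
      rw [h3, mul_one] at h2
      rw [left_eq_mul.1 h2]
      exact one_smul _ ξ
    rw [← ConcreteCategory.comp_apply (SSet.toTop.map (D.tw 1)), ← Functor.map_comp, h1]
  · rw [toTop_tw_snd, toTop_ρ_one]

/-- As for the section: pulled back along `Ψ` to the points over the sheet `V i g`, the lift is the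
twisted action of g⁻¹. -/
lemma continuous_lift (i : D.ι) : Continuous (D.lift i) := by
  have hU : IsOpen (SSet.toTop.map D.q ⁻¹' D.base i) :=
    (D.isOpen_base i).preimage (SSet.toTop.map D.q).hom.continuous
  refine D.isQuotientMap_Ψ.continuous_of_local hU _
    (fun g => SSet.toTop.map (CartesianMonoidalCategory.snd Y Z) ⁻¹' D.V i g)
    (fun g => (D.isOpen_V i g).preimage (SSet.toTop.map _).hom.continuous)
    (fun g => SSet.toTop.map (D.tw g⁻¹)) (fun g => (SSet.toTop.map _).hom.continuous)
    (fun w hw => (D.mem_base_iff i _).1 ?_) fun g w hw hg => ?_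
  · rw [← toTop_Ψ_q]; exact hw
  · refine D.eq_lift ((D.toTop_Ψ_eq_iff _ _).2 ⟨_, rfl⟩).symm ?_
    rw [toTop_tw_snd]
    exact D.ρ_inv_mem hg

lemma q_Ψ_pairPt_sec (i : D.ι) (b : D.base i) (y : SSet.toTop.obj Y) :
    SSet.toTop.map D.q (SSet.toTop.map D.Ψ (pairPt y (D.sec i b))) = b := by
  rw [toTop_Ψ_q, snd_pairPt, p_sec]

/-- The local trivialization over a trivializing open set. -/
def chart (i : D.ι) :
    (SSet.toTop.map D.q ⁻¹' D.base i : Set (SSet.toTop.obj E)) ≃ₜ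
      KProd (D.base i) (SSet.toTop.obj Y) where
  toFun e := (⟨SSet.toTop.map D.q e.1, e.2⟩,
    SSet.toTop.map (CartesianMonoidalCategory.fst Y Z) (D.lift i e))
  invFun z := ⟨SSet.toTop.map D.Ψ (pairPt z.2 (D.sec i z.1)),
    Set.mem_preimage.2 (D.q_Ψ_pairPt_sec i z.1 z.2 ▸ z.1.2)⟩
  left_inv e := by
    apply Subtype.ext
    change SSet.toTop.map D.Ψ (pairPt _ (D.sec i _)) = e.1
    rw [← snd_lift, pairPt_fst_snd, Ψ_lift]
  right_inv z := by
    refine Prod.ext (Subtype.ext (D.q_Ψ_pairPt_sec i z.1 z.2)) ?_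
    refine (congrArg (SSet.toTop.map (CartesianMonoidalCategory.fst Y Z))
      (D.eq_lift (w := pairPt z.2 (D.sec i z.1)) rfl ?_)).trans (fst_pairPt _ _)
    rw [snd_pairPt]; exact D.sec_mem i z.1
  continuous_toFun := by
    have hU : IsOpen (SSet.toTop.map D.q ⁻¹' D.base i) :=
      (D.isOpen_base i).preimage (SSet.toTop.map D.q).hom.continuous
    -- The domain is open in a realization, hence compactly generated, so continuity into the
    -- ordinary product suffices.
    have := hU.uCompactlyGeneratedSpace
    refine continuous_to_compactlyGenerated (B := D.base i × SSet.toTop.obj Y) ?_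
    exact (((SSet.toTop.map D.q).hom.continuous.comp continuous_subtype_val).subtype_mk _).prodMk
      ((SSet.toTop.map _).hom.continuous.comp (D.continuous_lift i))
  continuous_invFun :=
    ((SSet.toTop.map D.Ψ).hom.continuous.comp
      (continuous_pairPt_kprod (D.continuous_sec i))).subtype_mk _

lemma exists_change (i j : D.ι) (b : (D.base i ∩ D.base j : Set (SSet.toTop.obj X))) :
    ∃ g, SSet.toTop.map (D.ρ g) (D.sec j ⟨b, b.2.2⟩) = D.sec i ⟨b, b.2.1⟩ :=
  (D.toTop_p_eq_iff _ _).1 ((D.p_sec j ⟨b, b.2.2⟩).trans (D.p_sec i ⟨b, b.2.1⟩).symm)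

/-- The element of `G` which relates two sections. -/
def change (i j : D.ι) (b : (D.base i ∩ D.base j : Set (SSet.toTop.obj X))) : G :=
  (D.exists_change i j b).choose

lemma ρ_change (i j : D.ι) (b : (D.base i ∩ D.base j : Set (SSet.toTop.obj X))) :
    SSet.toTop.map (D.ρ (D.change i j b)) (D.sec j ⟨b, b.2.2⟩) = D.sec i ⟨b, b.2.1⟩ :=
  (D.exists_change i j b).choose_spec

lemma eq_change {i j : D.ι} {b : (D.base i ∩ D.base j : Set (SSet.toTop.obj X))} {g : G}
    (h : SSet.toTop.map (D.ρ g) (D.sec j ⟨b, b.2.2⟩) ∈ D.V i 1) : D.change i j b = g := by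
  have h1 := D.ρ_change i j b
  have h2 : D.change i j b = g * (g⁻¹ * D.change i j b) := by group
  have h3 : SSet.toTop.map (D.ρ (D.change i j b * g⁻¹))
      (SSet.toTop.map (D.ρ g) (D.sec j ⟨b, b.2.2⟩)) ∈ D.V i 1 := by
    rw [← toTop_ρ_mul, inv_mul_cancel_right, h1]
    exact D.sec_mem i _
  exact mul_inv_eq_one.1 (D.eq_one_of_mem h h3)

/-- The transition functions. -/
def transitionFun (i j : D.ι) (b : (D.base i ∩ D.base j : Set (SSet.toTop.obj X))) :
    SSet.toTop.obj K :=
  SSet.toTop.map (D.κ (D.change i j b)) (D.sec j ⟨b, b.2.2⟩)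

/-- The group element relating two sections is locally constant: if g moves the j-th section into
the open sheet `V i 1` at b, it does so near b. With g fixed, the transition function is a composite
of continuous maps. -/
lemma continuous_transitionFun (i j : D.ι) : Continuous (D.transitionFun i j) := by
  have hj : Continuous fun b : (D.base i ∩ D.base j : Set (SSet.toTop.obj X)) =>
      D.sec j ⟨b, b.2.2⟩ := (D.continuous_sec j).comp (continuous_subtype_val.subtype_mk _)
  rw [continuous_iff_continuousAt]
  intro b
  let g := D.change i j b
  have h1 : ContinuousAt (fun b : (D.base i ∩ D.base j : Set (SSet.toTop.obj X)) =>
      SSet.toTop.map (D.κ g) (D.sec j ⟨b, b.2.2⟩)) b :=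
    ((SSet.toTop.map (D.κ g)).hom.continuous.comp hj).continuousAt
  refine h1.congr ?_
  have h2 : IsOpen ((fun b : (D.base i ∩ D.base j : Set (SSet.toTop.obj X)) =>
      SSet.toTop.map (D.ρ g) (D.sec j ⟨b, b.2.2⟩)) ⁻¹' D.V i 1) :=
    (D.isOpen_V i 1).preimage ((SSet.toTop.map (D.ρ g)).hom.continuous.comp hj)
  have h3 : SSet.toTop.map (D.ρ g) (D.sec j ⟨b, b.2.2⟩) ∈ D.V i 1 := by
    rw [D.ρ_change i j b]; exact D.sec_mem i _
  filter_upwards [h2.mem_nhds h3] with b' hb'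
  rw [transitionFun, D.eq_change hb']

/-- The witness is the image of w under the simplicial map (ξ, z) ↦ (κ_g(z), ξ), whose composite
with the action is the Y-coordinate of the twisted action. -/
lemma realRel_smul (g : G) (w : SSet.toTop.obj (Y ⊗ Z)) :
    RealRel (smulMap K Y)
      (SSet.toTop.map (D.κ g) (SSet.toTop.map (CartesianMonoidalCategory.snd Y Z) w))
      (SSet.toTop.map (CartesianMonoidalCategory.fst Y Z) w)
      (SSet.toTop.map (CartesianMonoidalCategory.fst Y Z) (SSet.toTop.map (D.tw g) w)) := by
  let f : Y ⊗ Z ⟶ K ⊗ Y := CartesianMonoidalCategory.lift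
    (CartesianMonoidalCategory.snd Y Z ≫ D.κ g) (CartesianMonoidalCategory.fst Y Z)
  refine ⟨SSet.toTop.map f w, ?_, ?_, ?_⟩
  all_goals simp only [← ConcreteCategory.comp_apply, ← Functor.map_comp]
  · rw [CartesianMonoidalCategory.lift_fst]
  · rw [CartesianMonoidalCategory.lift_snd]
  · rfl

lemma realRel_mul (g h : G) (z : SSet.toTop.obj Z) :
    RealRel (mulMap K) (SSet.toTop.map (D.κ g) (SSet.toTop.map (D.ρ h) z))
      (SSet.toTop.map (D.κ h) z) (SSet.toTop.map (D.κ (g * h)) z) := by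
  let f : Z ⟶ K ⊗ K := CartesianMonoidalCategory.lift (D.ρ h ≫ D.κ g) (D.κ h)
  refine ⟨SSet.toTop.map f z, ?_, ?_, ?_⟩
  all_goals simp only [← ConcreteCategory.comp_apply, ← Functor.map_comp]
  · rw [CartesianMonoidalCategory.lift_fst]
  · rw [CartesianMonoidalCategory.lift_snd]
  · have : f ≫ mulMap K = D.κ (g * h) := by
      ext n x
      exact (D.κ_mul g h n x).symm
    rw [this]

/-- The bundle atlas of a twisted quotient. -/
def atlas : BundleAtlas (SSet.toTop.map D.q) K Y where
  ι := D.ι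
  U := D.base
  isOpen := D.isOpen_base
  covers b := by
    obtain ⟨z, rfl⟩ := D.isQuotientMap_p.surjective b
    obtain ⟨i, g, hz⟩ := D.V_cover z
    exact ⟨i, (D.mem_base_iff i z).2 ⟨g, hz⟩⟩
  chart := D.chart
  chart_fst _ _ := rfl
  g i j := ⟨D.transitionFun i j, D.continuous_transitionFun i j⟩
  transition i j e hi hj := by
    have h := D.realRel_smul (D.change i j ⟨_, hi, hj⟩) (D.lift j ⟨e, hj⟩)
    rw [snd_lift] at h
    -- The twisted action of the change element carries the j-th lift of e to a lift over the i-th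
    -- section, which is the i-th lift by uniqueness.
    rw [← D.eq_lift (i := i) (e := ⟨e, hi⟩)
      (w := SSet.toTop.map (D.tw (D.change i j ⟨_, hi, hj⟩)) (D.lift j ⟨e, hj⟩))
      (((D.toTop_Ψ_eq_iff _ _).2 ⟨_, rfl⟩).symm.trans (D.Ψ_lift j ⟨e, hj⟩))
      (by
        rw [toTop_tw_snd, snd_lift, D.ρ_change i j ⟨_, hi, hj⟩]
        exact D.sec_mem i _)] at h
    exact h
  cocycle i j k b hi hj hk := by
    have h := D.realRel_mul (D.change i j ⟨b, hi, hj⟩) (D.change j k ⟨b, hj, hk⟩)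
      (D.sec k ⟨b, hk⟩)
    -- Freeness makes the change elements multiplicative; the cocycle identity for κ then gives the
    -- one for the transition functions.
    have h1 : D.change i k ⟨b, hi, hk⟩ = D.change i j ⟨b, hi, hj⟩ * D.change j k ⟨b, hj, hk⟩ := by
      apply D.eq_change
      rw [toTop_ρ_mul, D.ρ_change j k ⟨b, hj, hk⟩, D.ρ_change i j ⟨b, hi, hj⟩]
      exact D.sec_mem i _
    rw [D.ρ_change j k ⟨b, hj, hk⟩, ← h1] at h
    exact h

lemma isFibreBundle : IsFibreBundle (SSet.toTop.map D.q) K Y := ⟨D.atlas⟩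

end TwistedQuotient

namespace Realization

variable {m n : SimplexCategory}

/-! ## Truncated barycentric coordinates -/

/-- The lengths of the intersections with `[0, s]` of the consecutive intervals whose lengths are the
barycentric coordinates of `t`. -/
def truncCoord (s : ℝ) (t : TopSimplex n) (j : Fin (n.len + 1)) : ℝ :=
  min (cumSum t (j.val + 1)) s - min (cumSum t j) s

lemma truncCoord_nonneg (s : ℝ) (t : TopSimplex n) (j : Fin (n.len + 1)) :
    0 ≤ truncCoord s t j :=
  sub_nonneg.2 (min_le_min_right s (cumSum_mono t (Nat.le_succ _)))

lemma continuous_truncCoord (s : ℝ) (j : Fin (n.len + 1)) :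
    Continuous fun t : TopSimplex n => truncCoord s t j :=
  ((continuous_cumSum _).min continuous_const).sub ((continuous_cumSum _).min continuous_const)

lemma sum_truncCoord_lt (s : ℝ) (t : TopSimplex n) (p : Fin (n.len + 2)) :
    (∑ j : Fin (n.len + 1), if j.val < p.val then truncCoord s t j else 0) =
      min (cumSum t p) s - min 0 s := by
  have h := sum_ite_sub_eq (k := n.len) (fun i => min (cumSum t i) s) p
  simp only [Fin.val_zero, cumSum_zero] at h
  rw [← h]
  rfl

lemma sum_truncCoord_le {s : ℝ} (hs : 0 ≤ s) (t : TopSimplex n) :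
    ∑ j : Fin (n.len + 1), truncCoord s t j ≤ s := by
  have h := sum_truncCoord_lt s t (Fin.last _)
  have h1 : ∀ j : Fin (n.len + 1), j.val < (Fin.last (n.len + 1)).val := fun j => j.2
  simp only [h1, if_true, min_eq_left hs, sub_zero] at h
  rw [h]
  exact min_le_right _ _

/-- The preimage of an initial segment under a monotone map is an initial segment; this lets sums
over the preimage telescope. -/
lemma exists_lt_iff (θ : m ⟶ n) (k : ℕ) :
    ∃ p : Fin (m.len + 2), ∀ j, (θ.toOrderHom j).val < k ↔ j.val < p.val := by
  classical
  by_cases h : ∃ j, k ≤ (θ.toOrderHom j).val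
  · have h' : ∃ l, ∃ hl : l < m.len + 1, k ≤ (θ.toOrderHom ⟨l, hl⟩).val := by
      obtain ⟨j, hj⟩ := h
      exact ⟨j, j.2, hj⟩
    obtain ⟨hl, hl'⟩ := Nat.find_spec h'
    refine ⟨⟨Nat.find h', by lia⟩, fun j => ⟨fun hj => ?_, fun hj => ?_⟩⟩
    · by_contra hlt
      have h1 : (⟨Nat.find h', hl⟩ : Fin (m.len + 1)) ≤ j := not_lt.1 hlt
      have h2 := Fin.le_def.1 (θ.toOrderHom.monotone h1)
      lia
    · have h1 := Nat.find_min h' hj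
      push Not at h1
      exact h1 j.2
  · push Not at h
    exact ⟨Fin.last _, fun j => ⟨fun _ => j.2, fun _ => h j⟩⟩

lemma sum_truncCoord_map_lt (s : ℝ) (θ : m ⟶ n) (t : TopSimplex m) (k : ℕ) :
    (∑ j : Fin (m.len + 1), if (θ.toOrderHom j).val < k then truncCoord s t j else 0) =
      min (cumSum (topSimplexMap θ t) k) s - min 0 s := by
  obtain ⟨p, hp⟩ := exists_lt_iff θ k
  rw [cumSum_topSimplexMap]
  simp only [hp]
  exact sum_truncCoord_lt s t p

/-- Lengths inside [0, s] are additive when intervals are merged. The proof compares cumulative sums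
at i and i + 1 and takes the difference. -/
lemma truncCoord_map (s : ℝ) (θ : m ⟶ n) (t : TopSimplex m) (i : Fin (n.len + 1)) :
    truncCoord s (topSimplexMap θ t) i =
      ∑ j : Fin (m.len + 1), if θ.toOrderHom j = i then truncCoord s t j else 0 := by
  have h1 := sum_truncCoord_map_lt s θ t (i.val + 1)
  have h2 := sum_truncCoord_map_lt s θ t i
  have h3 : truncCoord s (topSimplexMap θ t) i =
      (min (cumSum (topSimplexMap θ t) (i.val + 1)) s - min 0 s) -
        (min (cumSum (topSimplexMap θ t) i) s - min 0 s) := by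
    unfold truncCoord; ring
  rw [h3, ← h1, ← h2, ← Finset.sum_sub_distrib]
  refine Finset.sum_congr rfl fun j _ => ?_
  rcases lt_trichotomy (θ.toOrderHom j).val i.val with h | h | h
  · have e : θ.toOrderHom j ≠ i := fun e => h.ne (congrArg Fin.val e)
    simp [e, h, h.trans (Nat.lt_succ_self _)]
  · have e : θ.toOrderHom j = i := Fin.ext h
    simp [e]
  · have e : θ.toOrderHom j ≠ i := fun e => h.ne' (congrArg Fin.val e)
    have e1 : ¬ (θ.toOrderHom j).val < i.val + 1 := by lia
    simp [e, e1, h.not_gt]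

end Realization

/-! ## The universal covering of the classifying space of a group -/

/-- The simplicial set with the maps `{0, …, n} → G` as its `n`-simplices. -/
def univCover (G : Type u) : SSet.{u} where
  obj n := Fin (n.unop.len + 1) → G
  map θ := ↾fun a => a ∘ θ.unop.toOrderHom
  map_id _ := rfl
  map_comp _ _ := rfl

namespace univCover

variable {G : Type u}

open Classical in
/-- The total length of the set of points of `[0, s]` at which the step function with values `a` and
with step lengths `t` has the value `g`. -/
def massFun (s : ℝ) (g : G) {n : SimplexCategory} (a : (univCover G).obj (op n))
    (t : TopSimplex n) : ℝ :=
  ∑ j : Fin (n.len + 1), if (a : Fin (n.len + 1) → G) j = g then truncCoord s t j else 0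

lemma massFun_map (s : ℝ) (g : G) {m n : SimplexCategory} (θ : m ⟶ n)
    (a : (univCover G).obj (op n)) (t : TopSimplex m) :
    massFun s g ((univCover G).map θ.op a) t = massFun s g a (topSimplexMap θ t) := by
  classical
  unfold massFun
  simp only [truncCoord_map]
  have h : ∀ i : Fin (n.len + 1),
      (if (a : Fin (n.len + 1) → G) i = g then
        ∑ j : Fin (m.len + 1), (if θ.toOrderHom j = i then truncCoord s t j else 0) else 0) =
      ∑ j : Fin (m.len + 1), if θ.toOrderHom j = i then
        (if (a : Fin (n.len + 1) → G) i = g then truncCoord s t j else 0) else 0 := by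
    intro i
    split_ifs <;> simp
  simp only [h]
  rw [Finset.sum_comm]
  refine Finset.sum_congr rfl fun j _ => ?_
  simp only [Finset.sum_ite_eq, Finset.mem_univ, if_true]
  rfl

/-- The continuous function on the realization given by `massFun`. -/
def mass (s : ℝ) (g : G) : C(SSet.toTop.obj (univCover G), ULift.{u} ℝ) :=
  SimplexFamily.desc
    { map := fun a => ⟨fun t => ⟨massFun s g a t⟩, continuous_uliftUp.comp (by
        unfold massFun
        refine continuous_finsetSum _ fun j _ => ?_
        split_ifs
        exacts [continuous_truncCoord s j, continuous_const])⟩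
      compat := fun θ a t => ULift.ext _ _ (massFun_map s g θ a t) }

lemma mass_charMap (s : ℝ) (g : G) {n : SimplexCategory} (a : (univCover G).obj (op n))
    (t : TopSimplex n) : (mass s g (charMap a t)).down = massFun s g a t :=
  congrArg ULift.down (SimplexFamily.desc_charMap _ a t)

/-- The points at which `g` is the value on more than half of `[0, s]`. -/
def sheet (s : ℝ) (g : G) : Set (SSet.toTop.obj (univCover G)) :=
  (fun z => (mass s g z).down) ⁻¹' Set.Ioi (s / 2)

lemma isOpen_sheet (s : ℝ) (g : G) : IsOpen (sheet s g) :=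
  isOpen_Ioi.preimage (continuous_uliftDown.comp (mass s g).continuous)

lemma charMap_mem_sheet {s : ℝ} {g : G} {n : SimplexCategory} {a : (univCover G).obj (op n)}
    {t : TopSimplex n} : charMap a t ∈ sheet s g ↔ s / 2 < massFun s g a t := by
  rw [← mass_charMap]; rfl

/-- The step function takes different values on disjoint parts of [0, s], and two disjoint parts
cannot both exceed half of the total length. -/
lemma eq_of_mem_sheet {s : ℝ} (hs : 0 < s) {g g' : G} {z : SSet.toTop.obj (univCover G)}
    (h : z ∈ sheet s g) (h' : z ∈ sheet s g') : g = g' := by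
  classical
  by_contra hg
  obtain ⟨n, a, t, rfl⟩ := exists_charMap z
  rw [charMap_mem_sheet] at h h'
  have h1 : massFun s g a t + massFun s g' a t ≤ s := by
    refine le_trans ?_ (sum_truncCoord_le hs.le t)
    unfold massFun
    rw [← Finset.sum_add_distrib]
    refine Finset.sum_le_sum fun j _ => ?_
    have := truncCoord_nonneg s t j
    split_ifs with h1 h2
    · exact absurd (h1.symm.trans h2) hg
    all_goals simp [this]
  linarith

lemma exists_mem_sheet (z : SSet.toTop.obj (univCover G)) : ∃ s > 0, ∃ g : G, z ∈ sheet s g := by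
  classical
  obtain ⟨n, a, -, t, ht, rfl, -⟩ := exists_charMap_pair z z
  -- In interior coordinates the first interval has positive length s = t 0, and on all of it the
  -- step function has the value a 0.
  refine ⟨t 0, ht 0, (a : Fin (n.len + 1) → G) 0, ?_⟩
  rw [charMap_mem_sheet]
  have h1 : truncCoord (t 0) t 0 = t 0 := by
    have := cumSum_succ t 0
    simp only [Fin.val_zero, cumSum_zero, zero_add] at this
    simp [truncCoord, cumSum_zero, this, (ht 0).le]
  have h2 : truncCoord (t 0) t 0 ≤ massFun (t 0) ((a : Fin (n.len + 1) → G) 0) a t := by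
    unfold massFun
    refine le_trans (le_of_eq (if_pos rfl).symm) (Finset.single_le_sum
      (f := fun j => if (a : Fin (n.len + 1) → G) j = (a : Fin (n.len + 1) → G) 0
        then truncCoord (t 0) t j else 0) (fun j _ => ?_) (Finset.mem_univ 0))
    split_ifs
    exacts [truncCoord_nonneg _ t j, le_rfl]
  have h3 := ht 0
  linarith

variable [Group G]

/-- The action of `G` by left translation. -/
def translate (g : G) : univCover G ⟶ univCover G where
  app n := ↾fun (a : Fin (n.unop.len + 1) → G) j => g * a j
  naturality _ _ _ := rfl

lemma translate_mem_sheet {s : ℝ} {g h : G} {z : SSet.toTop.obj (univCover G)}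
    (hz : z ∈ sheet s h) : SSet.toTop.map (translate g) z ∈ sheet s (g * h) := by
  obtain ⟨n, a, t, rfl⟩ := exists_charMap z
  classical
  rw [toTop_map_charMap]
  rw [charMap_mem_sheet] at hz ⊢
  refine hz.trans_eq ?_
  unfold massFun
  refine Finset.sum_congr rfl fun j _ => ?_
  have : g * (a : Fin (n.len + 1) → G) j = g * h ↔ (a : Fin (n.len + 1) → G) j = h :=
    mul_right_inj g
  exact if_congr this.symm rfl rfl

end univCover

open LinkingSystem

/-! ## Simplices of the nerve of a group -/

namespace OneObj

variable {G : Type u} [Group G] {J : Type} [Category.{0} J]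

lemma eqToHom_eq {a b : OneObj G} (h : a = b) : (eqToHom h : a ⟶ b) = (1 : G) := by
  subst h; rfl

lemma comp_eq {a b c : OneObj G} (g : a ⟶ b) (h : b ⟶ c) : g ≫ h = (h * g : G) := rfl

/-- The group element given by a morphism in a diagram. -/
def elt (x : J ⥤ (OneObj G)ᵒᵖ) {i j : J} (f : i ⟶ j) : G := (x.map f).unop

lemma elt_comp (x : J ⥤ (OneObj G)ᵒᵖ) {i j k : J} (f : i ⟶ j) (g : j ⟶ k) :
    elt x (f ≫ g) = elt x f * elt x g := by
  unfold elt; rw [x.map_comp]; rfl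

/-- The element of `G` which relates the `i`-th and the `j`-th vertex of a simplex of the nerve. -/
def arr {N : ℕ} (x : Fin (N + 1) ⥤ (OneObj G)ᵒᵖ) (i j : Fin (N + 1)) : G :=
  (elt x (homOfLE (Fin.zero_le i)))⁻¹ * elt x (homOfLE (Fin.zero_le j))

variable {N : ℕ} (x : Fin (N + 1) ⥤ (OneObj G)ᵒᵖ)

@[simp] lemma arr_self (i : Fin (N + 1)) : arr x i i = 1 := inv_mul_cancel _

@[simp] lemma arr_mul (i j k : Fin (N + 1)) : arr x i j * arr x j k = arr x i k := by
  unfold arr; group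

lemma arr_inv (i j : Fin (N + 1)) : (arr x i j)⁻¹ = arr x j i := by
  unfold arr; group

lemma elt_eq_arr {i j : Fin (N + 1)} (f : i ⟶ j) : elt x f = arr x i j := by
  rw [arr, eq_inv_mul_iff_mul_eq, ← elt_comp]
  rfl

/-- The definition of `arr` passes through vertex 0, which Φ need not preserve; multiplicativity
removes the dependence on the base vertex. -/
lemma arr_whisker {M : ℕ} (Φ : Fin (M + 1) ⥤ Fin (N + 1)) (i j : Fin (M + 1)) :
    arr (Φ ⋙ x) i j = arr x (Φ.obj i) (Φ.obj j) := by
  have h : ∀ {i j : Fin (M + 1)} (f : i ⟶ j), elt (Φ ⋙ x) f = arr x (Φ.obj i) (Φ.obj j) :=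
    fun f => elt_eq_arr x (Φ.map f)
  rw [arr, h, h, arr_inv, arr_mul]

lemma ext_arr {x y : Fin (N + 1) ⥤ (OneObj G)ᵒᵖ} (h : ∀ i j, arr x i j = arr y i j) : x = y := by
  refine CategoryTheory.Functor.ext (fun j => unop_injective rfl) fun i j f => ?_
  apply Quiver.Hom.unop_inj
  rw [unop_comp, unop_comp, eqToHom_unop, eqToHom_unop, comp_eq, comp_eq, eqToHom_eq, one_mul,
    mul_one]
  change elt x f = elt y f
  rw [elt_eq_arr, elt_eq_arr, h]

/-- The simplex of the nerve with given vertices in `G`. -/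
def ofVertices {J : Type} [Category.{0} J] (a : J → G) : J ⥤ (OneObj G)ᵒᵖ where
  obj _ := op ⟨⟩
  map {i j} _ := Quiver.Hom.op (X := OneObj.mk) (Y := OneObj.mk) ((a i)⁻¹ * a j)
  map_id j := Quiver.Hom.unop_inj (inv_mul_cancel (a j))
  map_comp {i j k} _ _ := Quiver.Hom.unop_inj (by
    change (a i)⁻¹ * a k = ((a i)⁻¹ * a j) * ((a j)⁻¹ * a k)
    group)

lemma arr_ofVertices (a : Fin (N + 1) → G) (i j : Fin (N + 1)) :
    arr (ofVertices a) i j = (a i)⁻¹ * a j := by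
  unfold arr
  change ((a 0)⁻¹ * a i)⁻¹ * ((a 0)⁻¹ * a j) = _
  group

end OneObj

/-! ## Diagrams of automorphisms which lift to the extension group -/

namespace ExtensionPair

variable {p : ℕ} [Fact p.Prime] {S : Type u} [Group S] {F : FusionSystem S}
  {L : LinkingSystem p F} {G : Type u} [Group G] (U : ExtensionPair L G)

open Classical in
/-- The preimage in `Γ` of an element of the kernel of `ρ`. -/
def toGam (x : U.Γhat) : L.Gam :=
  if h : ∃ l, U.incl l = x then h.choose else 1

lemma incl_toGam {x : U.Γhat} (hx : U.ρ x = 1) : U.incl (U.toGam x) = x := by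
  have h : ∃ l, U.incl l = x := by
    rw [← MonoidHom.mem_ker, U.exact] at hx; exact hx
  rw [toGam, dif_pos h]
  exact h.choose_spec

@[simp] lemma ρ_incl (l : L.Gam) : U.ρ (U.incl l) = 1 := by
  rw [← MonoidHom.mem_ker, U.exact]; exact ⟨l, rfl⟩

lemma toGam_eq {x : U.Γhat} {l : L.Gam} (h : x = U.incl l) : U.toGam x = l := by
  apply U.incl_injective
  rw [U.incl_toGam (by rw [h, ρ_incl]), h]

variable {J : Type} [Category.{0} J]

/-- The diagram with vertices `τ(u j)`, for a family of elements of the extension group with the same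
image in `G`. -/
def diag (u : J → U.Γhat) (hu : ∀ i j, U.ρ (u i) = U.ρ (u j)) : J ⥤ (AutTyp L)ᵒᵖ :=
  AutTyp.mkDiagram (fun j => U.τ (u j)) (fun {i j} _ => U.toGam (u i * (u j)⁻¹))
    (fun {i j} _ => by
      rw [← U.τ_incl, U.incl_toGam (by rw [map_mul, map_inv, hu i j, mul_inv_cancel]), ← map_mul,
        inv_mul_cancel_right])
    (fun j => U.toGam_eq (by rw [mul_inv_cancel, map_one]))
    (fun {i j k} _ _ => U.toGam_eq (by
      rw [map_mul, U.incl_toGam (by rw [map_mul, map_inv, hu i j, mul_inv_cancel]),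
        U.incl_toGam (by rw [map_mul, map_inv, hu j k, mul_inv_cancel])]
      group))

variable {U} in
lemma ob_diag {u : J → U.Γhat} (hu : ∀ i j, U.ρ (u i) = U.ρ (u j)) (j : J) :
    AutTyp.ob (U.diag u hu) j = U.τ (u j) := rfl

variable {U} in
lemma incl_chi_diag {u : J → U.Γhat} (hu : ∀ i j, U.ρ (u i) = U.ρ (u j)) {i j : J} (f : i ⟶ j) :
    U.incl (AutTyp.chi (U.diag u hu) f) = u i * (u j)⁻¹ :=
  U.incl_toGam (by rw [map_mul, map_inv, hu i j, mul_inv_cancel])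

lemma diag_congr {u v : J → U.Γhat} (hu : ∀ i j, U.ρ (u i) = U.ρ (u j))
    (hv : ∀ i j, U.ρ (v i) = U.ρ (v j)) (h : ∀ j, u j = v j) : U.diag u hu = U.diag v hv := by
  obtain rfl : u = v := funext h
  rfl

variable {U} in
lemma ρ_mul_congr {I : Type*} {u v : I → U.Γhat} (hu : ∀ i j, U.ρ (u i) = U.ρ (u j))
    (hv : ∀ i j, U.ρ (v i) = U.ρ (v j)) (i j : I) : U.ρ (u i * v i) = U.ρ (u j * v j) := by
  rw [map_mul, map_mul, hu i j, hv i j]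

/-- Since τ(u j) acts on Γ as conjugation by u j, the product rule χ · α(χ') for edges becomes u_i
u_j⁻¹ · u_j (v_i v_j⁻¹) u_j⁻¹ = (u_i v_i)(u_j v_j)⁻¹. -/
lemma diag_mul {u v : J → U.Γhat} (hu : ∀ i j, U.ρ (u i) = U.ρ (u j))
    (hv : ∀ i j, U.ρ (v i) = U.ρ (v j)) :
    U.diag (fun j => u j * v j) (ρ_mul_congr hu hv) = U.diag u hu * U.diag v hv := by
  refine AutTyp.diagram_ext (fun j => map_mul U.τ _ _) fun {i j} f => ?_
  apply U.incl_injective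
  rw [AutTyp.chi_mul, map_mul, incl_chi_diag, incl_chi_diag, ob_diag, ← TypAut.evS_apply,
    U.τ_conj, incl_chi_diag]
  group

lemma diag_one (h : ∀ _ _ : J, U.ρ 1 = U.ρ 1) : U.diag (fun _ : J => 1) h = 1 :=
  AutTyp.diagram_ext (fun _ => map_one U.τ) fun f => by
    apply U.incl_injective
    rw [AutTyp.chi_one, incl_chi_diag, map_one, mul_inv_cancel]

/-- The common image in G is `arr x k l`. Hence the frames based at vertices k and l differ by a
diagram in 𝒜ut_typ(L). -/
lemma ρ_section_arr {t : G → U.Γhat} (ht : ∀ g, U.ρ (t g) = g) {M N : ℕ}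
    (x : Fin (N + 1) ⥤ (OneObj G)ᵒᵖ) (k l : Fin (N + 1))
    (κ : Fin (M + 1) → Fin (N + 1)) (i j : Fin (M + 1)) :
    U.ρ (t (OneObj.arr x k (κ i)) * (t (OneObj.arr x l (κ i)))⁻¹) =
      U.ρ (t (OneObj.arr x k (κ j)) * (t (OneObj.arr x l (κ j)))⁻¹) := by
  simp only [map_mul, map_inv, ht, OneObj.arr_inv, OneObj.arr_mul]

end ExtensionPair

namespace OneObj

variable {G : Type u} [Group G]

lemma arr_map {m n : SimplexCategory} (θ : m ⟶ n) (x : (opNerve (OneObj G)).obj (op n))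
    (i j : Fin (m.len + 1)) :
    arr ((opNerve (OneObj G)).map θ.op x : Fin (m.len + 1) ⥤ (OneObj G)ᵒᵖ) i j =
      arr (N := n.len) x (θ.toOrderHom i) (θ.toOrderHom j) :=
  arr_whisker (M := m.len) (N := n.len) _ _ i j

lemma arr_δ {n : ℕ} (k : Fin (n + 2)) (x : opNerve (OneObj G) _⦋n + 1⦌) (i j : Fin (n + 1)) :
    arr (N := n) ((opNerve (OneObj G)).δ k x) i j =
      arr (N := n + 1) x (k.succAbove i) (k.succAbove j) :=
  arr_map (SimplexCategory.δ k) x i j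

lemma arr_σ {n : ℕ} (k : Fin (n + 1)) (x : opNerve (OneObj G) _⦋n⦌) (i j : Fin (n + 2)) :
    arr (N := n + 1) ((opNerve (OneObj G)).σ k x) i j =
      arr (N := n) x (k.predAbove i) (k.predAbove j) :=
  arr_map (SimplexCategory.σ k) x i j

end OneObj

/-! ## The associated twisting function -/

section Twisting

variable {p : ℕ} [Fact p.Prime] {S : Type u} [Group S] {F : FusionSystem S}
  {L : LinkingSystem p F} {G : Type u} [Group G] (U : ExtensionPair L G)
  (t : G → U.Γhat) (ht : ∀ g, U.ρ (t g) = g)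

open OneObj

/-- The values of the twisting function of an extension pair with a section. -/
def twistingValue (n : ℕ) (x : opNerve (OneObj G) _⦋n + 1⦌) : opNerve (AutTyp L) _⦋n⦌ :=
  U.diag (J := Fin (n + 1))
    (fun j => t (arr (N := n + 1) x 0 j.succ) * (t (arr (N := n + 1) x 1 j.succ))⁻¹)
    (U.ρ_section_arr ht (N := n + 1) x 0 1 Fin.succ)

/-- For i ≠ 0 the face operator with index i + 1 keeps the two base vertices 0 and 1 of the frames.
-/
lemma twistingValue_δ (n : ℕ) (i : Fin (n + 2)) (x : opNerve (OneObj G) _⦋n + 2⦌) (hi : i ≠ 0) :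
    twistingValue U t ht n ((opNerve (OneObj G)).δ i.succ x) =
      (opNerve (AutTyp L)).δ i (twistingValue U t ht (n + 1) x) := by
  refine (U.diag_congr _ (U.ρ_section_arr ht (N := n + 2) x 0 1 fun j => (i.succAbove j).succ)
    fun j => ?_).trans rfl
  rw [arr_δ, arr_δ]
  have h1 : i.succ.succAbove (1 : Fin (n + 2)) = 1 := by
    rw [← Fin.succ_zero_eq_one, Fin.succ_succAbove_succ, Fin.succAbove_ne_zero_zero hi]
    rfl
  rw [Fin.succ_succAbove_zero, h1, Fin.succ_succAbove_succ]

/-- Omitting vertex 1 makes 0 and 2 the base vertices, and t(x_0j) t(x_2j)⁻¹ = t(x_0j) t(x_1j)⁻¹ ·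
t(x_1j) t(x_2j)⁻¹, with j shifted by 2. -/
lemma twistingValue_δ_one (n : ℕ) (x : opNerve (OneObj G) _⦋n + 2⦌) :
    twistingValue U t ht n ((opNerve (OneObj G)).δ 1 x) =
      (opNerve (AutTyp L)).δ 0 (twistingValue U t ht (n + 1) x) *
        twistingValue U t ht n ((opNerve (OneObj G)).δ 0 x) := by
  have h1 : ∀ j : Fin (n + 1), (1 : Fin (n + 3)).succAbove j.succ = j.succ.succ := fun j => by
    rw [← Fin.succ_zero_eq_one, Fin.succ_succAbove_succ, Fin.succAbove_zero]
  have h2 : (0 : Fin (n + 3)).succAbove (0 : Fin (n + 2)) = 1 := rfl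
  have h3 : (1 : Fin (n + 3)).succAbove (0 : Fin (n + 2)) = 0 := rfl
  have h4 : (1 : Fin (n + 3)).succAbove (1 : Fin (n + 2)) = (0 : Fin (n + 3)).succAbove 1 := rfl
  have e : (opNerve (AutTyp L)).δ 0 (twistingValue U t ht (n + 1) x) =
      U.diag (J := Fin (n + 1)) (fun j => t (arr (N := n + 2) x 0 j.succ.succ) *
          (t (arr (N := n + 2) x 1 j.succ.succ))⁻¹)
        (U.ρ_section_arr ht (N := n + 2) x 0 1 fun j => j.succ.succ) := rfl
  rw [e]
  refine (U.diag_congr _ _ fun j => ?_).trans (U.diag_mul _ _)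
  have h5 : (0 : Fin (n + 3)).succAbove j.succ = j.succ.succ := rfl
  rw [arr_δ, arr_δ, arr_δ, arr_δ, h1, h2, h3, h4, h5]
  group

lemma twistingValue_σ (n : ℕ) (i : Fin (n + 1)) (x : opNerve (OneObj G) _⦋n + 1⦌) :
    twistingValue U t ht (n + 1) ((opNerve (OneObj G)).σ i.succ x) =
      (opNerve (AutTyp L)).σ i (twistingValue U t ht n x) := by
  refine (U.diag_congr _ (U.ρ_section_arr ht (N := n + 1) x 0 1 fun j => (i.predAbove j).succ)
    fun j => ?_).trans rfl
  rw [arr_σ, arr_σ]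
  have h1 : i.succ.predAbove (1 : Fin (n + 3)) = 1 := by
    rw [← Fin.succ_zero_eq_one, Fin.succ_predAbove_succ]
    simp
  have h2 : i.succ.predAbove (0 : Fin (n + 3)) = 0 := by simp
  rw [h1, h2, Fin.succ_predAbove_succ]

/-- After repeating vertex 0 the two base vertices coincide, so the frames agree. -/
lemma twistingValue_σ_zero (n : ℕ) (x : opNerve (OneObj G) _⦋n⦌) :
    twistingValue U t ht n ((opNerve (OneObj G)).σ 0 x) = 1 := by
  refine Eq.trans (U.diag_congr _ (fun _ _ => rfl) fun j => ?_) (U.diag_one fun _ _ => rfl)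
  rw [arr_σ, arr_σ]
  have h1 : (0 : Fin (n + 1)).predAbove (1 : Fin (n + 2)) = 0 := rfl
  have h2 : (0 : Fin (n + 1)).predAbove (0 : Fin (n + 2)) = 0 := rfl
  rw [h1, h2, mul_inv_cancel]

/-- The twisting function of an extension pair with a section. -/
def twistingFunction : TwistingFunction (opNerve (OneObj G)) (opNerve (AutTyp L)) where
  φ := twistingValue U t ht
  φ_δ := twistingValue_δ U t ht
  φ_δ_one := twistingValue_δ_one U t ht
  φ_σ := twistingValue_σ U t ht
  φ_σ_zero := twistingValue_σ_zero U t ht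

end Twisting

/-! ## Characterization of the associated twisting function -/

namespace OneObj

variable {G : Type u} [Group G]

lemma ext_arr_zero {N : ℕ} {x y : Fin (N + 1) ⥤ (OneObj G)ᵒᵖ} (h : ∀ j, arr x 0 j = arr y 0 j) :
    x = y :=
  ext_arr fun i j => by rw [← arr_mul x i 0 j, ← arr_mul y i 0 j, ← arr_inv x, ← arr_inv y, h, h]

lemma arr_bar₁ (g : G) : arr (N := 1) (bar₁ g) 0 1 = g :=
  (elt_eq_arr (N := 1) (bar₁ g) (homOfLE (Fin.zero_le 1))).symm

lemma arr_bar₂_left (g h : G) : arr (N := 2) (bar₂ g h) 0 1 = g :=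
  (elt_eq_arr (N := 2) (bar₂ g h) (homOfLE (Fin.zero_le 1))).symm

lemma arr_bar₂_right (g h : G) : arr (N := 2) (bar₂ g h) 1 2 = h :=
  (elt_eq_arr (N := 2) (bar₂ g h) (i := 1) (j := 2) (homOfLE (by decide))).symm

lemma eq_bar₁ (x : opNerve (OneObj G) _⦋1⦌) : ∃ g, x = bar₁ g := by
  refine ⟨arr (N := 1) x 0 1, ext_arr_zero (N := 1) fun j => ?_⟩
  fin_cases j
  · exact (arr_self (N := 1) x 0).trans (arr_self (N := 1) _ 0).symm
  · exact (arr_bar₁ _).symm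

lemma eq_bar₂ (x : opNerve (OneObj G) _⦋2⦌) : ∃ g h, x = bar₂ g h := by
  refine ⟨arr (N := 2) x 0 1, arr (N := 2) x 1 2, ext_arr_zero (N := 2) fun j => ?_⟩
  fin_cases j
  · exact (arr_self (N := 2) x 0).trans (arr_self (N := 2) _ 0).symm
  · exact (arr_bar₂_left _ _).symm
  · refine (arr_mul (N := 2) x 0 1 2).symm.trans (Eq.trans ?_ (arr_mul (N := 2) _ 0 1 2))
    rw [arr_bar₂_left, arr_bar₂_right]

end OneObj

/-- This is `twist_comp` for κ followed by δ⁰, solved for the restriction. Both twists on the right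
have source [m], so they are values of `φ.φ m`: low-dimensional values control all faces of the
higher ones. -/
lemma TwistingFunction.map_φ {X K : SSet.{u}} [SimplicialGroup K] (φ : TwistingFunction X K)
    {m n : ℕ} (κ : (⦋m⦌ : SimplexCategory) ⟶ ⦋n⦌) (x : X _⦋n + 1⦌) :
    K.map κ.op (φ.φ n x) =
      φ.twist (κ ≫ SimplexCategory.δ 0) x * (φ.twist κ (X.δ 0 x))⁻¹ := by
  rw [eq_mul_inv_iff_mul_eq, ← φ.twist_δ_zero]
  exact (φ.twist_comp κ (SimplexCategory.δ 0) x).symm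

lemma TwistingFunction.map_φ_congr {X K : SSet.{u}} [SimplicialGroup K]
    {φ φ' : TwistingFunction X K} {m n : ℕ} (h : φ.φ m = φ'.φ m)
    (κ : (⦋m⦌ : SimplexCategory) ⟶ ⦋n⦌) (x : X _⦋n + 1⦌) :
    K.map κ.op (φ.φ n x) = K.map κ.op (φ'.φ n x) := by
  have h1 : ∀ {n : ℕ} (θ : (⦋m⦌ : SimplexCategory) ⟶ ⦋n⦌) (x : X _⦋n⦌),
      φ.twist θ x = φ'.twist θ x := fun θ x => congrFun h _
  rw [map_φ, map_φ, h1, h1]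

section Associated

variable {p : ℕ} [Fact p.Prime] {S : Type u} [Group S] {F : FusionSystem S}
  {L : LinkingSystem p F}

lemma nerve_autTyp_ext {n : ℕ} {a b : opNerve (AutTyp L) _⦋n⦌}
    (h₀ : ∀ κ : (⦋0⦌ : SimplexCategory) ⟶ ⦋n⦌, vertexAut ((opNerve (AutTyp L)).map κ.op a) =
      vertexAut ((opNerve (AutTyp L)).map κ.op b))
    (h₁ : ∀ κ : (⦋1⦌ : SimplexCategory) ⟶ ⦋n⦌, edgeGam ((opNerve (AutTyp L)).map κ.op a) =
      edgeGam ((opNerve (AutTyp L)).map κ.op b)) : a = b :=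
  AutTyp.diagram_ext (J := Fin (n + 1)) (fun j => h₀ (SimplexCategory.const ⦋0⦌ ⦋n⦌ j))
    fun {i j} f => h₁ (SimplexCategory.mkOfLe i j f.le)

variable {G : Type u} [Group G] (U : ExtensionPair L G) (t : G → U.Γhat)

-- Since t(1) = 1 the base-vertex correction disappears: the vertex at [g] is τ(t(g)), and the edge
-- at [g|h] is t(g) · (t(gh) t(h)⁻¹)⁻¹ = t(g) t(h) t(gh)⁻¹.
open OneObj in
lemma isAssociated_twistingFunction (ht : ∀ g, U.ρ (t g) = g) (ht_one : t 1 = 1) :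
    IsAssociated U t (twistingFunction U t ht) where
  vertex g := by
    have e : vertexAut ((twistingFunction U t ht).φ 0 (bar₁ g)) =
      U.τ (t (arr (N := 1) (bar₁ g) 0 1) * (t (arr (N := 1) (bar₁ g) 1 1))⁻¹) := rfl
    have e1 : arr (N := 1) (bar₁ g) 1 1 = 1 := arr_self _ _
    rw [e, e1, ht_one, inv_one, mul_one, arr_bar₁]
  edge g h := by
    have e : U.incl (edgeGam ((twistingFunction U t ht).φ 1 (bar₂ g h))) =
        (t (arr (N := 2) (bar₂ g h) 0 1) * (t (arr (N := 2) (bar₂ g h) 1 1))⁻¹) *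
          (t (arr (N := 2) (bar₂ g h) 0 2) * (t (arr (N := 2) (bar₂ g h) 1 2))⁻¹)⁻¹ :=
      ExtensionPair.incl_chi_diag (U.ρ_section_arr ht (N := 2) (bar₂ g h) 0 1 Fin.succ) _
    have e1 : arr (N := 2) (bar₂ g h) 1 1 = 1 := arr_self _ _
    have e2 : arr (N := 2) (bar₂ g h) 0 2 =
      arr (N := 2) (bar₂ g h) 0 1 * arr (N := 2) (bar₂ g h) 1 2 := (arr_mul _ _ _ _).symm
    rw [e, e1, e2, ht_one, arr_bar₂_left, arr_bar₂_right]
    group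

variable {U t}

/-- The first condition fixes `φ.φ 0`, hence all vertices of all values. The second, with
injectivity of Γ → Γ̂, fixes the nontrivial edge of each value of `φ.φ 1`, hence all edges of all
values. Vertices and edges determine a simplex of the nerve. -/
lemma IsAssociated.unique {φ φ' : TwistingFunction (opNerve (OneObj G)) (opNerve (AutTyp L))}
    (h : IsAssociated U t φ) (h' : IsAssociated U t φ') : φ' = φ := by
  have e : ∀ {n : ℕ} {a b : opNerve (AutTyp L) _⦋0⦌}, vertexAut a = vertexAut b → a = b :=
    fun {n a b} hab => AutTyp.diagram_ext (J := Fin 1)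
      (fun j => by obtain rfl := Subsingleton.elim j 0; exact hab)
      (fun {i j} f => by
        obtain rfl := Subsingleton.elim i j
        obtain rfl := Subsingleton.elim f (𝟙 i)
        exact (AutTyp.chi_id (J := Fin 1) a i).trans (AutTyp.chi_id (J := Fin 1) b i).symm)
  have h₀ : φ'.φ 0 = φ.φ 0 := by
    funext x
    obtain ⟨g, rfl⟩ := OneObj.eq_bar₁ x
    exact e (n := 0) ((h'.vertex g).symm.trans (h.vertex g))
  have hv : ∀ {n : ℕ} (x : opNerve (OneObj G) _⦋n + 1⦌) (κ : (⦋0⦌ : SimplexCategory) ⟶ ⦋n⦌),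
      vertexAut ((opNerve (AutTyp L)).map κ.op (φ'.φ n x)) =
        vertexAut ((opNerve (AutTyp L)).map κ.op (φ.φ n x)) :=
    fun x κ => congrArg vertexAut (TwistingFunction.map_φ_congr h₀ κ x)
  have h₁ : φ'.φ 1 = φ.φ 1 := by
    funext x
    refine AutTyp.diagram_ext (J := Fin 2) (fun j => hv x (SimplexCategory.const ⦋0⦌ ⦋1⦌ j)) ?_
    have hx : edgeGam (φ'.φ 1 x) = edgeGam (φ.φ 1 x) := by
      obtain ⟨g, k, rfl⟩ := OneObj.eq_bar₂ x
      apply U.incl_injective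
      exact mul_right_cancel ((h'.edge g k).symm.trans (h.edge g k))
    have h1 : ∀ j (f : j ⟶ j), AutTyp.chi (J := Fin 2) (φ'.φ 1 x) f =
        AutTyp.chi (J := Fin 2) (φ.φ 1 x) f := fun j f => by
      obtain rfl := Subsingleton.elim f (𝟙 j)
      exact (AutTyp.chi_id (J := Fin 2) _ j).trans (AutTyp.chi_id (J := Fin 2) _ j).symm
    intro i j f
    match i, j, f with
    | 0, 0, f => exact h1 _ f
    | 0, 1, f => exact hx
    | 1, 0, f => exact absurd f.le (by decide)
    | 1, 1, f => exact h1 _ f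
  refine TwistingFunction.ext (funext fun n => funext fun x => nerve_autTyp_ext (hv x) fun κ => ?_)
  exact congrArg edgeGam (TwistingFunction.map_φ_congr h₁ κ x)

end Associated

/-! ## The extended category as an extension of the linking system -/

namespace ExtCat

variable {p : ℕ} [Fact p.Prime] {S : Type u} [Group S] {F : FusionSystem S}
  {L : LinkingSystem p F} {G : Type u} [Group G] {U : ExtensionPair L G}

lemma homMk_congr {P Q : ExtCat U} {γ γ' : U.Γhat} (h : γ = γ')
    {φ : (U.τ γ).F.obj P.obj ⟶ Q.obj} {φ' : (U.τ γ').F.obj P.obj ⟶ Q.obj}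
    (hφ : φ = eqToHom (by rw [h]) ≫ φ') : homMk γ φ = homMk γ' φ' := by
  subst h; simp [hφ]

lemma homMk_comp {P Q R : ExtCat U} (γ η : U.Γhat) (φ : (U.τ γ).F.obj P.obj ⟶ Q.obj)
    (ψ : (U.τ η).F.obj Q.obj ⟶ R.obj) : homMk γ φ ≫ homMk η ψ =
      homMk (η * γ) (eqToHom (τ_mul_obj η γ P.obj) ≫ (U.τ η).F.map φ ≫ ψ) := rfl

/-- An element λ relating two pairs with the same γ maps to 1 in Γ̂, so λ = 1 and its restriction is
the identity. -/
lemma homMk_injective {P Q : ExtCat U} (γ : U.Γhat) :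
    Function.Injective (homMk (P := P) (Q := Q) γ) := by
  intro φ φ' h
  obtain ⟨l, μ, h1, h2, h3⟩ := (Quotient.exact h : Rel (P := P) (Q := Q) ⟨γ, φ⟩ ⟨γ, φ'⟩)
  obtain rfl : l = 1 := by
    apply U.incl_injective
    rw [map_one, ← inv_eq_one]
    exact mul_eq_right.1 h2.symm
  rw [h1.unique (isRestr_id _)] at h3
  exact (h3.trans (Category.id_comp _)).symm

/-- Any two elements of Γ̂ with the same image in G differ by some λ ∈ Γ, which the equivalence
relation moves into the L-component. -/
lemma exists_homMk {P Q : ExtCat U} (m : P ⟶ Q) (γ : U.Γhat) (h : (pr U).map m = U.ρ γ) :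
    ∃ φ, homMk γ φ = m := by
  induction m using Quotient.ind with | _ a
  have h' : U.ρ (a.γ * γ⁻¹) = 1 := by
    rw [map_mul, map_inv, mul_inv_eq_one]; exact h
  have h2 : γ = (U.incl (U.toGam (a.γ * γ⁻¹)))⁻¹ * a.γ := by
    rw [U.incl_toGam h']; group
  exact ⟨TypAut.comp (τ_eq h2) P.obj ≫ a.φ,
    (Quotient.sound (show Rel a ⟨γ, TypAut.comp (τ_eq h2) P.obj ≫ a.φ⟩ from
      ⟨_, _, TypAut.comp_spec (τ_eq h2) P.obj, h2, rfl⟩)).symm⟩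

variable (U) in
/-- The embedding of `L` in `L_U`. -/
abbrev emb : L.Obj ⥤ ExtCat U where
  obj P := ⟨P⟩
  map {P Q} φ := homMk (P := ⟨P⟩) (Q := ⟨Q⟩) 1 (eqToHom (τ_one_obj (U := U) P) ≫ φ)
  map_id P := by rw [Category.comp_id]; rfl
  map_comp {P Q R} φ ψ := by
    rw [homMk_comp]
    refine homMk_congr (mul_one (1 : U.Γhat)).symm ?_
    have h := τ_map_congr (map_one U.τ) (eqToHom (τ_one_obj (U := U) P) ≫ φ)
    have h' : (U.τ 1).F.map (eqToHom (τ_one_obj (U := U) P) ≫ φ) ≫ eqToHom (τ_one_obj Q) ≫ ψ =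
        eqToHom (τ_one_obj _) ≫ eqToHom (τ_one_obj (U := U) P) ≫ φ ≫ ψ := by
      rw [← Category.assoc, h, TypAut.one_map]
      simp only [Category.assoc]
    rw [h']
    simp

lemma pr_map_emb {P Q : L.Obj} (φ : P ⟶ Q) : (pr U).map ((emb U).map φ) = (1 : G) :=
  map_one (ExtensionPair.ρ U)

instance : (emb U).Faithful where
  map_injective h := by
    have h := homMk_injective _ h
    rwa [cancel_epi] at h

/-- The canonical isomorphism from `P` to `τ(γ)(P)`, with `Q` in place of `τ(γ)(P)`. -/
def frame (γ : U.Γhat) {P : ExtCat U} {Q : L.Obj} (h : (U.τ γ).F.obj P.obj = Q) :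
    P ⟶ (emb U).obj Q := homMk γ (eqToHom h)

lemma frame_congr {γ γ' : U.Γhat} (e : γ = γ') {P : ExtCat U} {Q : L.Obj}
    (h : (U.τ γ).F.obj P.obj = Q) : frame γ h = frame γ' ((by rw [← e]; exact h)) := by
  subst e; rfl

lemma frame_comp {γ η : U.Γhat} {P : ExtCat U} {Q R : L.Obj} (h : (U.τ γ).F.obj P.obj = Q)
    (h' : (U.τ η).F.obj Q = R) : frame γ h ≫ frame (P := (emb U).obj Q) η h' =
      frame (η * γ) ((τ_mul_obj η γ P.obj).trans ((congrArg _ h).trans h')) := by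
  refine (homMk_comp _ _ _ _).trans (congrArg (homMk _) ?_)
  rw [eqToHom_map]
  simp

instance {γ : U.Γhat} {P : ExtCat U} {Q : L.Obj} (h : (U.τ γ).F.obj P.obj = Q) :
    IsIso (frame γ h) := by
  have h' : (U.τ γ⁻¹).F.obj Q = P.obj := by
    rw [← h, ← τ_mul_obj, inv_mul_cancel, τ_one_obj]
  refine ⟨frame (P := (emb U).obj Q) γ⁻¹ h', ?_, ?_⟩
  · rw [frame_comp, frame_congr (inv_mul_cancel γ)]; rfl
  · exact (frame_comp (P := (emb U).obj Q) h' h).trans (frame_congr (mul_inv_cancel γ) _)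

/-- In L_U the automorphism τ(γ) of L becomes conjugation by the canonical isomorphisms of γ. -/
lemma emb_map_frame {P Q : L.Obj} (φ : P ⟶ Q) (γ : U.Γhat) :
    (emb U).map φ ≫ frame (P := (emb U).obj Q) γ rfl =
      frame (P := (emb U).obj P) γ rfl ≫ (emb U).map ((U.τ γ).F.map φ) := by
  refine (homMk_comp _ _ _ _).trans (Eq.trans ?_ (homMk_comp _ _ _ _).symm)
  refine homMk_congr ((mul_one γ).trans (one_mul γ).symm) ?_
  simp [eqToHom_map, emb]

/-- This is the defining relation (φλ, λ⁻¹γ) ∼ (φ, γ) with λ = χ: changing a frame by an element of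
Γ composes it with a component of the natural transformation χ. -/
lemma frame_comp_emb_map {γ γ' : U.Γhat} {χ : L.Gam} (h : γ' = U.incl χ * γ) (P : L.Obj)
    (h' : U.τ γ' = TypAut.c L χ * U.τ γ) :
    frame (P := (emb U).obj P) γ rfl ≫ (emb U).map (TypAut.comp h' P) =
      frame (P := (emb U).obj P) γ' rfl := by
  refine (homMk_comp _ _ _ _).trans ?_
  have h1 : homMk (P := (emb U).obj P) (Q := (emb U).obj ((U.τ γ').F.obj P)) γ (TypAut.comp h' P) =
      homMk γ' (𝟙 _) :=
    (Quotient.sound (show Rel (P := (emb U).obj P) (Q := (emb U).obj ((U.τ γ').F.obj P))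
      ⟨γ', 𝟙 _⟩ ⟨γ, TypAut.comp h' P⟩ from ⟨χ, _, TypAut.comp_spec h' P,
        eq_inv_mul_of_mul_eq h.symm, (Category.comp_id _).symm⟩)).symm
  refine Eq.trans (homMk_congr (one_mul γ) ?_) h1
  simp

end ExtCat

/-! ## Framings of simplices of the nerve of the extended category -/

section Framing

variable {p : ℕ} [Fact p.Prime] {S : Type u} [Group S] {F : FusionSystem S}
  {L : LinkingSystem p F} {G : Type u} [Group G] {U : ExtensionPair L G}
  {J : Type} [Category.{0} J]

open ExtCat

/-- The diagram `A` in `L_U` is carried to the diagram `ξ` in `L` by the canonical isomorphisms which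
are given by the elements `u j` of the extension group. -/
structure Framed (u : J → U.Γhat) (A : J ⥤ (ExtCat U)ᵒᵖ) (ξ : J ⥤ L.Objᵒᵖ) : Prop where
  obj : ∀ j, (U.τ (u j)).F.obj (A.obj j).unop.obj = (ξ.obj j).unop
  map : ∀ {i j : J} (f : i ⟶ j), (A.map f).unop ≫ frame (u i) (obj i) =
    frame (u j) (obj j) ≫ (emb U).map (ξ.map f).unop

namespace Framed

variable {u : J → U.Γhat} {A A' : J ⥤ (ExtCat U)ᵒᵖ} {ξ ξ' : J ⥤ L.Objᵒᵖ}

/-- Frames are isomorphisms and the embedding of L is faithful. -/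
lemma right_unique (h : Framed u A ξ) (h' : Framed u A ξ') : ξ = ξ' := by
  obtain ⟨o, m, _, _⟩ := ξ
  obtain ⟨o', m', _, _⟩ := ξ'
  obtain rfl : o = o' := funext fun j => unop_injective ((h.obj j).symm.trans (h'.obj j))
  obtain rfl : @m = @m' := by
    funext i j f
    apply Quiver.Hom.unop_inj
    apply (emb U).map_injective
    exact (cancel_epi (frame (u j) (h.obj j))).1 ((h.map f).symm.trans (h'.map f))
  rfl

/-- Objects are recovered because τ(u j) is invertible on objects, morphisms because frames are
isomorphisms. -/
lemma left_unique (h : Framed u A ξ) (h' : Framed u A' ξ) : A = A' := by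
  obtain ⟨o, m, _, _⟩ := A
  obtain ⟨o', m', _, _⟩ := A'
  obtain rfl : o = o' := funext fun j => unop_injective (ExtCat.ext (by
    have h1 := congrArg (U.τ (u j)).inv.obj ((h.obj j).trans (h'.obj j).symm)
    rwa [TypAut.inv_obj, TypAut.inv_obj] at h1))
  obtain rfl : @m = @m' := by
    funext i j f
    apply Quiver.Hom.unop_inj
    exact (cancel_mono (frame (u i) (h.obj i))).1 ((h.map f).trans (h'.map f).symm)
  rfl

lemma ρ_mul_elt (h : Framed u A ξ) {i j : J} (f : i ⟶ j) :
    U.ρ (u i) * OneObj.elt (A ⋙ (pr U).op) f = U.ρ (u j) := by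
  have h1 := congrArg (fun m => (pr U).map m) (h.map f)
  simp only [Functor.map_comp] at h1
  refine Eq.trans h1 ?_
  exact (congrArg (fun g : G => g * U.ρ (u j)) (pr_map_emb _)).trans (one_mul _)

/-- The necessary condition of `ρ_mul_elt` is also sufficient: it says that A(f) followed by the
frame of u i lies over ρ(u j), so it has a representative with second component u j, whose first
component is the required morphism of L. Functoriality follows by cancelling frames. -/
lemma exists_right (u : J → U.Γhat) (A : J ⥤ (ExtCat U)ᵒᵖ)
    (h : ∀ {i j : J} (f : i ⟶ j), U.ρ (u i) * OneObj.elt (A ⋙ (pr U).op) f = U.ρ (u j)) :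
    ∃ ξ, Framed u A ξ := by
  let o : J → L.Obj := fun j => (U.τ (u j)).F.obj (A.obj j).unop.obj
  have key : ∀ {i j : J} (f : i ⟶ j), ∃ φ : o j ⟶ o i,
      frame (P := (A.obj j).unop) (u j) rfl ≫ (emb U).map φ =
        (A.map f).unop ≫ frame (u i) rfl := fun {i j} f => by
    obtain ⟨φ, hφ⟩ := exists_homMk (Q := (emb U).obj (o i)) ((A.map f).unop ≫ frame (u i) rfl) (u j)
      ((Functor.map_comp _ _ _).trans (h f))
    refine ⟨φ, Eq.trans ?_ hφ⟩
    refine (homMk_comp _ _ _ _).trans (homMk_congr (one_mul _) ?_)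
    simp
  choose m hm using @key
  refine ⟨{ obj := fun j => op (o j), map := fun f => (m f).op, map_id := fun j => ?_,
            map_comp := fun {i j k} f g => ?_ }, fun _ => rfl, fun f => (hm f).symm⟩
  · apply Quiver.Hom.unop_inj
    apply (emb U).map_injective
    apply (cancel_epi (frame (P := (A.obj j).unop) (u j) rfl)).1
    refine (hm (𝟙 j)).trans ?_
    rw [A.map_id, unop_id, Category.id_comp, unop_id, CategoryTheory.Functor.map_id]
    exact (Category.comp_id _).symm
  · apply Quiver.Hom.unop_inj
    apply (emb U).map_injective
    apply (cancel_epi (frame (P := (A.obj k).unop) (u k) rfl)).1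
    refine (hm (f ≫ g)).trans ?_
    rw [A.map_comp, unop_comp, Category.assoc, ← hm f, ← Category.assoc, ← hm g, Category.assoc,
      ← Functor.map_comp]
    rfl

/-- There is no compatibility condition in this direction: conjugating ξ by the frames yields A, and
the u j then determine its image in B(G). -/
lemma exists_left (u : J → U.Γhat) (ξ : J ⥤ L.Objᵒᵖ) : ∃ A, Framed u A ξ := by
  let o : J → ExtCat U := fun j => ⟨(U.τ (u j)).inv.obj (ξ.obj j).unop⟩
  have ho : ∀ j, (U.τ (u j)).F.obj (o j).obj = (ξ.obj j).unop := fun j => TypAut.obj_inv _ _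
  refine ⟨{ obj := fun j => op (o j)
            map := fun {i j} f => (frame (u j) (ho j) ≫ (emb U).map (ξ.map f).unop ≫
              inv (frame (u i) (ho i))).op
            map_id := fun j => ?_
            map_comp := fun {i j k} f g => ?_ }, ho, fun f => ?_⟩
  · apply Quiver.Hom.unop_inj
    rw [ξ.map_id, unop_id, CategoryTheory.Functor.map_id, Category.id_comp]
    exact IsIso.hom_inv_id _
  · apply Quiver.Hom.unop_inj
    rw [ξ.map_comp, unop_comp, Functor.map_comp]
    simp
  · simp

/-- The frame of v j · u j is the frame of u j followed by that of v j. Moving the latter past a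
morphism φ of ξ turns φ into τ(v j)(φ), and passing from v j to v i contributes the component of v i
(v j)⁻¹ ∈ Γ; together these are the action of the simplicial group. -/
lemma smul (h : Framed u A ξ) {v : J → U.Γhat} (hv : ∀ i j, U.ρ (v i) = U.ρ (v j)) :
    Framed (fun j => v j * u j) A (U.diag v hv • ξ) := by
  have e : ∀ j, (U.τ (v j * u j)).F.obj (A.obj j).unop.obj = (U.τ (v j)).F.obj (ξ.obj j).unop :=
    fun j => (τ_mul_obj _ _ _).trans (congrArg _ (h.obj j))
  have e1 : ∀ j, frame (u j) (h.obj j) ≫ frame (P := (emb U).obj (ξ.obj j).unop) (v j) rfl =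
    frame (v j * u j) (e j) := fun j => frame_comp _ _
  refine ⟨e, fun {i j} f => ?_⟩
  have hd : U.τ (v i) = TypAut.c L (AutTyp.chi (U.diag v hv) f) * U.τ (v j) :=
    AutTyp.ob_eq (U.diag v hv) f
  have e2 : ((U.diag v hv • ξ).map f).unop =
      (U.τ (v j)).F.map (ξ.map f).unop ≫ TypAut.comp hd (ξ.obj i).unop := rfl
  have e3 := frame_comp_emb_map (γ := v j) (γ' := v i) (χ := AutTyp.chi (U.diag v hv) f)
    (by rw [ExtensionPair.incl_chi_diag, inv_mul_cancel_right]) (ξ.obj i).unop hd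
  have key : (frame (u j) (h.obj j) ≫ (emb U).map (ξ.map f).unop) ≫
        frame (P := (emb U).obj (ξ.obj i).unop) (v i) rfl =
      frame (v j * u j) (e j) ≫
        (emb U).map ((U.τ (v j)).F.map (ξ.map f).unop ≫ TypAut.comp hd (ξ.obj i).unop) := by
    rw [← e1, ← e3, Functor.map_comp, Category.assoc, Category.assoc, ← Category.assoc (frame _ rfl),
      ← emb_map_frame, Category.assoc]
  have key' : (A.map f).unop ≫ frame (v i * u i) (e i) =
      (frame (u j) (h.obj j) ≫ (emb U).map (ξ.map f).unop) ≫
        frame (P := (emb U).obj (ξ.obj i).unop) (v i) rfl := by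
    rw [← e1, ← Category.assoc, h.map]
  exact key'.trans (key.trans
    (congrArg (fun m => frame (v j * u j) (e j) ≫ (emb U).map m) e2.symm))

lemma whisker {J' : Type} [Category.{0} J'] (h : Framed u A ξ) (Φ : J' ⥤ J) :
    Framed (fun j => u (Φ.obj j)) (Φ ⋙ A) (Φ ⋙ ξ) :=
  ⟨fun j => h.obj (Φ.obj j), fun f => h.map (Φ.map f)⟩

end Framed

end Framing

/-! ## The nerve of the extended category as a twisted cartesian product -/

namespace ExtCat

variable {p : ℕ} [Fact p.Prime] {S : Type u} [Group S] {F : FusionSystem S}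
  {L : LinkingSystem p F} {G : Type u} [Group G] {U : ExtensionPair L G}

open OneObj

lemma arr_eq_of_framed {N : ℕ} {u : Fin (N + 1) → U.Γhat} {A : Fin (N + 1) ⥤ (ExtCat U)ᵒᵖ}
    {ξ : Fin (N + 1) ⥤ L.Objᵒᵖ} (h : Framed u A ξ) (i j : Fin (N + 1)) :
    arr (A ⋙ (pr U).op) i j = (U.ρ (u i))⁻¹ * U.ρ (u j) := by
  have h1 : ∀ j, elt (A ⋙ (pr U).op) (homOfLE (Fin.zero_le j)) = (U.ρ (u 0))⁻¹ * U.ρ (u j) :=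
    fun j => eq_inv_mul_of_mul_eq (h.ρ_mul_elt _)
  rw [arr, h1, h1]
  group

variable {t : G → U.Γhat}

variable (t) in
/-- The framing of a simplex of the nerve of `L_U` which is given by the section `t`. -/
abbrev sectionFrame {N : ℕ} (x : Fin (N + 1) ⥤ (OneObj G)ᵒᵖ) (j : Fin (N + 1)) : U.Γhat :=
  t (arr x 0 j)

lemma exists_framed (ht : ∀ g, U.ρ (t g) = g) {N : ℕ} (A : Fin (N + 1) ⥤ (ExtCat U)ᵒᵖ) :
    ∃ ξ, Framed (sectionFrame t (A ⋙ (pr U).op)) A ξ :=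
  Framed.exists_right _ _ fun f => by rw [ht, ht, elt_eq_arr, arr_mul]

variable (ht : ∀ g, U.ρ (t g) = g)

/-- The twist evaluates the twisting function at the simplex with vertices 0, θ(0), θ(1), …, whose
base vertices 0 and 1 are the vertices 0 and θ(0) of x. -/
lemma twist_twistingFunction {m n : SimplexCategory} (θ : m ⟶ n)
    (x : opNerve (OneObj G) _⦋n.len⦌) :
    (twistingFunction U t ht).twist θ x =
      U.diag (J := Fin (m.len + 1)) (fun j => t (arr (N := n.len) x 0 (θ.toOrderHom j)) *
          (t (arr (N := n.len) x (θ.toOrderHom 0) (θ.toOrderHom j)))⁻¹)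
        (U.ρ_section_arr ht (N := n.len) x _ _ θ.toOrderHom) := by
  have h : ∀ i j : Fin (m.len + 1 + 1), arr (N := m.len + 1) ((opNerve (OneObj G)).map
      (SimplexShift.shift θ).op ((opNerve (OneObj G)).σ 0 x)) i j =
      arr (N := n.len) x ((0 : Fin (n.len + 1)).predAbove ((SimplexShift.shift θ).toOrderHom i))
        ((0 : Fin (n.len + 1)).predAbove ((SimplexShift.shift θ).toOrderHom j)) := fun i j =>
    (arr_map (SimplexShift.shift θ) _ i j).trans (arr_σ 0 x _ _)
  refine U.diag_congr (U.ρ_section_arr ht (N := m.len + 1) _ 0 1 Fin.succ) _ fun j => ?_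
  have h1 : (1 : Fin (m.len + 1 + 1)) = Fin.succ 0 := rfl
  have h2 : ∀ i : Fin (n.len + 1), (0 : Fin (n.len + 1)).predAbove i.succ = i := fun i => by simp
  have h3 : (0 : Fin (n.len + 1)).predAbove (0 : Fin (n.len + 2)) = 0 := rfl
  rw [h, h, h1, SimplexShift.shift_succ, SimplexShift.shift_succ, SimplexShift.shift_zero, h2, h2,
    h3]

/-- The map from the nerve of `L_U` to the twisted cartesian product. -/
def toTwistedProduct :
    opNerve (ExtCat U) ⟶ twistedProduct (twistingFunction U t ht) (opNerve L.Obj) where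
  app n := ↾fun A : Fin (n.unop.len + 1) ⥤ (ExtCat U)ᵒᵖ =>
    ((exists_framed ht A).choose, A ⋙ (pr U).op)
  naturality m n θ := by
    apply ConcreteCategory.hom_ext
    intro (A : Fin (m.unop.len + 1) ⥤ (ExtCat U)ᵒᵖ)
    refine Prod.ext ?_ rfl
    let Φ : Fin (n.unop.len + 1) ⥤ Fin (m.unop.len + 1) := θ.unop.toOrderHom.monotone.functor
    have h := ((exists_framed ht A).choose_spec).whisker Φ
    -- The restricted simplex is framed from its own first vertex θ(0), whereas restricting the
    -- frames of A keeps vertex 0 as the base. Multiplying by the ratio of the frames, which is the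
    -- twist of θ, makes both framings equal, so the two diagrams in L agree.
    have h' := ((exists_framed ht (Φ ⋙ A)).choose_spec).smul
      (U.ρ_section_arr ht (A ⋙ (pr U).op) 0 (θ.unop.toOrderHom 0) θ.unop.toOrderHom)
    have key := eq_inv_smul_iff.2 (h'.right_unique (ξ' := Φ ⋙ (exists_framed ht A).choose) (by
      convert h using 2 with j
      have e : arr ((Φ ⋙ A) ⋙ (pr U).op) 0 j =
          arr (A ⋙ (pr U).op) (θ.unop.toOrderHom 0) (θ.unop.toOrderHom j) :=
        arr_whisker (A ⋙ (pr U).op) Φ 0 j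
      rw [sectionFrame, e, inv_mul_cancel_right]
      rfl))
    refine key.trans ?_
    exact congrArg (fun k : Fin (n.unop.len + 1) ⥤ (AutTyp L)ᵒᵖ =>
      k⁻¹ • (Φ ⋙ (exists_framed ht A).choose)) (twist_twistingFunction ht θ.unop _).symm

/-- The second coordinate fixes the frames, and for fixed frames A and ξ determine each other. For
surjectivity the image in B(G) of the transported diagram is recovered from the frames by
`arr_eq_of_framed`. -/
lemma toTwistedProduct_bijective (n : SimplexCategoryᵒᵖ) :
    Function.Bijective ((toTwistedProduct ht).app n) := by
  constructor
  · intro (A : Fin (n.unop.len + 1) ⥤ (ExtCat U)ᵒᵖ) (A' : Fin (n.unop.len + 1) ⥤ (ExtCat U)ᵒᵖ) h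
    have h1 : (exists_framed ht A).choose = (exists_framed ht A').choose := congrArg Prod.fst h
    have h2 : A ⋙ (pr U).op = A' ⋙ (pr U).op := congrArg Prod.snd h
    have h3 := (exists_framed ht A).choose_spec
    rw [h1, h2] at h3
    exact h3.left_unique (exists_framed ht A').choose_spec
  · rintro ⟨ξ, (x : Fin (n.unop.len + 1) ⥤ (OneObj G)ᵒᵖ)⟩
    obtain ⟨A, hA⟩ := Framed.exists_left (sectionFrame t (N := n.unop.len) x) ξ
    have hx : A ⋙ (pr U).op = x := ext_arr fun i j => by
      rw [arr_eq_of_framed hA, ht, ht, arr_inv, arr_mul]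
    refine ⟨A, Prod.ext ?_ hx⟩
    subst hx
    exact (exists_framed ht A).choose_spec.right_unique hA

lemma exists_iso_twistedProduct :
    ∃ e : opNerve (ExtCat U) ≅ twistedProduct (twistingFunction U t ht) (opNerve L.Obj),
      e.hom ≫ twistedProduct.proj _ (opNerve L.Obj) = opNerveMap (pr U) := by
  have : ∀ n, IsIso ((toTwistedProduct ht).app n) := fun n =>
    (isIso_iff_bijective _).2 (toTwistedProduct_bijective ht n)
  have : IsIso (toTwistedProduct ht) := NatIso.isIso_of_isIso_app _
  exact ⟨asIso (toTwistedProduct ht), rfl⟩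

/-! ## The nerve of the extended category as a quotient of a trivial bundle -/

section

variable {I : Type} [Category.{0} I]

/-- The diagram of automorphisms which relates the framings given by two families of elements of
`G`, one of which is a left translate of the other. -/
def translationDiagram (g : G) (a : I → G) : I ⥤ (AutTyp L)ᵒᵖ :=
  U.diag (fun j => t (g * a j) * (t (a j))⁻¹) fun _ _ => by
    simp only [map_mul, map_inv, ht, mul_inv_cancel_right]

lemma translationDiagram_mul (g h : G) (a : I → G) : translationDiagram ht (g * h) a =
    translationDiagram ht g (fun j => h * a j) * translationDiagram ht h a := by
  unfold translationDiagram
  rw [← U.diag_mul]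
  refine U.diag_congr _ _ fun j => ?_
  rw [mul_assoc g]
  group

/-- The ratios of the new to the old frames all lie over g, so `Framed.smul` applies; this is the
twisted G-action on NL × EG. -/
lemma framed_translate {a : I → G} {A : I ⥤ (ExtCat U)ᵒᵖ} {ξ : I ⥤ L.Objᵒᵖ}
    (h : Framed (fun j => t (a j)) A ξ) (g : G) :
    Framed (fun j => t (g * a j)) A (translationDiagram ht g a • ξ) := by
  have h' := h.smul (v := fun j => t (g * a j) * (t (a j))⁻¹) fun _ _ => by
    simp only [map_mul, map_inv, ht, mul_inv_cancel_right]
  simp only [inv_mul_cancel_right] at h'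
  exact h'

end

lemma ofVertices_eq_iff {N : ℕ} (a b : Fin (N + 1) → G) :
    ofVertices a = ofVertices b ↔ ∃ g, (fun j => g * a j) = b := by
  constructor
  · intro h
    -- The translating element is forced by the vertices at 0; the common values (a 0)⁻¹ a j = (b
    -- 0)⁻¹ b j give the rest.
    refine ⟨b 0 * (a 0)⁻¹, funext fun j => ?_⟩
    have h1 := arr_ofVertices a 0 j
    rw [h, arr_ofVertices] at h1
    rw [mul_assoc, ← h1, mul_inv_cancel_left]
  · rintro ⟨g, rfl⟩
    refine ext_arr fun i j => ?_
    rw [arr_ofVertices, arr_ofVertices]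
    group

/-- One diagram A framed by both a and a' has one image in B(G), so a' = ga for some g. The frame
change then determines ξ' from ξ by `Framed.right_unique`; the converse is `Framed.left_unique`. -/
lemma choose_left_eq_iff {N : ℕ} (ξ ξ' : Fin (N + 1) ⥤ L.Objᵒᵖ) (a a' : Fin (N + 1) → G) :
    (Framed.exists_left (U := U) (fun j => t (a j)) ξ).choose =
        (Framed.exists_left (U := U) (fun j => t (a' j)) ξ').choose ↔
      ∃ g, translationDiagram ht g a • ξ = ξ' ∧ (fun j => g * a j) = a' := by
  have h := (Framed.exists_left (U := U) (fun j => t (a j)) ξ).choose_spec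
  have h' := (Framed.exists_left (U := U) (fun j => t (a' j)) ξ').choose_spec
  constructor
  · intro e
    have hp : ofVertices a = ofVertices a' := ext_arr fun i j => by
      have h1 := arr_eq_of_framed h i j
      rw [e, arr_eq_of_framed h' i j] at h1
      simp only [ht] at h1
      rw [arr_ofVertices, arr_ofVertices, h1]
    obtain ⟨g, rfl⟩ := (ofVertices_eq_iff a a').1 hp
    rw [← e] at h'
    exact ⟨g, (framed_translate ht h g).right_unique h', rfl⟩
  · rintro ⟨g, rfl, rfl⟩
    exact (framed_translate ht h g).left_unique h'

/-- The presentation of the nerve of `L_U` as the quotient of a trivial bundle over the universal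
cover of the classifying space of `G`. -/
def twistedQuotient : TwistedQuotient (opNerve (AutTyp L)) (opNerve L.Obj) (opNerve (ExtCat U))
    (opNerve (OneObj G)) (univCover G) G where
  q := opNerveMap (pr U)
  p :=
    { app n := ↾fun a : Fin (n.unop.len + 1) → G => ofVertices a
      naturality _ _ _ := rfl }
  Ψ :=
    { app n := ↾fun z : (Fin (n.unop.len + 1) ⥤ L.Objᵒᵖ) × (Fin (n.unop.len + 1) → G) =>
        (Framed.exists_left (U := U) (fun j => t (z.2 j)) z.1).choose
      naturality m n θ := by
        apply ConcreteCategory.hom_ext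
        intro (z : (Fin (m.unop.len + 1) ⥤ L.Objᵒᵖ) × (Fin (m.unop.len + 1) → G))
        exact (Framed.exists_left _ _).choose_spec.left_unique
          ((Framed.exists_left (U := U) (fun j => t (z.2 j)) z.1).choose_spec.whisker
            θ.unop.toOrderHom.monotone.functor) }
  ρ := univCover.translate
  κ g :=
    { app n := ↾fun a : Fin (n.unop.len + 1) → G =>
        translationDiagram ht g a
      naturality _ _ _ := rfl }
  Ψ_q := by
    apply NatTrans.ext
    funext n
    apply ConcreteCategory.hom_ext
    intro (z : (Fin (n.unop.len + 1) ⥤ L.Objᵒᵖ) × (Fin (n.unop.len + 1) → G))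
    refine ext_arr (N := n.unop.len) fun i j => ?_
    refine (arr_eq_of_framed (Framed.exists_left (U := U) (fun j => t (z.2 j)) z.1).choose_spec
      i j).trans ?_
    rw [ht, ht]
    exact (arr_ofVertices z.2 i j).symm
  p_surjective n := by
    intro (x : Fin (n.unop.len + 1) ⥤ (OneObj G)ᵒᵖ)
    refine ⟨fun j => arr x 0 j, ext_arr (N := n.unop.len) fun i j => ?_⟩
    refine (arr_ofVertices _ i j).trans ?_
    rw [arr_inv, arr_mul]
  Ψ_surjective n := by
    intro (A : Fin (n.unop.len + 1) ⥤ (ExtCat U)ᵒᵖ)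
    obtain ⟨ξ, hξ⟩ := exists_framed ht A
    exact ⟨(ξ, fun j => arr (A ⋙ (pr U).op) 0 j),
      (Framed.exists_left _ _).choose_spec.left_unique hξ⟩
  ρ_one := by
    apply NatTrans.ext
    funext n
    apply ConcreteCategory.hom_ext
    intro (a : Fin (n.unop.len + 1) → G)
    exact funext fun j => one_mul (a j)
  ρ_mul g h := by
    apply NatTrans.ext
    funext n
    apply ConcreteCategory.hom_ext
    intro (a : Fin (n.unop.len + 1) → G)
    exact funext fun j => mul_assoc g h (a j)
  κ_mul g h n a := translationDiagram_mul ht g h _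
  p_eq_iff n a b := ofVertices_eq_iff (N := n.unop.len) a b
  Ψ_eq_iff n ξ ξ' a b := choose_left_eq_iff ht (N := n.unop.len) ξ ξ' a b
  -- The trivializing sets are indexed by the length s > 0 of the initial segment on which the
  -- majority value of the step function is read off.
  ι := ULift.{u} (Set.Ioi (0 : ℝ))
  V s g := univCover.sheet s.down g
  isOpen_V s g := univCover.isOpen_sheet _ g
  V_disjoint s g g' z h h' := univCover.eq_of_mem_sheet s.down.2 h h'
  ρ_mem_V s g h z hz := univCover.translate_mem_sheet hz
  V_cover z := by
    obtain ⟨s, hs, g, h⟩ := univCover.exists_mem_sheet z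
    exact ⟨⟨s, hs⟩, g, h⟩

end ExtCat

/-! ### The proposition -/

theorem proposition6p5 {p : ℕ} [Fact p.Prime] {S : Type u} [Group S] (hS : IsDiscretePToral p S)
    (F : FusionSystem S) (hF : F.IsSaturated p) (L : LinkingSystem p F)
    (G : Type u) [Group G] [Finite G] (U : ExtensionPair L G)
    (t : G → U.Γhat) (ht : ∀ g, U.ρ (t g) = g) (ht_one : t 1 = 1) :
    ∃ φ : TwistingFunction (opNerve (OneObj G)) (opNerve (AutTyp L)),
      (IsAssociated U t φ ∧ ∀ φ', IsAssociated U t φ' → φ' = φ) ∧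
      (∃ e : opNerve (ExtCat U) ≅ twistedProduct φ (opNerve L.Obj),
        e.hom ≫ twistedProduct.proj φ (opNerve L.Obj) = opNerveMap (ExtCat.pr U)) ∧
      IsFibreBundle (SSet.toTop.map (opNerveMap (ExtCat.pr U)))
        (opNerve (AutTyp L)) (opNerve L.Obj) :=
  ⟨twistingFunction U t ht, ⟨isAssociated_twistingFunction U t ht ht_one,
    fun _ h => (isAssociated_twistingFunction U t ht ht_one).unique h⟩,
    ExtCat.exists_iso_twistedProduct ht, (ExtCat.twistedQuotient ht).isFibreBundle⟩

end
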